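/- Let $d,n\ge 1$ be integers, $0<s<1$, $1\le p\le\infty$, $0<q\le\infty$ and $-n<\alpha<sp-n$ (for $p=\infty$ the upper bound is void, and $(\alpha+n)/p=0$). Write $\mathbb R^{d+n}=\mathbb R^d\times\mathbb R^n$, identify $\mathbb R^d$ with $\mathbb R^d\times\{0\}$, and let $\mu_\alpha$ be the measure on $\mathbb R^{d+n}$ with density $\min(1,\operatorname{dist}(x,\mathbb R^d))^\alpha$ with respect to Lebesgue measure. **Besov spaces.** Let $\mathcal D_{N,k}$ be the set of cubes $2^{-k}((0,1]^N+m)$, $m\in\mathbb Z^N$, let $\mathcal D_N=\bigcup_{k\in\mathbb Z}\mathcal D_{N,k}$ and let $\ell(Q)$ be the edge length of $Q$. Write $Q\sim Q'$ if $\frac12\le \ell(Q)/\ell(Q')\le 2$ and $\overline Q\cap\overline{Q'}\ne\emptyset$, and write $f_{Q,\mu}$ for the $\mu$-average of $f$ over $Q$. For $0<\sigma<1$, $B^\sigma_{p,q}(\mathbb R^N,\mu)$ is the space of complex-valued $f\in L^1_{loc}(\mathbb R^N)$ such that $$\|f\|_{B^\sigma_{p,q}(\mathbb R^N,\mu)}=\|f\|_{L^p(\mathbb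 R^N,\mu)}+\Big(\sum_{k\ge0}2^{k\sigma q}\Big(\sum_{Q\in\mathcal D_{N,k}}\mu(Q)\sum_{Q'\sim Q}|f_{Q,\mu}-f_{Q',\mu}|^p\Big)^{q/p}\Big)^{1/q}<\infty,$$ with suprema in place of the sums if $p=\infty$ or $q=\infty$; $\mu$ is omitted from the notation if it is Lebesgue measure. **Whitney extension.** For $Q\in\mathcal D_{d,k}$, $k\ge 0$, let $\mathcal A_Q$ be the set of $P\in\mathcal D_{d+n,k}$ with $P\subset (Q\times[-2^{-k+1},2^{-k+1}]^n)\setminus(Q\times(-2^{-k},2^{-k})^n)$; these cubes are the part of the Whitney decomposition of $\mathbb R^{d+n}\setminus\mathbb R^d$ with $\ell(P)\le1$. Let $\psi_P:\mathbb R^{d+n}\to[0,1]$ be any smooth functions, indexed by the cubes $P\in\bigcup_{k\ge0}\bigcup_{Q\in\mathcal D_{d,k}}\mathcal A_Q$, such that, with constants $C,c>0$ independent of $P$, $\psi_P$ is Lipschitz with constant $C/\ell(P)$, $\psi_P\ge c$ on $P$, $\operatorname{supp}\psi_P$ is contained in the $\ell(P)/4$-neighbourhood of $P$, and $\sum_{P}\psi_P=1$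 on the union of all these cubes $P$. For $f\in L^1_{loc}(\mathbb R^d)$ put $$\mathcal E f=\sum_{k\ge0}\ \sum_{Q\in\mathcal D_{d,k}}\ \sum_{P\in\mathcal A_Q}\Big(\frac1{|Q|}\int_Q f\Big)\psi_P .$$ **Theorem.** The pair $\big(B^{s-(\alpha+n)/p}_{p,q}(\mathbb R^d),\,B^s_{p,q}(\mathbb R^{d+n},\mu_\alpha)\big)$ is a Whitney trace-extension pair. That is, with $X$ denoting the first and $Y$ the second space: 1. $\mathcal E$ maps $X$ continuously into $Y$: $\mathcal Ef\in Y$ and $\|\mathcal E f\|_Y\le C\|f\|_X$ for all $f\in X$, with $C$ independent of $f$; 2. for every $f\in Y$ the limit $$\mathcal Rf(x)=\lim_{r\to0^+}\frac1{\mu_\alpha(B((x,0),r))}\int_{B((x,0),r)}f\,d\mu_\alpha$$ exists for Lebesgue-almost every $x\in\mathbb R^d$, and $\mathcal Rf\in L^1_{loc}(\mathbb R^d)$; 3. $\mathcal R$ maps $Y$ continuously into $X$: $\mathcal Rf\in X$ and $\|\mathcal Rf\|_X\le C\|f\|_Y$ for all $f\in Y$, with $C$ independent of $f$; 4. $\mathcal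 R(\mathcal Ef)=f$ almost everywhere for every $f\in X$. -/

import Mathlib

open MeasureTheory Filter Topology
open scoped ENNReal NNReal

namespace WhitneyTrace

/-- The Euclidean space with coordinates indexed by `ι`. We use `ι = Fin d` for `ℝ^d`, and
`ι = Fin d ⊕ Fin n` for `ℝ^{d+n} = ℝ^d × ℝ^n`. -/
abbrev E (ι : Type) : Type := EuclideanSpace ℝ ι

/-! ### Dyadic cubes -/

/-- Index of the semi-open dyadic cube `2^{-k} ((0,1]^ι + m)`, with `k = scale`, `m = pos`. -/
structure DyadicCube (ι : Type) where
  scale : ℤ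
  pos : ι → ℤ

namespace DyadicCube

variable {ι : Type}

/-- The edge length `2^{-k}`. -/
noncomputable def side (Q : DyadicCube ι) : ℝ := (2 : ℝ) ^ (-Q.scale)

/-- The cube as a set of points. -/
def toSet (Q : DyadicCube ι) : Set (E ι) :=
  {x | ∀ i, Q.side * (Q.pos i : ℝ) < x i ∧ x i ≤ Q.side * ((Q.pos i : ℝ) + 1)}

/-- Two dyadic cubes are neighbours if their edge lengths differ at most by a factor `2` and
their closures meet. -/
def Neighbor (Q Q' : DyadicCube ι) : Prop :=
  1 / 2 ≤ Q.side / Q'.side ∧ Q.side / Q'.side ≤ 2 ∧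
    (closure Q.toSet ∩ closure Q'.toSet).Nonempty

end DyadicCube

/-! ### Besov spaces -/

section Besov

variable {ι : Type} [Fintype ι]

/-- The `k`-th dyadic oscillation of `f`,
`(∑_{Q ∈ 𝒟_k} μ(Q) ∑_{Q' ∼ Q} |f_{Q,μ} - f_{Q',μ}|^p)^{1/p}`,
respectively `sup_{Q ∈ 𝒟_k} sup_{Q' ∼ Q} |f_{Q,μ} - f_{Q',μ}|` if `p = ∞`. -/
noncomputable def besovLevel (p : ℝ≥0∞) (μ : Measure (E ι)) (f : E ι → ℂ) (k : ℕ) : ℝ≥0∞ :=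
  if p = ∞ then
    ⨆ (Q : {Q : DyadicCube ι // Q.scale = (k : ℤ)})
      (Q' : {Q' : DyadicCube ι // Q.1.Neighbor Q'}),
      ‖(⨍ y in Q.1.toSet, f y ∂μ) - (⨍ y in Q'.1.toSet, f y ∂μ)‖ₑ
  else
    (∑' Q : {Q : DyadicCube ι // Q.scale = (k : ℤ)},
      μ Q.1.toSet * ∑' Q' : {Q' : DyadicCube ι // Q.1.Neighbor Q'},
        ‖(⨍ y in Q.1.toSet, f y ∂μ) - (⨍ y in Q'.1.toSet, f y ∂μ)‖ₑ ^ p.toReal)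
      ^ (1 / p.toReal)

/-- The Besov energy: the `ℓ^q` quasinorm over `k ≥ 0` of `2^{ks} besovLevel p μ f k`. -/
noncomputable def besovEnergy (s : ℝ) (p q : ℝ≥0∞) (μ : Measure (E ι)) (f : E ι → ℂ) : ℝ≥0∞ :=
  if q = ∞ then
    ⨆ k : ℕ, (2 : ℝ≥0∞) ^ ((k : ℝ) * s) * besovLevel p μ f k
  else
    (∑' k : ℕ, ((2 : ℝ≥0∞) ^ ((k : ℝ) * s) * besovLevel p μ f k) ^ q.toReal) ^ (1 / q.toReal)

/-- The dyadic Besov quasinorm of `B^s_{p,q}(ℝ^ι, μ)`. -/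
noncomputable def besovNorm (s : ℝ) (p q : ℝ≥0∞) (μ : Measure (E ι)) (f : E ι → ℂ) : ℝ≥0∞ :=
  eLpNorm f p μ + besovEnergy s p q μ f

/-- The Besov space `B^s_{p,q}(ℝ^ι, μ)`: the functions in `L^1_loc(ℝ^ι)` with finite
Besov quasinorm. -/
def besovSpace (s : ℝ) (p q : ℝ≥0∞) (μ : Measure (E ι)) : Set (E ι → ℂ) :=
  {f | LocallyIntegrable f volume ∧ MemLp f p μ ∧ besovNorm s p q μ f < ∞}

end Besov

/-! ### The weighted measure, the Whitney extension and the trace -/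

section Whitney

variable {d n : ℕ}

/-- The subspace `ℝ^d × {0}` of `ℝ^{d+n}`. -/
def base (d n : ℕ) : Set (E (Fin d ⊕ Fin n)) := {x | ∀ j : Fin n, x (Sum.inr j) = 0}

/-- The embedding `x ↦ (x, 0)` of `ℝ^d` into `ℝ^{d+n}`. -/
noncomputable def embed (n : ℕ) (x : E (Fin d)) : E (Fin d ⊕ Fin n) :=
  WithLp.toLp 2 (Sum.elim (fun i => x i) (fun _ => 0))

/-- The measure `μ_α` on `ℝ^{d+n}` with density `min(1, dist(x, ℝ^d))^α`. -/
noncomputable def weightMeasure (d n : ℕ) (α : ℝ) : Measure (E (Fin d ⊕ Fin n)) :=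
  (volume : Measure (E (Fin d ⊕ Fin n))).withDensity
    fun x => ENNReal.ofReal ((min 1 (Metric.infDist x (base d n))) ^ α)

/-- For a dyadic cube `Q ⊆ ℝ^d` of edge length `ℓ`, the dyadic cubes `P ⊆ ℝ^{d+n}` of edge
length `ℓ` with `P ⊆ (Q × [-2ℓ, 2ℓ]^n) \ (Q × (-ℓ, ℓ)^n)`. -/
def whitneyCubes (n : ℕ) (Q : DyadicCube (Fin d)) : Set (DyadicCube (Fin d ⊕ Fin n)) :=
  {P | P.scale = Q.scale ∧
    P.toSet ⊆
      {x | WithLp.toLp 2 (fun i => x (Sum.inl i)) ∈ Q.toSet ∧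
          ∀ j, x (Sum.inr j) ∈ Set.Icc (-(2 * Q.side)) (2 * Q.side)} \
      {x | WithLp.toLp 2 (fun i => x (Sum.inl i)) ∈ Q.toSet ∧
          ∀ j, x (Sum.inr j) ∈ Set.Ioo (-Q.side) Q.side}}

/-- The dyadic cubes of edge length at most `1`. -/
abbrev SmallCube (d : ℕ) : Type := {Q : DyadicCube (Fin d) // 0 ≤ Q.scale}

/-- All Whitney cubes attached to dyadic cubes of `ℝ^d` of edge length at most `1`. -/
def allWhitneyCubes (d n : ℕ) : Set (DyadicCube (Fin d ⊕ Fin n)) :=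
  ⋃ Q : SmallCube d, whitneyCubes n Q.1

/-- Smooth bump functions subordinate to the Whitney cubes (the values of `ψ` at cubes outside
`allWhitneyCubes d n` are irrelevant). -/
structure IsWhitneyBumps (ψ : DyadicCube (Fin d ⊕ Fin n) → E (Fin d ⊕ Fin n) → ℝ) : Prop where
  smooth : ∀ P ∈ allWhitneyCubes d n, ContDiff ℝ (⊤ : ℕ∞) (ψ P)
  mem_Icc : ∀ P ∈ allWhitneyCubes d n, ∀ x, ψ P x ∈ Set.Icc (0 : ℝ) 1
  lipschitz : ∃ C : ℝ, ∀ P ∈ allWhitneyCubes d n, ∀ x y,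
    |ψ P x - ψ P y| ≤ C / P.side * dist x y
  lower : ∃ c : ℝ, 0 < c ∧ ∀ P ∈ allWhitneyCubes d n, ∀ x ∈ P.toSet, c ≤ ψ P x
  support : ∀ P ∈ allWhitneyCubes d n,
    tsupport (ψ P) ⊆ Metric.thickening (P.side / 4) P.toSet
  partition : ∀ P₀ ∈ allWhitneyCubes d n, ∀ x ∈ P₀.toSet,
    ∑' Q : SmallCube d, ∑' P : whitneyCubes n Q.1, ψ P.1 x = 1

/-- The Whitney extension `∑_Q ∑_{P ∈ 𝒜_Q} (⨍_Q f) ψ_P` of `f`. -/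
noncomputable def whitneyExt (ψ : DyadicCube (Fin d ⊕ Fin n) → E (Fin d ⊕ Fin n) → ℝ)
    (f : E (Fin d) → ℂ) (x : E (Fin d ⊕ Fin n)) : ℂ :=
  ∑' Q : SmallCube d, ∑' P : whitneyCubes n Q.1, (⨍ y in Q.1.toSet, f y) * (ψ P.1 x : ℂ)

/-- The average of `f` over the ball of radius `r` centred at `(x, 0)`. -/
noncomputable def ballAverage (μ : Measure (E (Fin d ⊕ Fin n))) (f : E (Fin d ⊕ Fin n) → ℂ)
    (x : E (Fin d)) (r : ℝ) : ℂ :=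
  ⨍ y in Metric.ball (embed n x) r, f y ∂μ

/-- `f` has a trace at `x`: the averages over the balls centred at `(x, 0)` converge. -/
def HasTraceAt (μ : Measure (E (Fin d ⊕ Fin n))) (f : E (Fin d ⊕ Fin n) → ℂ)
    (x : E (Fin d)) : Prop :=
  ∃ l : ℂ, Tendsto (ballAverage μ f x) (𝓝[>] 0) (𝓝 l)

/-- The trace function, meaningful at the points where `HasTraceAt` holds. -/
noncomputable def trace (μ : Measure (E (Fin d ⊕ Fin n))) (f : E (Fin d ⊕ Fin n) → ℂ)
    (x : E (Fin d)) : ℂ :=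
  limUnder (𝓝[>] 0) (ballAverage μ f x)

/-- `(X, Y)` is a Whitney trace-extension pair, where `X` is a function space on `ℝ^d` with
quasinorm `nX`, `Y` is a function space on `(ℝ^{d+n}, μ)` with quasinorm `nY`, and the Whitney
extension is formed with the bump functions `ψ`. Continuity of the (linear) extension and trace
operators between quasinormed spaces is expressed by boundedness. -/
structure IsWhitneyTraceExtensionPair
    (ψ : DyadicCube (Fin d ⊕ Fin n) → E (Fin d ⊕ Fin n) → ℝ)
    (μ : Measure (E (Fin d ⊕ Fin n)))
    (X : Set (E (Fin d) → ℂ)) (nX : (E (Fin d) → ℂ) → ℝ≥0∞)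
    (Y : Set (E (Fin d ⊕ Fin n) → ℂ)) (nY : (E (Fin d ⊕ Fin n) → ℂ) → ℝ≥0∞) : Prop where
  ext_mem : ∀ f ∈ X, whitneyExt ψ f ∈ Y
  ext_bounded : ∃ C : ℝ≥0, ∀ f ∈ X, nY (whitneyExt ψ f) ≤ C * nX f
  trace_exists : ∀ f ∈ Y, ∀ᵐ x : E (Fin d), HasTraceAt μ f x
  trace_locallyIntegrable : ∀ f ∈ Y, LocallyIntegrable (trace μ f) volume
  trace_mem : ∀ f ∈ Y, trace μ f ∈ X
  trace_bounded : ∃ C : ℝ≥0, ∀ f ∈ Y, nX (trace μ f) ≤ C * nY f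
  trace_ext : ∀ f ∈ X, ∀ᵐ x : E (Fin d), trace μ (whitneyExt ψ f) x = f x

end Whitney

end WhitneyTrace

/-!
Write `σ = s - (α + n) / p`, which is positive by the assumption on `α`. Both Besov norms are
rewritten in terms of the dyadic oscillation `osc μ f k x`, the largest difference between the
`μ`-average of `f` over the cube of edge length `2^{-k}` around `x` and over a neighbouring cube:
up to constants, the Besov energy is the `ℓ^q` norm of `2^{ks} ‖osc μ f k‖_{L^p(μ)}`
(`lq_osc_le_besovEnergy`, `besovEnergy_le_lq_osc`). The exponents match because `μ_α` is the product
of Lebesgue measure on `ℝ^d` and a measure on `ℝ^n` that gives mass `≈ 2^{-k(n+α)}` to a cube or slab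
of width `2^{-k}` at the origin (`exists_fiberMeasure_slab_le`, `exists_le_fiberMeasure_cube`), so
that passing between `L^p(ℝ^d)` and `L^p(ℝ^{d+n}, μ_α)` at height `2^{-k}` costs the factor
`2^{k(α+n)/p}`.

*Trace.* The averages of `f` over the cubes `Q × (0, ℓ(Q)]^n` above the cubes `Q` of edge length
`2^{-k}` change from one scale to the next by at most the oscillation of `f` above `x`, whose
`L^p(ℝ^d)` norm is at most `C 2^{-kσ} ‖f‖`. As `σ > 0`, they converge almost everywhere, and so do
the averages over the balls centred at `(x, 0)`: a ball of radius `≈ 2^{-k}` is compared to the cube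
of that size above `x`, with an error that is a convergent sum of oscillations near `(x, 0)`
(`ae_tendsto_ballAverage`). The trace differs from the average at scale `k` by at most the sum of the
later oscillations, which gives the bound on its Besov norm by a discrete Hardy inequality
(`exists_lq_le_of_le_tsum`, `exists_besovNorm_trace_le`).

*Extension.* At height `≈ 2^{-m}` the extension is a combination of at most a fixed number of bumps,
with coefficients that are averages of `f` over cubes of edge length `≈ 2^{-m}`
(`IsWhitneyBumps.exists_finset`). The oscillation of the extension at scale `k` is estimated in two
regions. Above height `8 · 2^{-k}` the Lipschitz bounds for the bumps give the oscillations of `f` at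
the coarser scales `l ≤ k`, damped by `2^{l-k}` (`exists_enorm_whitneyExt_sub_le`). Below that height
the average of the extension over a cube is compared to the average of `f` over its projection, and
the oscillations of `f` at the finer scales `l` enter on the slabs of height `2^{-l}` only
(`exists_enorm_cubeAvg_whitneyExt_sub_le`). Since `0 < s < 1`, both contributions decay geometrically
in `|k - l|` (`exists_lq_slabNorm_le`). The comparison near `ℝ^d` also shows that the averages of
the extension above `x` have the same limit as the averages of `f` around `x`, which is `f x` at
almost every `x` (`ae_trace_whitneyExt`).
-/

set_option linter.unusedSectionVars false

namespace WhitneyTrace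

/-! ### Dyadic cubes -/

namespace DyadicCube

variable {ι : Type}

theorem ext' {Q Q' : DyadicCube ι} (h : Q.scale = Q'.scale) (h' : Q.pos = Q'.pos) : Q = Q' := by
  cases Q; cases Q'; simp_all

/-- A dyadic cube is the pair of its scale and its position. -/
def equivProd (ι : Type) : DyadicCube ι ≃ ℤ × (ι → ℤ) where
  toFun Q := (Q.scale, Q.pos)
  invFun z := ⟨z.1, z.2⟩
  left_inv _ := rfl
  right_inv _ := rfl

instance [Finite ι] : Countable (DyadicCube ι) := (equivProd ι).countable_iff.2 inferInstance

theorem side_pos (Q : DyadicCube ι) : 0 < Q.side := by unfold side; positivity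

theorem side_eq_inv (Q : DyadicCube ι) : Q.side = ((2 : ℝ) ^ Q.scale)⁻¹ := by
  rw [side, zpow_neg]

theorem mem_toSet {Q : DyadicCube ι} {x : E ι} : x ∈ Q.toSet ↔
    ∀ i, (Q.pos i : ℝ) < 2 ^ Q.scale * x i ∧ 2 ^ Q.scale * x i ≤ Q.pos i + 1 := by
  have h : (0 : ℝ) < 2 ^ Q.scale := by positivity
  simp only [toSet, Set.mem_ofPred_eq, side_eq_inv, inv_mul_lt_iff₀ h, le_inv_mul_iff₀ h]

/-- The closed cube with the same scale and position. -/
def closedBox (Q : DyadicCube ι) : Set (E ι) :=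
  {x | ∀ i, Q.side * (Q.pos i : ℝ) ≤ x i ∧ x i ≤ Q.side * ((Q.pos i : ℝ) + 1)}

theorem mem_closedBox {Q : DyadicCube ι} {x : E ι} : x ∈ Q.closedBox ↔
    ∀ i, (Q.pos i : ℝ) ≤ 2 ^ Q.scale * x i ∧ 2 ^ Q.scale * x i ≤ Q.pos i + 1 := by
  have h : (0 : ℝ) < 2 ^ Q.scale := by positivity
  simp only [closedBox, Set.mem_ofPred_eq, side_eq_inv, inv_mul_le_iff₀ h, le_inv_mul_iff₀ h]

theorem toSet_subset_closedBox (Q : DyadicCube ι) : Q.toSet ⊆ Q.closedBox :=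
  fun _ hx i => ⟨(hx i).1.le, (hx i).2⟩

theorem toSet_eq_preimage (Q : DyadicCube ι) : Q.toSet = (WithLp.ofLp : E ι → ι → ℝ) ⁻¹'
    Set.univ.pi fun i => Set.Ioc (Q.side * (Q.pos i : ℝ)) (Q.side * ((Q.pos i : ℝ) + 1)) := by
  ext x
  simp [toSet, Set.mem_pi]

theorem closure_toSet (Q : DyadicCube ι) : closure Q.toSet = Q.closedBox := by
  have h := (PiLp.homeomorph 2 (fun _ : ι => ℝ)).preimage_closure
    (Set.univ.pi fun i => Set.Ioc (Q.side * (Q.pos i : ℝ)) (Q.side * ((Q.pos i : ℝ) + 1)))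
  rw [toSet_eq_preimage]
  refine h.symm.trans ?_
  rw [closure_pi_set]
  ext x
  have h1 : ∀ i, closure (Set.Ioc (Q.side * (Q.pos i : ℝ)) (Q.side * ((Q.pos i : ℝ) + 1)))
      = Set.Icc (Q.side * (Q.pos i : ℝ)) (Q.side * ((Q.pos i : ℝ) + 1)) := fun i =>
    closure_Ioc (by have := Q.side_pos; nlinarith)
  simp [h1, closedBox, PiLp.homeomorph, Pi.le_def, forall_and]

theorem side_div_side (Q Q' : DyadicCube ι) : Q.side / Q'.side = 2 ^ (Q'.scale - Q.scale) := by
  rw [side, side, ← zpow_sub₀ (two_ne_zero)]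
  congr 1; ring

/-- Two cubes are neighbours if and only if their scales differ at most by one and the closed
cubes have a common point. -/
theorem neighbor_iff {Q Q' : DyadicCube ι} : Q.Neighbor Q' ↔
    Q'.scale ≤ Q.scale + 1 ∧ Q.scale ≤ Q'.scale + 1 ∧ ∃ z, z ∈ Q.closedBox ∧ z ∈ Q'.closedBox := by
  have e1 : (1 / 2 : ℝ) = 2 ^ (-1 : ℤ) := by norm_num
  have e2 : (2 : ℝ) = 2 ^ (1 : ℤ) := by norm_num
  have h1 : (1 / 2 : ℝ) ≤ 2 ^ (Q'.scale - Q.scale) ↔ Q.scale ≤ Q'.scale + 1 := by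
    rw [e1, zpow_le_zpow_iff_right₀ one_lt_two]; constructor <;> intro h <;> linarith
  have h2 : (2 : ℝ) ^ (Q'.scale - Q.scale) ≤ 2 ↔ Q'.scale ≤ Q.scale + 1 := by
    conv_lhs => rw [← zpow_one (2 : ℝ), ← zpow_mul, one_mul]
    rw [zpow_le_zpow_iff_right₀ one_lt_two]; constructor <;> intro h <;> linarith
  rw [Neighbor, side_div_side, closure_toSet, closure_toSet, h1, h2]
  constructor
  · rintro ⟨a, b, z, hz⟩; exact ⟨b, a, z, hz.1, hz.2⟩
  · rintro ⟨a, b, z, hz⟩; exact ⟨b, a, z, hz⟩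

theorem neighbor_of_mem {Q Q' : DyadicCube ι} {z : E ι} (h : Q'.scale ≤ Q.scale + 1)
    (h' : Q.scale ≤ Q'.scale + 1) (hz : z ∈ Q.toSet) (hz' : z ∈ Q'.toSet) : Q.Neighbor Q' :=
  neighbor_iff.2 ⟨h, h', z, Q.toSet_subset_closedBox hz, Q'.toSet_subset_closedBox hz'⟩

/-- The dyadic cube of edge length `2^{-k}` that contains `x`. -/
noncomputable def cubeAt (k : ℤ) (x : E ι) : DyadicCube ι := ⟨k, fun i => ⌈2 ^ k * x i⌉ - 1⟩

@[simp] theorem cubeAt_scale (k : ℤ) (x : E ι) : (cubeAt k x).scale = k := rfl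

theorem mem_cubeAt (k : ℤ) (x : E ι) : x ∈ (cubeAt k x).toSet := by
  rw [mem_toSet]
  intro i
  simp only [cubeAt, Int.cast_sub, Int.cast_one]
  have h1 := Int.ceil_lt_add_one ((2 : ℝ) ^ k * x i)
  have h2 := Int.le_ceil ((2 : ℝ) ^ k * x i)
  constructor <;> linarith

theorem eq_cubeAt {Q : DyadicCube ι} {x : E ι} (h : x ∈ Q.toSet) : Q = cubeAt Q.scale x := by
  refine ext' rfl ?_
  funext i
  have h := mem_toSet.1 h i
  simp only [cubeAt]
  have : ⌈(2 : ℝ) ^ Q.scale * x i⌉ = Q.pos i + 1 := by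
    rw [Int.ceil_eq_iff]
    push_cast
    constructor <;> linarith [h.1, h.2]
  omega

theorem mem_toSet_iff_eq {k : ℤ} {Q : DyadicCube ι} (hQ : Q.scale = k) {x : E ι} :
    x ∈ Q.toSet ↔ cubeAt k x = Q := by
  subst hQ
  exact ⟨fun h => (eq_cubeAt h).symm, fun h => h ▸ mem_cubeAt _ x⟩

theorem toSet_nonempty (Q : DyadicCube ι) : Q.toSet.Nonempty := by
  refine ⟨WithLp.toLp 2 fun i => Q.side * ((Q.pos i : ℝ) + 1), fun i => ?_⟩
  have := Q.side_pos
  refine ⟨?_, le_rfl⟩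
  show _ < Q.side * ((Q.pos i : ℝ) + 1)
  nlinarith

theorem exists_eq_cubeAt (Q : DyadicCube ι) : ∃ x, x ∈ Q.toSet ∧ Q = cubeAt Q.scale x := by
  obtain ⟨x, hx⟩ := Q.toSet_nonempty
  exact ⟨x, hx, eq_cubeAt hx⟩

/-- Cubes of equal size that contain points at distance at most the edge length (in each
coordinate) are neighbours. -/
theorem neighbor_cubeAt {k : ℤ} {x z : E ι} (h : ∀ i, |x i - z i| ≤ 2 ^ (-k)) :
    (cubeAt k x).Neighbor (cubeAt k z) := by
  refine neighbor_iff.2 ⟨by simp, by simp, ?_⟩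
  have hk : (0 : ℝ) < 2 ^ k := by positivity
  set Q := cubeAt k x
  set R := cubeAt k z
  -- the positions of the two cubes differ at most by one, so a corner of one of them is shared
  have key : ∀ i, Q.pos i ≤ R.pos i + 1 ∧ R.pos i ≤ Q.pos i + 1 := by
    intro i
    have hx := mem_toSet.1 (mem_cubeAt k x) i
    have hz := mem_toSet.1 (mem_cubeAt k z) i
    have hd : |2 ^ k * x i - 2 ^ k * z i| ≤ 1 := by
      rw [← mul_sub, abs_mul, abs_of_pos hk]
      calc (2 : ℝ) ^ k * |x i - z i| ≤ 2 ^ k * 2 ^ (-k) := by gcongr; exact h i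
        _ = 1 := by rw [zpow_neg, mul_inv_cancel₀ hk.ne']
    rw [abs_le] at hd
    simp only [cubeAt_scale] at hx hz
    have h1 : (Q.pos i : ℝ) < R.pos i + 2 := by linarith [hx.1, hz.2, hd.2]
    have h2 : (R.pos i : ℝ) < Q.pos i + 2 := by linarith [hx.2, hz.1, hd.1]
    have h1' : Q.pos i < R.pos i + 2 := by exact_mod_cast h1
    have h2' : R.pos i < Q.pos i + 2 := by exact_mod_cast h2
    omega
  refine ⟨WithLp.toLp 2 fun i => 2 ^ (-k) * (max (Q.pos i) (R.pos i) : ℤ), ?_, ?_⟩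
  · rw [mem_closedBox]
    intro i
    have : (2 : ℝ) ^ Q.scale * (2 ^ (-k) * (max (Q.pos i) (R.pos i) : ℤ))
      = (max (Q.pos i) (R.pos i) : ℤ) := by
      rw [← mul_assoc, zpow_neg]; show (2 : ℝ) ^ k * _ * _ = _; rw [mul_inv_cancel₀ hk.ne', one_mul]
    simp only [this]
    have := key i
    constructor
    · exact_mod_cast le_max_left _ _
    · exact_mod_cast max_le (by omega) (by omega)
  · rw [mem_closedBox]
    intro i
    have : (2 : ℝ) ^ R.scale * (2 ^ (-k) * (max (Q.pos i) (R.pos i) : ℤ))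
      = (max (Q.pos i) (R.pos i) : ℤ) := by
      rw [← mul_assoc, zpow_neg]; show (2 : ℝ) ^ k * _ * _ = _; rw [mul_inv_cancel₀ hk.ne', one_mul]
    simp only [this]
    have := key i
    constructor
    · exact_mod_cast le_max_right _ _
    · exact_mod_cast max_le (by omega) (by omega)

/-- The cubes around a point at equal or consecutive scales are neighbours. -/
theorem neighbor_cubeAt_of_scale {k l : ℤ} (x : E ι) (h : l ≤ k + 1) (h' : k ≤ l + 1) :
    (cubeAt k x).Neighbor (cubeAt l x) :=
  neighbor_of_mem h h' (mem_cubeAt k x) (mem_cubeAt l x)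

theorem abs_sub_le_of_mem {Q : DyadicCube ι} {x z : E ι} (hx : x ∈ Q.closedBox)
    (hz : z ∈ Q.closedBox) (i : ι) : |x i - z i| ≤ 2 ^ (-Q.scale) := by
  have h1 := hx i
  have h2 := hz i
  have : Q.side = 2 ^ (-Q.scale) := rfl
  rw [← this, abs_le]
  constructor <;> nlinarith [h1.1, h1.2, h2.1, h2.2]

/-- Points of neighbouring cubes are at distance at most three edge lengths. -/
theorem abs_sub_le_of_neighbor {Q Q' : DyadicCube ι} (h : Q.Neighbor Q') {x z : E ι}
    (hx : x ∈ Q.toSet) (hz : z ∈ Q'.toSet) (i : ι) : |x i - z i| ≤ 3 * 2 ^ (-Q.scale) := by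
  obtain ⟨h1, h2, w, hw, hw'⟩ := neighbor_iff.1 h
  have a := abs_sub_le_of_mem (Q.toSet_subset_closedBox hx) hw i
  have b := abs_sub_le_of_mem hw' (Q'.toSet_subset_closedBox hz) i
  have c : (2 : ℝ) ^ (-Q'.scale) ≤ 2 * 2 ^ (-Q.scale) := by
    rw [← zpow_one_add₀ two_ne_zero]
    exact zpow_le_zpow_right₀ one_le_two (by omega)
  calc |x i - z i| = |(x i - w i) + (w i - z i)| := by ring_nf
    _ ≤ |x i - w i| + |w i - z i| := abs_add_le _ _
    _ ≤ _ := by linarith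

/-- The number of neighbours of a cube is bounded by a constant. -/
theorem card_neighbor_le [Fintype ι] (Q : DyadicCube ι) :
    ENat.card {Q' : DyadicCube ι // Q.Neighbor Q'} ≤ ((3 * 5 ^ Fintype.card ι : ℕ) : ℕ∞) := by
  classical
  let Q₀ : ℤ → ι → ℤ := fun e i => ⌊(2 : ℝ) ^ e * Q.pos i⌋
  have key : ∀ Q' : DyadicCube ι, Q.Neighbor Q' → (Q'.scale - Q.scale ∈ Finset.Icc (-1 : ℤ) 1) ∧
      ∀ i, Q'.pos i - Q₀ (Q'.scale - Q.scale) i ∈ Finset.Icc (-1 : ℤ) 3 := by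
    intro Q' h
    obtain ⟨h1, h2, z, hz, hz'⟩ := neighbor_iff.1 h
    refine ⟨by rw [Finset.mem_Icc]; omega, fun i => ?_⟩
    have a := mem_closedBox.1 hz i
    have b := mem_closedBox.1 hz' i
    set e := Q'.scale - Q.scale with he
    have e2 : (2 : ℝ) ^ e ≤ 2 := by
      calc (2 : ℝ) ^ e ≤ 2 ^ (1 : ℤ) := zpow_le_zpow_right₀ one_le_two (by omega)
        _ = 2 := by norm_num
    have e0 : (0 : ℝ) < 2 ^ e := by positivity
    have e3 : (2 : ℝ) ^ Q'.scale = 2 ^ e * 2 ^ Q.scale := by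
      rw [← zpow_add₀ two_ne_zero]; congr 1; omega
    rw [e3, mul_assoc] at b
    have f1 := Int.floor_le ((2 : ℝ) ^ e * Q.pos i)
    have f2 := Int.lt_floor_add_one ((2 : ℝ) ^ e * Q.pos i)
    have g1 : (2 : ℝ) ^ e * Q.pos i ≤ 2 ^ e * (2 ^ Q.scale * z i) := by gcongr; exact a.1
    have g2 : 2 ^ e * (2 ^ Q.scale * z i) ≤ (2 : ℝ) ^ e * (Q.pos i + 1) := by gcongr; exact a.2
    have c1 : (Q₀ e i : ℝ) - 1 ≤ Q'.pos i := by simp only [Q₀]; linarith [b.2]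
    have c2 : (Q'.pos i : ℝ) ≤ Q₀ e i + 3 := by simp only [Q₀]; nlinarith [b.1]
    have c1' : Q₀ e i - 1 ≤ Q'.pos i := by exact_mod_cast c1
    have c2' : Q'.pos i ≤ Q₀ e i + 3 := by exact_mod_cast c2
    rw [Finset.mem_Icc]; omega
  let F : {Q' : DyadicCube ι // Q.Neighbor Q'} →
      (Finset.Icc (-1 : ℤ) 1) × (ι → Finset.Icc (-1 : ℤ) 3) := fun Q' =>
    (⟨_, (key Q'.1 Q'.2).1⟩, fun i => ⟨_, (key Q'.1 Q'.2).2 i⟩)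
  have hF : Function.Injective F := by
    rintro ⟨Q', h'⟩ ⟨Q'', h''⟩ h
    simp only [F, Prod.mk.injEq, Subtype.mk.injEq] at h
    have hs : Q'.scale = Q''.scale := by omega
    refine Subtype.ext (ext' hs ?_)
    funext i
    have hi := congrArg Subtype.val (congrFun h.2 i)
    dsimp only at hi ⊢
    rw [hs] at hi
    omega
  refine (ENat.card_le_card_of_injective hF).trans ?_
  rw [ENat.card_eq_coe_fintype_card]
  simp

variable [Fintype ι]

theorem measurableSet_toSet (Q : DyadicCube ι) : MeasurableSet Q.toSet := by
  rw [toSet_eq_preimage]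
  exact (MeasurableSet.univ_pi fun i => measurableSet_Ioc).preimage (by fun_prop)

theorem volume_toSet (Q : DyadicCube ι) :
    volume Q.toSet = ENNReal.ofReal (2 ^ (-Q.scale)) ^ Fintype.card ι := by
  rw [toSet_eq_preimage, (PiLp.volume_preserving_ofLp ι).measure_preimage
    (MeasurableSet.univ_pi fun i => measurableSet_Ioc).nullMeasurableSet, Real.volume_pi_Ioc]
  have : ∀ i, Q.side * ((Q.pos i : ℝ) + 1) - Q.side * (Q.pos i) = 2 ^ (-Q.scale) := by
    intro i; rw [side]; ring
  simp [this]

theorem volume_toSet_ne_zero (Q : DyadicCube ι) : volume Q.toSet ≠ 0 := by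
  rw [volume_toSet]
  have : 0 < ENNReal.ofReal (2 ^ (-Q.scale)) := ENNReal.ofReal_pos.2 (by positivity)
  exact (pow_ne_zero _ this.ne')

theorem volume_toSet_ne_top (Q : DyadicCube ι) : volume Q.toSet ≠ ∞ := by
  rw [volume_toSet]; finiteness

theorem dist_le_of_mem {Q : DyadicCube ι} {x z : E ι} (hx : x ∈ Q.closedBox)
    (hz : z ∈ Q.closedBox) : dist x z ≤ √(Fintype.card ι) * 2 ^ (-Q.scale) := by
  rw [EuclideanSpace.dist_eq]
  have hpos : (0 : ℝ) ≤ 2 ^ (-Q.scale) := by positivity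
  rw [← Real.sqrt_sq hpos, ← Real.sqrt_mul (by positivity)]
  apply Real.sqrt_le_sqrt
  calc ∑ i, dist (x i) (z i) ^ 2 ≤ ∑ _i : ι, ((2 : ℝ) ^ (-Q.scale)) ^ 2 := by
        gcongr with i; exact abs_sub_le_of_mem hx hz i
    _ = _ := by simp [Finset.card_univ]

theorem isBounded_toSet (Q : DyadicCube ι) : Bornology.IsBounded Q.toSet :=
  Metric.isBounded_iff.2 ⟨_, fun _ hx _ hz =>
    dist_le_of_mem (Q.toSet_subset_closedBox hx) (Q.toSet_subset_closedBox hz)⟩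

end DyadicCube

end WhitneyTrace

namespace WhitneyTrace

/-! ### `L^p` norms of nonnegative functions -/

section Lp

variable {X : Type*} [MeasurableSpace X] {μ : Measure X} {p : ℝ≥0∞}

theorem eLpNorm_mono_ennreal {f g : X → ℝ≥0∞} (h : ∀ x, f x ≤ g x) :
    eLpNorm f p μ ≤ eLpNorm g p μ :=
  eLpNorm_mono_enorm fun x => by simpa using h x

theorem eLpNorm_const_mul_ennreal_le {f : X → ℝ≥0∞} (hf : Measurable f) (c : ℝ≥0∞) :
    eLpNorm (fun x => c * f x) p μ ≤ c * eLpNorm f p μ := by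
  by_cases hp0 : p = 0
  · simp [hp0]
  by_cases hp : p = ∞
  · subst hp
    simp only [eLpNorm_exponent_top]
    refine eLpNormEssSup_le_of_ae_enorm_bound ?_
    filter_upwards [enorm_ae_le_eLpNormEssSup f μ] with x hx
    simp only [enorm_eq_self] at hx ⊢
    gcongr
  · rw [eLpNorm_eq_lintegral_rpow_enorm_toReal hp0 hp, eLpNorm_eq_lintegral_rpow_enorm_toReal hp0 hp]
    have hp' : 0 < p.toReal := ENNReal.toReal_pos hp0 hp
    simp only [enorm_eq_self, ENNReal.mul_rpow_of_nonneg _ _ hp'.le]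
    rw [lintegral_const_mul _ (hf.pow_const _), ENNReal.mul_rpow_of_nonneg _ _ (by positivity),
      ← ENNReal.rpow_mul, mul_one_div_cancel hp'.ne', ENNReal.rpow_one]

theorem eLpNorm_add_ennreal_le (hp : 1 ≤ p) {f g : X → ℝ≥0∞} (hf : Measurable f)
    (hg : Measurable g) :
    eLpNorm (fun x => f x + g x) p μ ≤ eLpNorm f p μ + eLpNorm g p μ :=
  eLpNorm_add_le hf.aestronglyMeasurable hg.aestronglyMeasurable hp

/-- Minkowski's inequality for countable sums of nonnegative functions. -/
theorem eLpNorm_tsum_ennreal_le (hp : 1 ≤ p) {f : ℕ → X → ℝ≥0∞} (hf : ∀ i, Measurable (f i)) :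
    eLpNorm (fun x => ∑' i, f i x) p μ ≤ ∑' i, eLpNorm (f i) p μ := by
  have hp0 : p ≠ 0 := (zero_lt_one.trans_le hp).ne'
  by_cases hpt : p = ∞
  · subst hpt
    simp only [eLpNorm_exponent_top]
    refine eLpNormEssSup_le_of_ae_enorm_bound ?_
    have : ∀ᵐ x ∂μ, ∀ i, ‖f i x‖ₑ ≤ eLpNormEssSup (f i) μ :=
      ae_all_iff.2 fun i => enorm_ae_le_eLpNormEssSup (f i) μ
    filter_upwards [this] with x hx
    simp only [enorm_eq_self] at hx ⊢
    exact ENNReal.tsum_le_tsum hx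
  · have hp' : 0 < p.toReal := ENNReal.toReal_pos hp0 hpt
    have h1 : ∀ n, eLpNorm (fun x => ∑ i ∈ Finset.range n, f i x) p μ ≤ ∑' i, eLpNorm (f i) p μ := by
      intro n
      have := eLpNorm_sum_le (μ := μ) (p := p) (f := f) (s := Finset.range n)
        (fun i _ => (hf i).aestronglyMeasurable) hp
      have e : (∑ i ∈ Finset.range n, f i) = fun x => ∑ i ∈ Finset.range n, f i x := by
        ext x; simp
      rw [e] at this
      exact this.trans (ENNReal.sum_le_tsum _)
    rw [eLpNorm_eq_lintegral_rpow_enorm_toReal hp0 hpt]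
    simp only [enorm_eq_self]
    rw [one_div, ENNReal.rpow_inv_le_iff hp']
    have h2 : ∀ x, (∑' i, f i x) ^ p.toReal = ⨆ n, (∑ i ∈ Finset.range n, f i x) ^ p.toReal := by
      intro x
      rw [ENNReal.tsum_eq_iSup_nat]
      exact (ENNReal.orderIsoRpow p.toReal hp').map_iSup _
    simp only [h2]
    rw [lintegral_iSup]
    · refine iSup_le fun n => ?_
      have := h1 n
      rw [eLpNorm_eq_lintegral_rpow_enorm_toReal hp0 hpt, one_div,
        ENNReal.rpow_inv_le_iff hp'] at this
      simpa using this
    · intro n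
      exact (Finset.measurable_fun_sum _ fun i _ => hf i).pow_const _
    · intro a b hab x
      dsimp only
      gcongr

theorem eLpNorm_finset_sum_ennreal_le (hp : 1 ≤ p) {κ : Type*} (s : Finset κ) {f : κ → X → ℝ≥0∞}
    (hf : ∀ i, Measurable (f i)) :
    eLpNorm (fun x => ∑ i ∈ s, f i x) p μ ≤ ∑ i ∈ s, eLpNorm (f i) p μ := by
  have := eLpNorm_sum_le (μ := μ) (p := p) (f := f) (s := s)
    (fun i _ => (hf i).aestronglyMeasurable) hp
  have e : (∑ i ∈ s, f i) = fun x => ∑ i ∈ s, f i x := by ext x; simp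
  rwa [e] at this

theorem ae_lt_top_of_eLpNorm_ne_top (hp : 1 ≤ p) {f : X → ℝ≥0∞} (hf : Measurable f)
    (h : eLpNorm f p μ ≠ ∞) : ∀ᵐ x ∂μ, f x < ∞ := by
  have hp0 : p ≠ 0 := (zero_lt_one.trans_le hp).ne'
  by_cases hpt : p = ∞
  · subst hpt
    rw [eLpNorm_exponent_top] at h
    filter_upwards [enorm_ae_le_eLpNormEssSup f μ] with x hx
    rw [enorm_eq_self] at hx
    exact hx.trans_lt h.lt_top
  · have hp' : 0 < p.toReal := ENNReal.toReal_pos hp0 hpt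
    rw [eLpNorm_eq_lintegral_rpow_enorm_toReal hp0 hpt] at h
    simp only [enorm_eq_self] at h
    have h' : ∫⁻ x, f x ^ p.toReal ∂μ ≠ ∞ := by
      intro h2
      rw [h2] at h
      exact h (ENNReal.top_rpow_of_pos (by positivity))
    filter_upwards [ae_lt_top (hf.pow_const _) h'] with x hx
    by_contra h3
    rw [not_lt, top_le_iff] at h3
    rw [h3, ENNReal.top_rpow_of_pos hp'] at hx
    exact lt_irrefl _ hx

/-- If `‖f_k‖_p` is summable over `k`, then `f_k → 0` almost everywhere. -/
theorem ae_tendsto_zero_of_tsum_eLpNorm_ne_top (hp : 1 ≤ p) {f : ℕ → X → ℝ≥0∞}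
    (hf : ∀ i, Measurable (f i)) (h : ∑' i, eLpNorm (f i) p μ ≠ ∞) :
    ∀ᵐ x ∂μ, Tendsto (fun i => f i x) atTop (𝓝 0) := by
  have := ne_top_of_le_ne_top h (eLpNorm_tsum_ennreal_le hp hf)
  filter_upwards [ae_lt_top_of_eLpNorm_ne_top hp (Measurable.tsum hf) this] with x hx
  exact ENNReal.tendsto_atTop_zero_of_tsum_ne_top hx.ne

end Lp

/-! ### Step functions on dyadic cubes and the dyadic oscillation -/

open DyadicCube

variable {ι : Type} [Fintype ι]

theorem measurable_comp_cubeAt {β : Type*} [MeasurableSpace β] (u : DyadicCube ι → β) (k : ℤ) :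
    Measurable fun x : E ι => u (cubeAt k x) := by
  have h1 : Measurable fun x : E ι => (fun i => ⌈(2 : ℝ) ^ k * x i⌉ - 1 : ι → ℤ) := by
    refine measurable_pi_lambda _ fun i => ?_
    have : Measurable fun x : E ι => (2 : ℝ) ^ k * x i := by fun_prop
    exact (Int.measurable_ceil.comp this).sub_const 1
  exact (measurable_of_countable fun m : ι → ℤ => u ⟨k, m⟩).comp h1

/-- The cubes of edge length `2^{-k}`. -/
abbrev Level (ι : Type) (k : ℤ) : Type := {Q : DyadicCube ι // Q.scale = k}

theorem iUnion_level (k : ℤ) : ⋃ Q : Level ι k, Q.1.toSet = Set.univ :=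
  Set.eq_univ_of_forall fun x => Set.mem_iUnion.2 ⟨⟨cubeAt k x, rfl⟩, mem_cubeAt k x⟩

theorem pairwise_disjoint_level (k : ℤ) :
    Pairwise (Function.onFun Disjoint fun Q : Level ι k => Q.1.toSet) := by
  intro Q Q' h
  refine Set.disjoint_left.2 fun x hx hx' => h (Subtype.ext ?_)
  rw [← (mem_toSet_iff_eq Q.2).1 hx, (mem_toSet_iff_eq Q'.2).1 hx']

theorem lintegral_eq_tsum_level (μ : Measure (E ι)) (g : E ι → ℝ≥0∞) (k : ℤ) :
    ∫⁻ x, g x ∂μ = ∑' Q : Level ι k, ∫⁻ x in Q.1.toSet, g x ∂μ := by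
  rw [← lintegral_iUnion (fun Q : Level ι k => Q.1.measurableSet_toSet)
    (pairwise_disjoint_level k), iUnion_level, Measure.restrict_univ]

theorem setLIntegral_comp_cubeAt (μ : Measure (E ι)) (u : DyadicCube ι → ℝ≥0∞) {k : ℤ}
    (Q : Level ι k) : ∫⁻ x in Q.1.toSet, u (cubeAt k x) ∂μ = μ Q.1.toSet * u Q.1 := by
  rw [setLIntegral_congr_fun (g := fun _ => u Q.1) Q.1.measurableSet_toSet, setLIntegral_const,
    mul_comm]
  intro x hx
  simp only [(mem_toSet_iff_eq Q.2).1 hx]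

theorem lintegral_comp_cubeAt (μ : Measure (E ι)) (u : DyadicCube ι → ℝ≥0∞) (k : ℤ) :
    ∫⁻ x, u (cubeAt k x) ∂μ = ∑' Q : Level ι k, μ Q.1.toSet * u Q.1 := by
  rw [lintegral_eq_tsum_level μ _ k]
  exact tsum_congr fun Q => setLIntegral_comp_cubeAt μ u Q

/-- The average of `f` over a dyadic cube. -/
noncomputable def cubeAvg (μ : Measure (E ι)) (f : E ι → ℂ) (Q : DyadicCube ι) : ℂ :=
  ⨍ y in Q.toSet, f y ∂μ

/-- The largest difference between the average of `f` over `Q` and over a neighbour of `Q`. -/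
noncomputable def cubeOsc (μ : Measure (E ι)) (f : E ι → ℂ) (Q : DyadicCube ι) : ℝ≥0∞ :=
  ⨆ Q' : {Q' : DyadicCube ι // Q.Neighbor Q'}, ‖cubeAvg μ f Q - cubeAvg μ f Q'.1‖ₑ

/-- The oscillation at scale `k`, as a function that is constant on the cubes of edge length
`2^{-k}`. -/
noncomputable def osc (μ : Measure (E ι)) (f : E ι → ℂ) (k : ℤ) (x : E ι) : ℝ≥0∞ :=
  cubeOsc μ f (cubeAt k x)

theorem measurable_osc (μ : Measure (E ι)) (f : E ι → ℂ) (k : ℤ) : Measurable (osc μ f k) :=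
  measurable_comp_cubeAt _ k

theorem enorm_sub_le_cubeOsc (μ : Measure (E ι)) (f : E ι → ℂ) {Q Q' : DyadicCube ι}
    (h : Q.Neighbor Q') : ‖cubeAvg μ f Q - cubeAvg μ f Q'‖ₑ ≤ cubeOsc μ f Q :=
  le_iSup (fun Q' : {Q' : DyadicCube ι // Q.Neighbor Q'} => ‖cubeAvg μ f Q - cubeAvg μ f Q'.1‖ₑ)
    ⟨Q', h⟩

theorem eLpNorm_osc_le_besovLevel (p : ℝ≥0∞) (hp : 1 ≤ p) (μ : Measure (E ι)) (f : E ι → ℂ)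
    (k : ℕ) : eLpNorm (osc μ f k) p μ ≤ besovLevel p μ f k := by
  have hp0 : p ≠ 0 := (zero_lt_one.trans_le hp).ne'
  unfold besovLevel
  split_ifs with hpt
  · subst hpt
    rw [eLpNorm_exponent_top]
    refine eLpNormEssSup_le_of_ae_enorm_bound (Eventually.of_forall fun x => ?_)
    rw [enorm_eq_self]
    exact le_iSup (fun Q : Level ι k => cubeOsc μ f Q.1) ⟨cubeAt k x, rfl⟩
  · have hp' : 0 < p.toReal := ENNReal.toReal_pos hp0 hpt
    rw [eLpNorm_eq_lintegral_rpow_enorm_toReal hp0 hpt]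
    simp only [enorm_eq_self]
    gcongr ?_ ^ _
    have := lintegral_comp_cubeAt μ (fun Q => cubeOsc μ f Q ^ p.toReal) k
    simp only [osc]
    rw [this]
    refine ENNReal.tsum_le_tsum fun Q => ?_
    gcongr
    refine ((ENNReal.orderIsoRpow p.toReal hp').map_iSup _).trans_le ?_
    exact iSup_le fun Q' => ENNReal.le_tsum (f := fun Q' : {Q' : DyadicCube ι // Q.1.Neighbor Q'} =>
      ‖cubeAvg μ f Q.1 - cubeAvg μ f Q'.1‖ₑ ^ p.toReal) Q'

/-- Conversely, the oscillation at one scale is controlled by the `L^p` norm of its maximal version,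
since the number of neighbours of a cube is bounded. -/
theorem besovLevel_le_eLpNorm_osc (p : ℝ≥0∞) (hp : 1 ≤ p) (μ : Measure (E ι))
    (hμ : ∀ Q : DyadicCube ι, μ Q.toSet ≠ 0) (f : E ι → ℂ) (k : ℕ) :
    besovLevel p μ f k ≤ ((3 * 5 ^ Fintype.card ι : ℕ) : ℝ≥0∞) * eLpNorm (osc μ f k) p μ := by
  have hp0 : p ≠ 0 := (zero_lt_one.trans_le hp).ne'
  set N : ℕ := 3 * 5 ^ Fintype.card ι with hN
  have hN1 : (1 : ℝ≥0∞) ≤ N := by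
    have : 1 ≤ N := by have : 0 < 5 ^ Fintype.card ι := by positivity
                       omega
    exact_mod_cast this
  unfold besovLevel
  split_ifs with hpt
  · subst hpt
    refine le_trans ?_ (le_mul_of_one_le_left' hN1)
    refine iSup_le fun Q => ?_
    change cubeOsc μ f Q.1 ≤ _
    rw [eLpNorm_exponent_top]
    by_contra! hlt
    have h1 := enorm_ae_le_eLpNormEssSup (osc μ f k) μ
    refine hμ Q.1 (measure_mono_null (fun x hx => ?_) (ae_iff.1 h1))
    rw [Set.mem_ofPred_eq, not_le, enorm_eq_self, osc, (mem_toSet_iff_eq Q.2).1 hx]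
    exact hlt
  · have hp' : 0 < p.toReal := ENNReal.toReal_pos hp0 hpt
    have hp1 : 1 ≤ p.toReal := by
      rw [← ENNReal.toReal_one]; exact ENNReal.toReal_mono hpt hp
    rw [eLpNorm_eq_lintegral_rpow_enorm_toReal hp0 hpt]
    simp only [enorm_eq_self]
    have e : (N : ℝ≥0∞) = ((N : ℝ≥0∞) ^ p.toReal) ^ (1 / p.toReal) := by
      rw [← ENNReal.rpow_mul, mul_one_div_cancel hp'.ne', ENNReal.rpow_one]
    rw [e, ← ENNReal.mul_rpow_of_nonneg _ _ (by positivity)]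
    gcongr ?_ ^ _
    have := lintegral_comp_cubeAt μ (fun Q => cubeOsc μ f Q ^ p.toReal) k
    simp only [osc]
    rw [this, ← ENNReal.tsum_mul_left]
    refine ENNReal.tsum_le_tsum fun Q => ?_
    rw [mul_left_comm]
    gcongr
    calc ∑' Q' : {Q' : DyadicCube ι // Q.1.Neighbor Q'},
          ‖cubeAvg μ f Q.1 - cubeAvg μ f Q'.1‖ₑ ^ p.toReal
        ≤ ∑' _ : {Q' : DyadicCube ι // Q.1.Neighbor Q'}, cubeOsc μ f Q.1 ^ p.toReal := by
          refine ENNReal.tsum_le_tsum fun Q' => ?_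
          gcongr
          exact enorm_sub_le_cubeOsc μ f Q'.2
      _ ≤ (N : ℝ≥0∞) * cubeOsc μ f Q.1 ^ p.toReal := by
          rw [ENNReal.tsum_const]
          gcongr
          have := card_neighbor_le Q.1
          rw [← hN] at this
          calc ((ENat.card {Q' : DyadicCube ι // Q.1.Neighbor Q'} : ℕ∞) : ℝ≥0∞)
              ≤ ((N : ℕ∞) : ℝ≥0∞) := ENat.toENNReal_le.2 this
            _ = N := by simp
      _ ≤ (N : ℝ≥0∞) ^ p.toReal * cubeOsc μ f Q.1 ^ p.toReal := by
          gcongr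
          exact ENNReal.le_rpow_self_of_one_le hN1 hp1

end WhitneyTrace

namespace WhitneyTrace

/-! ### Averages over cubes -/

section Average

variable {X : Type*} [MeasurableSpace X] {μ : Measure X}

theorem enorm_average_sub_le [IsFiniteMeasure μ] [NeZero μ] {f : X → ℂ} (hf : Integrable f μ)
    (c : ℂ) : ‖(⨍ x, f x ∂μ) - c‖ₑ ≤ ⨍⁻ x, ‖f x - c‖ₑ ∂μ := by
  have hprob : IsProbabilityMeasure ((μ Set.univ)⁻¹ • μ) := inferInstance
  have hint : Integrable f ((μ Set.univ)⁻¹ • μ) :=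
    hf.smul_measure (by simp [NeZero.ne μ])
  have : (⨍ x, f x ∂μ) - c = ∫ x, (f x - c) ∂((μ Set.univ)⁻¹ • μ) := by
    rw [average, integral_sub hint (integrable_const _)]
    simp
  rw [this]
  exact enorm_integral_le_lintegral_enorm _

/-- Jensen's inequality for the average of a nonnegative function. -/
theorem laverage_rpow_le [IsFiniteMeasure μ] [NeZero μ] {h : X → ℝ≥0∞} (hh : AEMeasurable h μ)
    {r : ℝ} (hr : 1 ≤ r) : (⨍⁻ x, h x ∂μ) ^ r ≤ ⨍⁻ x, h x ^ r ∂μ := by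
  have hprob : IsProbabilityMeasure ((μ Set.univ)⁻¹ • μ) := inferInstance
  have hh' : AEMeasurable h ((μ Set.univ)⁻¹ • μ) := hh.smul_measure _
  have h1 := eLpNorm_le_eLpNorm_of_exponent_le (μ := (μ Set.univ)⁻¹ • μ) (f := h) (p := 1)
    (q := ENNReal.ofReal r) (by simpa using ENNReal.ofReal_le_ofReal hr)
    hh'.aestronglyMeasurable
  rw [eLpNorm_one_eq_lintegral_enorm, eLpNorm_eq_lintegral_rpow_enorm_toReal (by simp; linarith)
    (by simp), ENNReal.toReal_ofReal (by linarith), one_div,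
    ENNReal.le_rpow_inv_iff (by linarith)] at h1
  simpa [laverage] using h1

end Average

open DyadicCube

variable {ι : Type} [Fintype ι]

/-- The average of a nonnegative function over a dyadic cube. -/
noncomputable def cubeLavg (μ : Measure (E ι)) (h : E ι → ℝ≥0∞) (Q : DyadicCube ι) : ℝ≥0∞ :=
  ⨍⁻ x in Q.toSet, h x ∂μ

theorem cubeLavg_eq (μ : Measure (E ι)) (h : E ι → ℝ≥0∞) (Q : DyadicCube ι) :
    cubeLavg μ h Q = (∫⁻ x in Q.toSet, h x ∂μ) / μ Q.toSet := by
  rw [cubeLavg, setLAverage_eq]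

theorem enorm_cubeAvg_sub_le {μ : Measure (E ι)} {f : E ι → ℂ} {Q : DyadicCube ι}
    (hf : IntegrableOn f Q.toSet μ) (h0 : μ Q.toSet ≠ 0) (ht : μ Q.toSet ≠ ∞) (c : ℂ) :
    ‖cubeAvg μ f Q - c‖ₑ ≤ cubeLavg μ (fun x => ‖f x - c‖ₑ) Q := by
  have : IsFiniteMeasure (μ.restrict Q.toSet) := ⟨by simpa using ht.lt_top⟩
  have : NeZero (μ.restrict Q.toSet) := ⟨by simpa using h0⟩
  exact enorm_average_sub_le hf c

theorem enorm_cubeAvg_le (μ : Measure (E ι)) (f : E ι → ℂ) (Q : DyadicCube ι) :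
    ‖cubeAvg μ f Q‖ₑ ≤ cubeLavg μ (fun x => ‖f x‖ₑ) Q :=
  enorm_integral_le_lintegral_enorm _

theorem cubeLavg_mono {μ : Measure (E ι)} {g h : E ι → ℝ≥0∞} {Q : DyadicCube ι}
    (hgh : ∀ x ∈ Q.toSet, g x ≤ h x) : cubeLavg μ g Q ≤ cubeLavg μ h Q := by
  rw [cubeLavg_eq, cubeLavg_eq]
  gcongr ?_ / _
  exact setLIntegral_mono' Q.measurableSet_toSet hgh

theorem cubeLavg_mono_ae {μ : Measure (E ι)} {g h : E ι → ℝ≥0∞} {Q : DyadicCube ι}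
    (hgh : ∀ᵐ x ∂μ, x ∈ Q.toSet → g x ≤ h x) : cubeLavg μ g Q ≤ cubeLavg μ h Q := by
  rw [cubeLavg_eq, cubeLavg_eq]
  gcongr ?_ / _
  exact setLIntegral_mono_ae' Q.measurableSet_toSet hgh

theorem cubeLavg_const {μ : Measure (E ι)} {Q : DyadicCube ι} (h0 : μ Q.toSet ≠ 0)
    (ht : μ Q.toSet ≠ ∞) (c : ℝ≥0∞) : cubeLavg μ (fun _ => c) Q = c := by
  rw [cubeLavg_eq, setLIntegral_const, ENNReal.mul_div_cancel_right h0 ht]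

theorem eLpNorm_cubeLavg_le {μ : Measure (E ι)} (h0 : ∀ Q : DyadicCube ι, μ Q.toSet ≠ 0)
    (ht : ∀ Q : DyadicCube ι, μ Q.toSet ≠ ∞) {p : ℝ≥0∞} (hp : 1 ≤ p) {h : E ι → ℝ≥0∞}
    (hh : AEMeasurable h μ) (k : ℤ) {τ : DyadicCube ι → DyadicCube ι} (hτ : Function.Injective τ)
    (hs : ∀ Q, (τ Q).scale = Q.scale) (hμτ : ∀ Q, μ (τ Q).toSet = μ Q.toSet) :
    eLpNorm (fun x => cubeLavg μ h (τ (cubeAt k x))) p μ ≤ eLpNorm h p μ := by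
  have hp0 : p ≠ 0 := (zero_lt_one.trans_le hp).ne'
  by_cases hpt : p = ∞
  · subst hpt
    rw [eLpNorm_exponent_top, eLpNorm_exponent_top]
    refine eLpNormEssSup_le_of_ae_enorm_bound (Eventually.of_forall fun x => ?_)
    rw [enorm_eq_self]
    refine (laverage_le_essSup _).trans ?_
    simp only [eLpNormEssSup, enorm_eq_self]
    exact essSup_mono_measure' Measure.restrict_le_self
  · have hp' : 0 < p.toReal := ENNReal.toReal_pos hp0 hpt
    have hp1 : 1 ≤ p.toReal := by
      rw [← ENNReal.toReal_one]; exact ENNReal.toReal_mono hpt hp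
    rw [eLpNorm_eq_lintegral_rpow_enorm_toReal hp0 hpt,
      eLpNorm_eq_lintegral_rpow_enorm_toReal hp0 hpt]
    simp only [enorm_eq_self]
    gcongr ?_ ^ _
    rw [lintegral_comp_cubeAt μ (fun Q => cubeLavg μ h (τ Q) ^ p.toReal) k,
      lintegral_eq_tsum_level μ _ k]
    have key : ∀ Q : Level ι k, μ Q.1.toSet * cubeLavg μ h (τ Q.1) ^ p.toReal ≤
        ∫⁻ x in (τ Q.1).toSet, h x ^ p.toReal ∂μ := by
      intro Q
      have : IsFiniteMeasure (μ.restrict (τ Q.1).toSet) := ⟨by simpa using (ht _).lt_top⟩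
      have : NeZero (μ.restrict (τ Q.1).toSet) := ⟨by simpa using h0 _⟩
      rw [← hμτ]
      calc μ (τ Q.1).toSet * cubeLavg μ h (τ Q.1) ^ p.toReal
          ≤ μ (τ Q.1).toSet * cubeLavg μ (fun x => h x ^ p.toReal) (τ Q.1) := by
            gcongr; exact laverage_rpow_le hh.restrict hp1
        _ = _ := by
            rw [cubeLavg_eq, ENNReal.mul_div_cancel (h0 _) (ht _)]
    refine (ENNReal.tsum_le_tsum key).trans ?_
    let σ : Level ι k → Level ι k := fun Q => ⟨τ Q.1, (hs Q.1).trans Q.2⟩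
    have hσ : Function.Injective σ := fun Q Q' hQ => by
      simp only [σ, Subtype.mk.injEq] at hQ
      exact Subtype.ext (hτ hQ)
    exact ENNReal.tsum_comp_le_tsum_of_injective hσ
      (fun Q : Level ι k => ∫⁻ x in Q.1.toSet, h x ^ p.toReal ∂μ)

attribute [irreducible] cubeLavg

/-- The translate of a dyadic cube by `e` edge lengths. -/
def DyadicCube.shift (e : ι → ℤ) (Q : DyadicCube ι) : DyadicCube ι := ⟨Q.scale, Q.pos + e⟩

/-- The translations by at most three edge lengths in every coordinate. -/
noncomputable def nbrOffsets (ι : Type) [Fintype ι] : Finset (ι → ℤ) := by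
  classical exact Fintype.piFinset fun _ : ι => Finset.Icc (-3 : ℤ) 3

theorem mem_nbrOffsets {e : ι → ℤ} : e ∈ nbrOffsets ι ↔ ∀ i, e i ∈ Finset.Icc (-3 : ℤ) 3 := by
  classical exact Fintype.mem_piFinset

theorem card_nbrOffsets : (nbrOffsets ι).card = 7 ^ Fintype.card ι := by
  classical
  rw [nbrOffsets, Fintype.card_piFinset]
  simp

/-- The sum of the averages of `h` over the translates of `Q` by at most three edge lengths;
it dominates the average over every neighbour of `Q`. -/
noncomputable def nbrAvg (h : E ι → ℝ≥0∞) (Q : DyadicCube ι) : ℝ≥0∞ :=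
  ∑ e ∈ nbrOffsets ι, cubeLavg volume h (Q.shift e)

theorem measurable_comp_shift (c : DyadicCube ι → ℝ≥0∞) (k : ℤ) (e : ι → ℤ) :
    Measurable fun x : E ι => c ((cubeAt k x).shift e) :=
  measurable_comp_cubeAt (fun Q => c (Q.shift e)) k

theorem eLpNorm_nbrAvg_le {p : ℝ≥0∞} (hp : 1 ≤ p) {h : E ι → ℝ≥0∞} (hh : AEMeasurable h volume)
    (k : ℤ) :
    eLpNorm (fun x => nbrAvg h (cubeAt k x)) p volume ≤
      ((7 ^ Fintype.card ι : ℕ) : ℝ≥0∞) * eLpNorm h p volume := by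
  have hm := fun e => measurable_comp_shift (cubeLavg volume h) k e
  refine (eLpNorm_finset_sum_ennreal_le (μ := volume) hp (nbrOffsets ι) hm).trans ?_
  refine (Finset.sum_le_card_nsmul _ _ (eLpNorm h p volume) fun e _ => ?_).trans ?_
  · refine eLpNorm_cubeLavg_le (fun Q => Q.volume_toSet_ne_zero) (fun Q => Q.volume_toSet_ne_top) hp
      hh k (τ := DyadicCube.shift e) ?_ (fun _ => rfl) ?_
    · intro Q Q' hQ
      simp only [DyadicCube.shift, DyadicCube.mk.injEq, add_left_inj] at hQ
      exact DyadicCube.ext' hQ.1 hQ.2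
    · intro Q; simp [volume_toSet, DyadicCube.shift]
  · rw [nsmul_eq_mul, card_nbrOffsets]

theorem cubeLavg_le_nbrAvg (h : E ι → ℝ≥0∞) {Q Q' : DyadicCube ι} (hQ : Q.Neighbor Q') :
    cubeLavg volume h Q' ≤ 2 ^ Fintype.card ι * nbrAvg h Q := by
  obtain ⟨x, hx, hQx⟩ := Q.exists_eq_cubeAt
  set I := nbrOffsets ι with hI
  have hsub : Q'.toSet ⊆ ⋃ e ∈ I, (Q.shift e).toSet := by
    intro z hz
    have hd := abs_sub_le_of_neighbor hQ hx hz
    set R := cubeAt Q.scale z with hR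
    have key : ∀ i, R.pos i - Q.pos i ∈ Finset.Icc (-3 : ℤ) 3 := by
      intro i
      have hx' := mem_toSet.1 hx i
      have hz' := mem_toSet.1 (mem_cubeAt Q.scale z) i
      have hd' : |2 ^ Q.scale * x i - 2 ^ Q.scale * z i| ≤ 3 := by
        have hk : (0 : ℝ) < 2 ^ Q.scale := by positivity
        rw [← mul_sub, abs_mul, abs_of_pos hk]
        calc (2 : ℝ) ^ Q.scale * |x i - z i| ≤ 2 ^ Q.scale * (3 * 2 ^ (-Q.scale)) := by
              gcongr; exact hd i
          _ = 3 := by rw [zpow_neg]; field_simp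
      rw [abs_le] at hd'
      rw [← hR, show R.scale = Q.scale from rfl] at hz'
      have h1 : (Q.pos i : ℝ) < R.pos i + 4 := by linarith [hx'.1, hz'.2, hd'.2]
      have h2 : (R.pos i : ℝ) < Q.pos i + 4 := by linarith [hx'.2, hz'.1, hd'.1]
      have h1' : Q.pos i < R.pos i + 4 := by exact_mod_cast h1
      have h2' : R.pos i < Q.pos i + 4 := by exact_mod_cast h2
      rw [Finset.mem_Icc]; omega
    refine Set.mem_iUnion₂.2 ⟨R.pos - Q.pos, ?_, ?_⟩
    · rw [hI, mem_nbrOffsets]; exact key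
    · have : Q.shift (R.pos - Q.pos) = R := DyadicCube.ext' rfl (by simp [DyadicCube.shift])
      rw [this]; exact mem_cubeAt _ _
  have hvol : volume Q.toSet ≤ 2 ^ Fintype.card ι * volume Q'.toSet := by
    rw [volume_toSet, volume_toSet, ← mul_pow]
    gcongr
    have := (neighbor_iff.1 hQ).1
    calc ENNReal.ofReal (2 ^ (-Q.scale)) ≤ ENNReal.ofReal (2 * 2 ^ (-Q'.scale)) := by
          apply ENNReal.ofReal_le_ofReal
          rw [← zpow_one_add₀ two_ne_zero]
          exact zpow_le_zpow_right₀ one_le_two (by omega)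
      _ = _ := by rw [ENNReal.ofReal_mul (by norm_num)]; simp
  have hshift : ∀ e, volume (Q.shift e).toSet = volume Q.toSet := fun e => by
    simp [volume_toSet, DyadicCube.shift]
  have h1 : ∫⁻ x in Q'.toSet, h x ≤ volume Q.toSet * nbrAvg h Q := by
    calc ∫⁻ x in Q'.toSet, h x ≤ ∫⁻ x in ⋃ e ∈ I, (Q.shift e).toSet, h x :=
          lintegral_mono_set hsub
      _ ≤ ∑ e ∈ I, ∫⁻ x in (Q.shift e).toSet, h x := by
          have : ∀ S : Set (E ι), MeasurableSet S →
              ∫⁻ x in S, h x = (volume.withDensity h) S := fun S hS => (withDensity_apply h hS).symm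
          rw [this _ (Finset.measurableSet_biUnion _ fun e _ => measurableSet_toSet _)]
          refine (measure_biUnion_finset_le _ _).trans_eq (Finset.sum_congr rfl fun e _ => ?_)
          rw [this _ (measurableSet_toSet _)]
      _ = volume Q.toSet * nbrAvg h Q := by
          rw [nbrAvg, Finset.mul_sum]
          refine Finset.sum_congr rfl fun e _ => ?_
          rw [cubeLavg_eq, hshift, ENNReal.mul_div_cancel Q.volume_toSet_ne_zero Q.volume_toSet_ne_top]
  rw [cubeLavg_eq]
  refine ENNReal.div_le_of_le_mul (h1.trans ?_)
  calc volume Q.toSet * nbrAvg h Q ≤ 2 ^ Fintype.card ι * volume Q'.toSet * nbrAvg h Q := by gcongr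
    _ = _ := by ring

theorem measurable_nbrAvg (h : E ι → ℝ≥0∞) (k : ℤ) :
    Measurable fun x => nbrAvg h (cubeAt k x) := measurable_comp_cubeAt _ k

end WhitneyTrace

namespace WhitneyTrace
open DyadicCube

variable {ι : Type} [Fintype ι]

/-! ### Lebesgue differentiation along dyadic cubes -/

/-- Lebesgue's differentiation theorem along the dyadic cubes that contain a point, deduced from the
theorem for balls. -/
theorem ae_tendsto_average_cube_norm_sub {F : Type*} [NormedAddCommGroup F] {g : E ι → F}
    (hg : LocallyIntegrable g volume) : ∀ᵐ x : E ι, Tendsto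
      (fun k : ℕ => ⨍ y in (cubeAt k x).toSet, ‖g y - g x‖) atTop (𝓝 0) := by
  have H := IsUnifLocDoublingMeasure.ae_tendsto_average_norm_sub
    (μ := (volume : Measure (E ι))) hg 1
  set a : ℝ := √(Fintype.card ι) + 1 with ha
  have ha0 : 0 < a := by positivity
  let δ : ℕ → ℝ := fun k => a * 2 ^ (-(k : ℤ))
  have hδ0 : ∀ k, 0 < δ k := fun k => by positivity
  have hδ : Tendsto δ atTop (𝓝[>] 0) := by
    refine tendsto_nhdsWithin_iff.2 ⟨?_, Eventually.of_forall hδ0⟩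
    have h1 : Tendsto (fun k : ℕ => a * (1 / 2 : ℝ) ^ k) atTop (𝓝 (a * 0)) :=
      (tendsto_pow_atTop_nhds_zero_of_lt_one (by norm_num) (by norm_num)).const_mul a
    rw [mul_zero] at h1
    refine h1.congr fun k => ?_
    simp [δ, zpow_neg]
  set b : ℝ := (a ^ Module.finrank ℝ (E ι)) * volume.real (Metric.ball (0 : E ι) 1) with hb
  filter_upwards [H] with x hx
  have hx' := hx (fun _ : ℕ => x) δ hδ (Eventually.of_forall fun k => by
    simp [(hδ0 k).le])
  have hlim := hx'.const_mul b
  rw [mul_zero] at hlim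
  refine squeeze_zero (fun k => ?_) (fun k => ?_) hlim
  · rw [setAverage_eq, smul_eq_mul]
    exact mul_nonneg (by positivity) (integral_nonneg fun _ => norm_nonneg _)
  · have hsub : (cubeAt k x).toSet ⊆ Metric.closedBall x (δ k) := by
      intro y hy
      have := dist_le_of_mem ((cubeAt k x).toSet_subset_closedBox hy)
        ((cubeAt k x).toSet_subset_closedBox (mem_cubeAt k x))
      rw [Metric.mem_closedBall]
      refine this.trans ?_
      simp only [δ, cubeAt_scale, ha]
      gcongr
      linarith
    have hint : IntegrableOn (fun y => ‖g y - g x‖) (Metric.closedBall x (δ k)) volume :=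
      ((hg.integrableOn_isCompact (isCompact_closedBall _ _)).sub
        (integrableOn_const (measure_closedBall_lt_top.ne))).norm
    rw [setAverage_eq, setAverage_eq, smul_eq_mul, smul_eq_mul]
    have hv : volume.real (Metric.closedBall x (δ k)) = b * volume.real (cubeAt k x).toSet := by
      rw [measureReal_def, Measure.addHaar_closedBall _ _ (hδ0 k).le, measureReal_def,
        volume_toSet, hb, measureReal_def]
      rw [ENNReal.toReal_mul, ENNReal.toReal_ofReal (by have := hδ0 k; positivity),
        ENNReal.toReal_pow, ENNReal.toReal_ofReal (by positivity), finrank_euclideanSpace]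
      simp only [δ, cubeAt_scale]
      ring_nf
    have hv0 : 0 < volume.real (cubeAt k x).toSet :=
      ENNReal.toReal_pos (volume_toSet_ne_zero _) (volume_toSet_ne_top _)
    have hb0 : 0 < b := by
      have : 0 < volume.real (Metric.ball (0 : E ι) 1) :=
        ENNReal.toReal_pos (Metric.measure_ball_pos _ _ one_pos).ne' measure_ball_lt_top.ne
      positivity
    rw [hv, mul_inv, ← mul_assoc, ← mul_assoc, mul_inv_cancel₀ hb0.ne', one_mul]
    gcongr
    exact Eventually.of_forall fun _ => norm_nonneg _

theorem ae_tendsto_average_cube {F : Type*} [NormedAddCommGroup F] [NormedSpace ℝ F]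
    [CompleteSpace F] {g : E ι → F} (hg : LocallyIntegrable g volume) : ∀ᵐ x : E ι, Tendsto
      (fun k : ℕ => ⨍ y in (cubeAt k x).toSet, g y) atTop (𝓝 (g x)) := by
  filter_upwards [ae_tendsto_average_cube_norm_sub hg] with x hx
  rw [tendsto_iff_norm_sub_tendsto_zero]
  refine squeeze_zero (fun k => norm_nonneg _) (fun k => ?_) hx
  set Q := cubeAt k x
  have : IsFiniteMeasure (volume.restrict Q.toSet) :=
    ⟨by simpa using Q.volume_toSet_ne_top.lt_top⟩
  have : NeZero (volume.restrict Q.toSet) := ⟨by simpa using Q.volume_toSet_ne_zero⟩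
  have hint : IntegrableOn g Q.toSet volume :=
    (hg.integrableOn_isCompact Q.isBounded_toSet.isCompact_closure).mono_set subset_closure
  have h2 : Integrable g ((volume.restrict Q.toSet Set.univ)⁻¹ • volume.restrict Q.toSet) :=
    hint.smul_measure (by simp [Q.volume_toSet_ne_zero])
  have : (⨍ y in Q.toSet, g y) - g x = ⨍ y in Q.toSet, (g y - g x) := by
    rw [average, average, integral_sub h2 (integrable_const _), integral_const, probReal_univ,
      one_smul]
  rw [this]
  exact norm_integral_le_integral_norm _

/-- Lebesgue's differentiation theorem along dyadic cubes for a measure with a positive density. -/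
theorem ae_tendsto_cubeAvg_withDensity {w : E ι → ℝ≥0} (hw : Measurable w)
    (hw0 : ∀ᵐ x : E ι, w x ≠ 0)
    (hwl : LocallyIntegrable (fun x => (w x : ℝ)) volume) {f : E ι → ℂ}
    (hf : LocallyIntegrable (fun x => w x • f x) volume) :
    ∀ᵐ x : E ι, Tendsto
      (fun k : ℕ => cubeAvg (volume.withDensity fun x => (w x : ℝ≥0∞)) f (cubeAt k x))
      atTop (𝓝 (f x)) := by
  filter_upwards [ae_tendsto_average_cube hwl, ae_tendsto_average_cube hf, hw0] with x h1 h2 h0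
  have h0' : (w x : ℝ) ≠ 0 := by exact_mod_cast h0
  have h3 := (h1.inv₀ h0').smul h2
  have e : ((w x : ℝ))⁻¹ • w x • f x = f x := by
    rw [NNReal.smul_def, smul_smul, inv_mul_cancel₀ h0', one_smul]
  rw [e] at h3
  refine h3.congr fun k => ?_
  set Q := cubeAt k x
  have hv0 : volume.real Q.toSet ≠ 0 :=
    (ENNReal.toReal_pos (volume_toSet_ne_zero _) (volume_toSet_ne_top _)).ne'
  have hμ : (volume.withDensity fun x => (w x : ℝ≥0∞)).real Q.toSet = ∫ y in Q.toSet, (w y : ℝ) := by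
    rw [measureReal_def, withDensity_apply _ Q.measurableSet_toSet,
      integral_eq_lintegral_of_nonneg_ae (Eventually.of_forall fun _ => NNReal.coe_nonneg _)
        (by fun_prop)]
    simp
  have hI : ∫ y in Q.toSet, f y ∂(volume.withDensity fun x => (w x : ℝ≥0∞)) =
      ∫ y in Q.toSet, w y • f y := by
    rw [restrict_withDensity Q.measurableSet_toSet, integral_withDensity_eq_integral_smul hw]
  rw [cubeAvg, setAverage_eq, setAverage_eq, setAverage_eq, hI, hμ, smul_smul, smul_eq_mul, mul_inv,
    inv_inv]
  congr 1
  field_simp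

/-- The distance between a function and its average over the cube of edge length `2^{-k}` is at most
the sum of the oscillations at the scales from `k` on. -/
theorem enorm_sub_cubeAvg_le_tsum_osc {μ : Measure (E ι)} {f : E ι → ℂ} {x : E ι}
    (h : Tendsto (fun k : ℕ => cubeAvg μ f (cubeAt k x)) atTop (𝓝 (f x))) (k : ℕ) :
    ‖f x - cubeAvg μ f (cubeAt k x)‖ₑ ≤ ∑' i : ℕ, osc μ f ((k + i : ℕ) : ℤ) x := by
  have := edist_le_tsum_of_edist_le_of_tendsto (f := fun k : ℕ => cubeAvg μ f (cubeAt k x))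
    (fun k : ℕ => osc μ f (k : ℤ) x) (fun n => ?_) h k
  · rwa [edist_comm, edist_eq_enorm_sub] at this
  · rw [edist_eq_enorm_sub]
    exact enorm_sub_le_cubeOsc _ _ (neighbor_cubeAt_of_scale x (by push_cast; omega)
      (by push_cast; omega))

/-- The averages over nested cubes differ by at most the sum of the intermediate oscillations. -/
theorem enorm_cubeAvg_sub_cubeAvg_le (μ : Measure (E ι)) (f : E ι → ℂ) (x : E ι) (k m : ℕ) :
    ‖cubeAvg μ f (cubeAt (k + m : ℕ) x) - cubeAvg μ f (cubeAt k x)‖ₑ ≤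
      ∑ i ∈ Finset.range m, osc μ f ((k + i : ℕ) : ℤ) x := by
  induction m with
  | zero => simp
  | succ m ih =>
    rw [Finset.sum_range_succ, add_comm (Finset.sum _ _)]
    rw [show cubeAvg μ f (cubeAt (k + (m + 1) : ℕ) x) - cubeAvg μ f (cubeAt k x) =
      (cubeAvg μ f (cubeAt (k + (m + 1) : ℕ) x) - cubeAvg μ f (cubeAt (k + m : ℕ) x)) +
      (cubeAvg μ f (cubeAt (k + m : ℕ) x) - cubeAvg μ f (cubeAt k x)) by ring]
    refine (enorm_add_le _ _).trans (add_le_add ?_ ih)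
    rw [← enorm_neg, neg_sub]
    exact enorm_sub_le_cubeOsc _ _ (neighbor_cubeAt_of_scale x (by push_cast; omega)
      (by push_cast; omega))

end WhitneyTrace

namespace WhitneyTrace
open DyadicCube

/-! ### The product structure of the weighted measure -/

section Split

variable {d n : ℕ}

/-- The projection `ℝ^{d+n} → ℝ^d`. -/
noncomputable def proj (y : E (Fin d ⊕ Fin n)) : E (Fin d) :=
  WithLp.toLp 2 fun i => y (Sum.inl i)

/-- The projection `ℝ^{d+n} → ℝ^n`. -/
noncomputable def vert (y : E (Fin d ⊕ Fin n)) : E (Fin n) :=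
  WithLp.toLp 2 fun j => y (Sum.inr j)

/-- The maximum norm on `ℝ^n`, which is adapted to cubes. -/
noncomputable def supNorm (v : E (Fin n)) : ℝ := ‖(WithLp.ofLp v : Fin n → ℝ)‖

/-- The distance of a point to `ℝ^d × {0}` in the maximum norm. -/
noncomputable def height (y : E (Fin d ⊕ Fin n)) : ℝ := supNorm (vert y)

@[simp] theorem proj_apply (y : E (Fin d ⊕ Fin n)) (i : Fin d) : proj y i = y (Sum.inl i) := rfl
@[simp] theorem vert_apply (y : E (Fin d ⊕ Fin n)) (j : Fin n) : vert y j = y (Sum.inr j) := rfl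

@[fun_prop] theorem continuous_proj : Continuous (proj : E (Fin d ⊕ Fin n) → E (Fin d)) := by
  unfold proj; fun_prop

@[fun_prop] theorem continuous_vert : Continuous (vert : E (Fin d ⊕ Fin n) → E (Fin n)) := by
  unfold vert; fun_prop

@[fun_prop] theorem measurable_proj : Measurable (proj : E (Fin d ⊕ Fin n) → E (Fin d)) :=
  continuous_proj.measurable

@[fun_prop] theorem measurable_vert : Measurable (vert : E (Fin d ⊕ Fin n) → E (Fin n)) :=
  continuous_vert.measurable

@[fun_prop] theorem continuous_supNorm : Continuous (supNorm : E (Fin n) → ℝ) := by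
  unfold supNorm; fun_prop

theorem abs_le_supNorm (v : E (Fin n)) (j : Fin n) : |v j| ≤ supNorm v :=
  norm_le_pi_norm (WithLp.ofLp v) j

theorem supNorm_le_iff {v : E (Fin n)} {r : ℝ} (hr : 0 ≤ r) : supNorm v ≤ r ↔ ∀ j, |v j| ≤ r :=
  pi_norm_le_iff_of_nonneg hr

theorem supNorm_nonneg (v : E (Fin n)) : 0 ≤ supNorm v := norm_nonneg _

theorem supNorm_le_norm (v : E (Fin n)) : supNorm v ≤ ‖v‖ :=
  (supNorm_le_iff (norm_nonneg _)).2 fun j => PiLp.norm_apply_le v j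

theorem norm_le_supNorm (v : E (Fin n)) : ‖v‖ ≤ √n * supNorm v := by
  rw [EuclideanSpace.norm_eq, ← Real.sqrt_sq (supNorm_nonneg v), ← Real.sqrt_mul (by positivity)]
  apply Real.sqrt_le_sqrt
  calc ∑ i, ‖v i‖ ^ 2 ≤ ∑ _i : Fin n, supNorm v ^ 2 := by
        gcongr with i; exact abs_le_supNorm v i
    _ = _ := by simp

theorem height_nonneg (y : E (Fin d ⊕ Fin n)) : 0 ≤ height y := supNorm_nonneg _

theorem abs_le_height (y : E (Fin d ⊕ Fin n)) (j : Fin n) : |y (Sum.inr j)| ≤ height y :=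
  abs_le_supNorm (vert y) j

theorem height_le_iff {y : E (Fin d ⊕ Fin n)} {r : ℝ} (hr : 0 ≤ r) :
    height y ≤ r ↔ ∀ j, |y (Sum.inr j)| ≤ r := supNorm_le_iff hr

@[fun_prop] theorem measurable_height : Measurable (height : E (Fin d ⊕ Fin n) → ℝ) :=
  (continuous_supNorm.comp continuous_vert).measurable

/-- The height is Lipschitz in the maximum norm. -/
theorem height_le_add {y z : E (Fin d ⊕ Fin n)} {r : ℝ} (h : ∀ i, |y i - z i| ≤ r) (hr : 0 ≤ r) :
    height y ≤ height z + r := by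
  rw [height_le_iff (add_nonneg (height_nonneg z) hr)]
  intro j
  have h1 := abs_le_height z j
  have h2 := h (Sum.inr j)
  calc |y (Sum.inr j)| = |z (Sum.inr j) + (y (Sum.inr j) - z (Sum.inr j))| := by ring_nf
    _ ≤ _ := (abs_add_le _ _).trans (add_le_add h1 h2)

theorem norm_vert_le_dist {x z : E (Fin d ⊕ Fin n)} (hz : z ∈ base d n) : ‖vert x‖ ≤ dist x z := by
  rw [EuclideanSpace.dist_eq, EuclideanSpace.norm_eq]
  apply Real.sqrt_le_sqrt
  rw [Fintype.sum_sum_type]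
  have : ∀ j : Fin n, dist (x (Sum.inr j)) (z (Sum.inr j)) ^ 2 = ‖vert x j‖ ^ 2 := by
    intro j
    rw [hz j, dist_zero_right]; rfl
  simp only [this]
  have : 0 ≤ ∑ i : Fin d, dist (x (Sum.inl i)) (z (Sum.inl i)) ^ 2 := by positivity
  linarith

theorem dist_embed_proj (x : E (Fin d ⊕ Fin n)) : dist x (embed n (proj x)) = ‖vert x‖ := by
  rw [EuclideanSpace.dist_eq, EuclideanSpace.norm_eq, Fintype.sum_sum_type]
  simp [embed]

theorem embed_mem_base (x : E (Fin d)) : embed n x ∈ base d n := fun j => by simp [embed]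

theorem infDist_base (x : E (Fin d ⊕ Fin n)) : Metric.infDist x (base d n) = ‖vert x‖ := by
  apply le_antisymm
  · rw [← dist_embed_proj]
    exact Metric.infDist_le_dist_of_mem (embed_mem_base _)
  · exact (Metric.le_infDist ⟨_, embed_mem_base 0⟩).2 fun z hz => norm_vert_le_dist hz

/-- The density `min(1, |v|)^α` on the fibres `ℝ^n`. -/
noncomputable def weight (n : ℕ) (α : ℝ) (v : E (Fin n)) : ℝ≥0 := Real.toNNReal ((min 1 ‖v‖) ^ α)

/-- The measure on the fibres `ℝ^n` with density `min(1, |v|)^α`. -/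
noncomputable def fiberMeasure (n : ℕ) (α : ℝ) : Measure (E (Fin n)) :=
  volume.withDensity fun v => (weight n α v : ℝ≥0∞)

@[fun_prop] theorem measurable_weight (α : ℝ) : Measurable (weight n α) := by
  unfold weight; fun_prop

theorem weightMeasure_eq (d n : ℕ) (α : ℝ) : weightMeasure d n α =
    volume.withDensity fun y => (weight n α (vert y) : ℝ≥0∞) := by
  simp only [weightMeasure, infDist_base]
  rfl

theorem weightMeasure_zero (d n : ℕ) : weightMeasure d n 0 = volume := by
  simp [weightMeasure_eq, weight]

theorem measurePreserving_split : MeasurePreserving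
    (fun y : E (Fin d ⊕ Fin n) => (proj y, vert y)) volume (volume.prod volume) := by
  have h1 := PiLp.volume_preserving_ofLp (Fin d ⊕ Fin n)
  have h2 := measurePreserving_sumPiEquivProdPi (fun _ : Fin d ⊕ Fin n => (volume : Measure ℝ))
  have h3 := (PiLp.volume_preserving_toLp (Fin d)).prod (PiLp.volume_preserving_toLp (Fin n))
  exact h3.comp (h2.comp h1)

theorem measurePreserving_split_weight (α : ℝ) : MeasurePreserving
    (fun y : E (Fin d ⊕ Fin n) => (proj y, vert y)) (weightMeasure d n α)
    (volume.prod (fiberMeasure n α)) := by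
  refine ⟨by fun_prop, ?_⟩
  have hm : Measurable fun v : E (Fin n) => (weight n α v : ℝ≥0∞) := by fun_prop
  rw [fiberMeasure, prod_withDensity_right hm, weightMeasure_eq]
  ext S hS
  have hφ : Measurable (fun y : E (Fin d ⊕ Fin n) => (proj y, vert y)) := by fun_prop
  rw [Measure.map_apply hφ hS, withDensity_apply _ (hφ hS), withDensity_apply _ hS,
    ← measurePreserving_split.map_eq, setLIntegral_map hS (by fun_prop) hφ]

/-- The weighted measure of a product set. -/
theorem weightMeasure_inter (α : ℝ) {A : Set (E (Fin d))} {R : Set (E (Fin n))}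
    (hA : MeasurableSet A) (hR : MeasurableSet R) :
    weightMeasure d n α (proj ⁻¹' A ∩ vert ⁻¹' R) = volume A * fiberMeasure n α R := by
  have : SFinite (fiberMeasure n α) := by unfold fiberMeasure; infer_instance
  rw [← Measure.prod_prod, ← (measurePreserving_split_weight α).measure_preimage
    (hA.prod hR).nullMeasurableSet]
  rfl

theorem map_proj_restrict (α : ℝ) {R : Set (E (Fin n))} (hR : MeasurableSet R) :
    ((weightMeasure d n α).restrict (vert ⁻¹' R)).map proj = fiberMeasure n α R • volume := by
  ext A hA
  rw [Measure.map_apply measurable_proj hA, Measure.restrict_apply (measurable_proj hA),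
    weightMeasure_inter α hA hR, Measure.smul_apply, smul_eq_mul, mul_comm]

theorem eLpNorm_comp_proj_restrict (α : ℝ) {R : Set (E (Fin n))} (hR : MeasurableSet R)
    (hR0 : fiberMeasure n α R ≠ 0) (p : ℝ≥0∞) {g : E (Fin d) → ℝ≥0∞} (hg : Measurable g) :
    eLpNorm (fun y => g (proj y)) p ((weightMeasure d n α).restrict (vert ⁻¹' R)) =
      fiberMeasure n α R ^ (p⁻¹).toReal * eLpNorm g p volume := by
  have := eLpNorm_map_measure (μ := (weightMeasure d n α).restrict (vert ⁻¹' R)) (p := p)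
    (f := proj) (g := g) hg.aestronglyMeasurable measurable_proj.aemeasurable
  rw [map_proj_restrict α hR, eLpNorm_smul_measure_of_ne_zero hR0] at this
  rw [← one_div, ← smul_eq_mul, this]
  rfl

theorem setLIntegral_comp_proj (α : ℝ) {A : Set (E (Fin d))} {R : Set (E (Fin n))}
    (hA : MeasurableSet A) (hR : MeasurableSet R) {g : E (Fin d) → ℝ≥0∞} (hg : Measurable g) :
    ∫⁻ y in proj ⁻¹' A ∩ vert ⁻¹' R, g (proj y) ∂(weightMeasure d n α) =
      fiberMeasure n α R * ∫⁻ x in A, g x := by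
  rw [← Measure.restrict_restrict (measurable_proj hA), ← setLIntegral_map hA hg measurable_proj,
    map_proj_restrict α hR, Measure.restrict_smul, lintegral_smul_measure, smul_eq_mul]

/-- The cube in `ℝ^d` that is the projection of a cube in `ℝ^{d+n}`. -/
def projCube (P : DyadicCube (Fin d ⊕ Fin n)) : DyadicCube (Fin d) :=
  ⟨P.scale, fun i => P.pos (Sum.inl i)⟩

/-- The cube in `ℝ^n` that is the projection of a cube in `ℝ^{d+n}`. -/
def vertCube (P : DyadicCube (Fin d ⊕ Fin n)) : DyadicCube (Fin n) :=
  ⟨P.scale, fun j => P.pos (Sum.inr j)⟩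

theorem projCube_cubeAt (k : ℤ) (y : E (Fin d ⊕ Fin n)) :
    projCube (cubeAt k y) = cubeAt k (proj y) := rfl

theorem toSet_eq_inter (P : DyadicCube (Fin d ⊕ Fin n)) :
    P.toSet = proj ⁻¹' (projCube P).toSet ∩ vert ⁻¹' (vertCube P).toSet := by
  ext y
  simp only [mem_toSet, Set.mem_inter_iff, Set.mem_preimage, Sum.forall, projCube, vertCube,
    proj_apply, vert_apply]

theorem weightMeasure_toSet (α : ℝ) (P : DyadicCube (Fin d ⊕ Fin n)) :
    weightMeasure d n α P.toSet =
      volume (projCube P).toSet * fiberMeasure n α (vertCube P).toSet := by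
  rw [toSet_eq_inter, weightMeasure_inter α (measurableSet_toSet _) (measurableSet_toSet _)]

theorem Neighbor.projCube {P P' : DyadicCube (Fin d ⊕ Fin n)} (h : P.Neighbor P') :
    (projCube P).Neighbor (WhitneyTrace.projCube P') := by
  obtain ⟨h1, h2, z, hz, hz'⟩ := neighbor_iff.1 h
  exact neighbor_iff.2 ⟨h1, h2, proj z, fun i => hz (Sum.inl i), fun i => hz' (Sum.inl i)⟩

end Split

/-! ### Estimates for the weight on the fibres -/

theorem rpow_le_of_comparable {a c C l : ℝ} (hc : 0 < c) (hl : 0 < l) (h1 : c * l ≤ a)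
    (h2 : a ≤ C * l) (α : ℝ) : a ^ α ≤ (c ^ α + C ^ α) * l ^ α := by
  have ha : 0 < a := lt_of_lt_of_le (by positivity) h1
  have hC : 0 < C := by
    by_contra! h
    have : C * l ≤ 0 := mul_nonpos_of_nonpos_of_nonneg h hl.le
    linarith
  rcases le_total 0 α with h | h
  · calc a ^ α ≤ (C * l) ^ α := Real.rpow_le_rpow ha.le h2 h
      _ = C ^ α * l ^ α := Real.mul_rpow hC.le hl.le
      _ ≤ _ := by gcongr; linarith [Real.rpow_nonneg hc.le α]
  · calc a ^ α ≤ (c * l) ^ α := Real.rpow_le_rpow_of_nonpos (by positivity) h1 h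
      _ = c ^ α * l ^ α := Real.mul_rpow hc.le hl.le
      _ ≤ _ := by gcongr; linarith [Real.rpow_nonneg hC.le α]

theorem ofReal_two_rpow (r : ℝ) : ENNReal.ofReal ((2 : ℝ) ^ r) = (2 : ℝ≥0∞) ^ r := by
  rw [← ENNReal.ofReal_rpow_of_pos two_pos]; simp

theorem two_rpow_ne_zero (r : ℝ) : (2 : ℝ≥0∞) ^ r ≠ 0 := by
  rw [← ofReal_two_rpow]; exact (ENNReal.ofReal_pos.2 (by positivity)).ne'

theorem two_rpow_ne_top (r : ℝ) : (2 : ℝ≥0∞) ^ r ≠ ∞ := by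
  rw [← ofReal_two_rpow]; exact ENNReal.ofReal_ne_top

theorem two_rpow_add (r t : ℝ) : (2 : ℝ≥0∞) ^ (r + t) = 2 ^ r * 2 ^ t :=
  ENNReal.rpow_add _ _ two_ne_zero (by simp)

theorem tsum_two_rpow_ne_top {δ : ℝ} (hδ : 0 < δ) : ∑' i : ℕ, (2 : ℝ≥0∞) ^ (-(i : ℝ) * δ) ≠ ∞ := by
  have h : ∀ i : ℕ, (2 : ℝ≥0∞) ^ (-(i : ℝ) * δ) = ((2 : ℝ≥0∞) ^ (-δ)) ^ i := by
    intro i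
    rw [← ENNReal.rpow_natCast, ← ENNReal.rpow_mul]; congr 1; ring
  simp only [h]
  rw [ENNReal.tsum_geometric]
  refine ENNReal.inv_ne_top.2 (tsub_pos_of_lt ?_).ne'
  rw [← ofReal_two_rpow, ← ENNReal.ofReal_one]
  exact (ENNReal.ofReal_lt_ofReal_iff one_pos).2
    (Real.rpow_lt_one_of_one_lt_of_neg one_lt_two (by linarith))

variable {n : ℕ}

/-- The set of points of `ℝ^n` of maximum norm at most `16 * 2^{-k}`. The constant leaves room for
the neighbours of the cubes of edge length `2^{-k}` at height at most `8 * 2^{-k}`. -/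
def slab (n : ℕ) (k : ℤ) : Set (E (Fin n)) := {v | supNorm v ≤ 16 * 2 ^ (-k)}

theorem measurableSet_slab (k : ℤ) : MeasurableSet (slab n k) :=
  measurableSet_le continuous_supNorm.measurable measurable_const

theorem volume_slab (k : ℕ) :
    volume (slab n k) = ENNReal.ofReal ((32 * (2 : ℝ) ^ (-(k : ℤ))) ^ n) := by
  have h : slab n k = (WithLp.ofLp : E (Fin n) → Fin n → ℝ) ⁻¹'
      Metric.closedBall 0 (16 * 2 ^ (-(k : ℤ))) := by
    ext v; simp [slab, supNorm]
  rw [h, (PiLp.volume_preserving_ofLp (Fin n)).measure_preimage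
    measurableSet_closedBall.nullMeasurableSet, Real.volume_pi_closedBall _ (by positivity)]
  simp only [Fintype.card_fin]
  congr 2; ring

theorem two_zpow_rpow (k : ℕ) (α : ℝ) : ((2 : ℝ) ^ (-(k : ℤ))) ^ α = 2 ^ (-(k : ℝ) * α) := by
  rw [← Real.rpow_intCast, ← Real.rpow_mul two_pos.le]
  congr 1; push_cast; ring

/-- The weighted measure of a slab of width comparable to `2^{-k}` is at most `C 2^{-k(n+α)}`. -/
theorem exists_fiberMeasure_slab_le (hn : 1 ≤ n) {α : ℝ} (hα : -(n : ℝ) < α) :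
    ∃ C : ℝ≥0, ∀ k : ℕ, fiberMeasure n α (slab n k) ≤ C * (2 : ℝ≥0∞) ^ (-(k : ℝ) * (n + α)) := by
  let K : ℝ := (1 ^ α + (16 * √n) ^ α) * 32 ^ n
  have hK : 0 ≤ K := by positivity
  let S : ℝ≥0∞ := ∑' i : ℕ, (2 : ℝ≥0∞) ^ (-(i : ℝ) * (n + α))
  have hS : S ≠ ∞ := tsum_two_rpow_ne_top (by linarith)
  let shell : ℕ → Set (E (Fin n)) := fun i => {v | 8 * 2 ^ (-(i : ℤ)) < supNorm v} ∩ slab n i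
  have hshell_meas : ∀ i, MeasurableSet (shell i) := fun i =>
    (measurableSet_lt measurable_const continuous_supNorm.measurable).inter (measurableSet_slab _)
  -- the bound on one dyadic shell, where the weight is comparable to a constant
  have hshell : ∀ i : ℕ, fiberMeasure n α (shell i) ≤
      ENNReal.ofReal K * (2 : ℝ≥0∞) ^ (-(i : ℝ) * (n + α)) := by
    intro i
    have hl : (0 : ℝ) < 2 ^ (-(i : ℤ)) := by positivity
    have hl1 : (2 : ℝ) ^ (-(i : ℤ)) ≤ 1 := zpow_le_one_of_nonpos₀ one_le_two (by omega)
    rw [fiberMeasure, withDensity_apply _ (hshell_meas i)]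
    calc ∫⁻ v in shell i, (weight n α v : ℝ≥0∞)
        ≤ ∫⁻ _ in shell i, ENNReal.ofReal ((1 ^ α + (16 * √n) ^ α) * (2 ^ (-(i : ℤ))) ^ α) := by
          refine setLIntegral_mono' (hshell_meas i) fun v hv => ?_
          refine ENNReal.ofReal_le_ofReal (rpow_le_of_comparable one_pos hl ?_ ?_ α)
          · have h1 : 8 * 2 ^ (-(i : ℤ)) < supNorm v := hv.1
            have h2 := supNorm_le_norm v
            rw [one_mul]
            exact le_min hl1 (by linarith)
          · have h1 : supNorm v ≤ 16 * 2 ^ (-(i : ℤ)) := hv.2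
            calc min 1 ‖v‖ ≤ ‖v‖ := min_le_right _ _
              _ ≤ √n * supNorm v := norm_le_supNorm v
              _ ≤ √n * (16 * 2 ^ (-(i : ℤ))) := by gcongr
              _ = _ := by ring
      _ = ENNReal.ofReal ((1 ^ α + (16 * √n) ^ α) * (2 ^ (-(i : ℤ))) ^ α) * volume (shell i) := by
          rw [setLIntegral_const]
      _ ≤ ENNReal.ofReal ((1 ^ α + (16 * √n) ^ α) * (2 ^ (-(i : ℤ))) ^ α) *
          ENNReal.ofReal ((32 * (2 : ℝ) ^ (-(i : ℤ))) ^ n) := by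
          gcongr
          rw [← volume_slab]
          exact measure_mono Set.inter_subset_right
      _ = ENNReal.ofReal K * (2 : ℝ≥0∞) ^ (-(i : ℝ) * (n + α)) := by
          rw [← ofReal_two_rpow, ← ENNReal.ofReal_mul (by positivity),
            ← ENNReal.ofReal_mul (by positivity)]
          congr 1
          rw [two_zpow_rpow, mul_pow, ← Real.rpow_natCast ((2 : ℝ) ^ (-(i : ℤ))), two_zpow_rpow,
            mul_add, Real.rpow_add two_pos]
          simp only [K]; ring
  refine ⟨(ENNReal.ofReal K * S).toNNReal, fun k => ?_⟩
  rw [ENNReal.coe_toNNReal (by finiteness)]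
  have hsub : slab n k ⊆ {0} ∪ ⋃ i : ℕ, shell (k + i) := by
    intro v hv
    by_cases h0 : v = 0
    · exact Or.inl h0
    right
    have hpos : 0 < supNorm v / 16 := by
      have : 0 < supNorm v := norm_pos_iff.2 (fun h => h0 (by ext j; exact congrFun h j))
      positivity
    obtain ⟨m, hm1, hm2⟩ := exists_mem_Ioc_zpow hpos (one_lt_two (α := ℝ))
    have hv' : supNorm v ≤ 16 * 2 ^ (-(k : ℤ)) := hv
    have hmk : m < -(k : ℤ) := by
      have : (2 : ℝ) ^ m < 2 ^ (-(k : ℤ)) := by linarith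
      exact (zpow_lt_zpow_iff_right₀ one_lt_two).1 this
    refine Set.mem_iUnion.2 ⟨(-m - 1 - k).toNat, ?_⟩
    have e : ((k + (-m - 1 - k).toNat : ℕ) : ℤ) = -m - 1 := by omega
    constructor
    · show 8 * (2 : ℝ) ^ (-((k + (-m - 1 - k).toNat : ℕ) : ℤ)) < supNorm v
      rw [e, show -(-m - 1) = m + 1 by ring, zpow_add_one₀ two_ne_zero]
      linarith
    · show supNorm v ≤ 16 * (2 : ℝ) ^ (-((k + (-m - 1 - k).toNat : ℕ) : ℤ))
      rw [e, show -(-m - 1) = m + 1 by ring]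
      linarith
  have : Nonempty (Fin n) := ⟨⟨0, hn⟩⟩
  calc fiberMeasure n α (slab n k) ≤ fiberMeasure n α {0} + ∑' i, fiberMeasure n α (shell (k + i)) :=
        (measure_mono hsub).trans ((measure_union_le _ _).trans
          (add_le_add le_rfl (measure_iUnion_le _)))
    _ = ∑' i, fiberMeasure n α (shell (k + i)) := by
        have : fiberMeasure n α {0} = 0 :=
          withDensity_absolutelyContinuous _ _ (by simp)
        rw [this, zero_add]
    _ ≤ ∑' i : ℕ, ENNReal.ofReal K * (2 : ℝ≥0∞) ^ (-(k : ℝ) * (n + α)) *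
          (2 : ℝ≥0∞) ^ (-(i : ℝ) * (n + α)) := by
        refine ENNReal.tsum_le_tsum fun i => (hshell _).trans_eq ?_
        rw [mul_assoc, ← two_rpow_add]
        congr 2; push_cast; ring
    _ = _ := by rw [ENNReal.tsum_mul_left]; ring

/-- The weighted measure of a cube of edge length comparable to `2^{-k}` whose distance to the
origin is at most of this order is at least `c 2^{-k(n+α)}`. -/
theorem exists_le_fiberMeasure_cube (hn : 1 ≤ n) (α : ℝ) :
    ∃ c : ℝ≥0, c ≠ 0 ∧ ∀ (k : ℕ) (R : DyadicCube (Fin n)), R.scale ≤ k + 1 → R.toSet ⊆ slab n k →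
      c * (2 : ℝ≥0∞) ^ (-(k : ℝ) * (n + α)) ≤ fiberMeasure n α R.toSet := by
  let K : ℝ := ((1 / 4) ^ (-α) + (16 * √n) ^ (-α))⁻¹ * (1 / 4) ^ n
  have hK : 0 < K := by positivity
  refine ⟨K.toNNReal, by simpa using hK, fun k R hs hR => ?_⟩
  have hl : (0 : ℝ) < 2 ^ (-(k : ℤ)) := by positivity
  have hl1 : (2 : ℝ) ^ (-(k : ℤ)) ≤ 1 := zpow_le_one_of_nonpos₀ one_le_two (by omega)
  -- the child of `R` that is farthest from the origin in every coordinate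
  let R' : DyadicCube (Fin n) :=
    ⟨R.scale + 1, fun j => if 0 ≤ R.pos j then 2 * R.pos j + 1 else 2 * R.pos j⟩
  have e2 : (2 : ℝ) ^ (R.scale + 1) = 2 ^ R.scale * 2 := zpow_add_one₀ two_ne_zero _
  have hsub : R'.toSet ⊆ R.toSet := by
    intro v hv
    rw [mem_toSet] at hv ⊢
    intro j
    have := hv j
    simp only [R', e2] at this
    split_ifs at this <;> push_cast at this <;> constructor <;> linarith
  have hfar : ∀ v ∈ R'.toSet, 1 / 4 * 2 ^ (-(k : ℤ)) ≤ ‖v‖ := by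
    intro v hv
    have hj := mem_toSet.1 hv ⟨0, hn⟩
    refine le_trans ?_ (PiLp.norm_apply_le v ⟨0, hn⟩)
    rw [Real.norm_eq_abs]
    have h1 : 1 ≤ 2 ^ (R.scale + 1) * |v ⟨0, hn⟩| := by
      rw [← abs_of_pos (show (0 : ℝ) < 2 ^ (R.scale + 1) by positivity), ← abs_mul]
      simp only [R'] at hj
      split_ifs at hj with hp
      · have : (0 : ℝ) ≤ R.pos ⟨0, hn⟩ := by exact_mod_cast hp
        push_cast at hj
        exact le_trans (by linarith) (le_abs_self _)
      · have : (R.pos ⟨0, hn⟩ : ℝ) ≤ -1 := by exact_mod_cast (by omega)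
        push_cast at hj
        exact le_trans (by linarith) (neg_le_abs _)
    have h2 : (2 : ℝ) ^ (R.scale + 1) ≤ 4 * 2 ^ (k : ℤ) := by
      calc (2 : ℝ) ^ (R.scale + 1) ≤ 2 ^ ((k : ℤ) + 2) := zpow_le_zpow_right₀ one_le_two (by omega)
        _ = _ := by rw [zpow_add₀ two_ne_zero]; norm_num; ring
    rw [zpow_neg, ← div_eq_mul_inv, div_le_iff₀ (by positivity)]
    nlinarith [abs_nonneg (v ⟨0, hn⟩)]
  have hwt : ∀ v ∈ R'.toSet, ENNReal.ofReal
      (((1 / 4) ^ (-α) + (16 * √n) ^ (-α))⁻¹ * (2 ^ (-(k : ℤ))) ^ α) ≤ (weight n α v : ℝ≥0∞) := by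
    intro v hv
    refine ENNReal.ofReal_le_ofReal ?_
    have h1 : 1 / 4 * 2 ^ (-(k : ℤ)) ≤ min 1 ‖v‖ := le_min (by linarith) (hfar v hv)
    have h2 : min 1 ‖v‖ ≤ 16 * √n * 2 ^ (-(k : ℤ)) := by
      have h1 : supNorm v ≤ 16 * 2 ^ (-(k : ℤ)) := hR (hsub hv)
      calc min 1 ‖v‖ ≤ ‖v‖ := min_le_right _ _
        _ ≤ √n * supNorm v := norm_le_supNorm v
        _ ≤ √n * (16 * 2 ^ (-(k : ℤ))) := by gcongr
        _ = _ := by ring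
    have h3 := rpow_le_of_comparable (by norm_num) hl h1 h2 (-α)
    have ha : 0 < min 1 ‖v‖ := lt_of_lt_of_le (by positivity) h1
    rw [Real.rpow_neg ha.le, Real.rpow_neg hl.le] at h3
    have hp1 : 0 < (min 1 ‖v‖) ^ α := Real.rpow_pos_of_pos ha α
    have hp2 : 0 < ((2 : ℝ) ^ (-(k : ℤ))) ^ α := Real.rpow_pos_of_pos hl α
    rw [inv_mul_le_iff₀ (by positivity)]
    rw [inv_le_iff_one_le_mul₀ hp1] at h3
    calc ((2 : ℝ) ^ (-(k : ℤ))) ^ α = ((2 : ℝ) ^ (-(k : ℤ))) ^ α * 1 := by ring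
      _ ≤ ((2 : ℝ) ^ (-(k : ℤ))) ^ α *
          (((1 / 4) ^ (-α) + (16 * √n) ^ (-α)) * (((2 : ℝ) ^ (-(k : ℤ))) ^ α)⁻¹ *
            min 1 ‖v‖ ^ α) := by gcongr
      _ = ((2 : ℝ) ^ (-(k : ℤ))) ^ α * (((2 : ℝ) ^ (-(k : ℤ))) ^ α)⁻¹ *
          (((1 / 4) ^ (-α) + (16 * √n) ^ (-α)) * min 1 ‖v‖ ^ α) := by ring
      _ = _ := by rw [mul_inv_cancel₀ hp2.ne', one_mul]
  have hvol : ENNReal.ofReal ((1 / 4 * (2 : ℝ) ^ (-(k : ℤ))) ^ n) ≤ volume R'.toSet := by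
    rw [volume_toSet, Fintype.card_fin, ENNReal.ofReal_pow (by positivity)]
    gcongr
    calc (1 / 4 : ℝ) * 2 ^ (-(k : ℤ)) = 2 ^ (-(k : ℤ) - 2) := by
          rw [zpow_sub₀ two_ne_zero]; norm_num; ring
      _ ≤ 2 ^ (-R'.scale) := zpow_le_zpow_right₀ one_le_two (by simp only [R']; omega)
  calc (K.toNNReal : ℝ≥0∞) * (2 : ℝ≥0∞) ^ (-(k : ℝ) * (n + α))
      = ENNReal.ofReal (((1 / 4) ^ (-α) + (16 * √n) ^ (-α))⁻¹ * (2 ^ (-(k : ℤ))) ^ α) *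
          ENNReal.ofReal ((1 / 4 * (2 : ℝ) ^ (-(k : ℤ))) ^ n) := by
        change ENNReal.ofReal K * _ = _
        rw [← ofReal_two_rpow, ← ENNReal.ofReal_mul (by positivity),
            ← ENNReal.ofReal_mul (by positivity)]
        congr 1
        rw [two_zpow_rpow, mul_pow, ← Real.rpow_natCast ((2 : ℝ) ^ (-(k : ℤ))), two_zpow_rpow,
            mul_add, Real.rpow_add two_pos]
        simp only [K]; ring
    _ ≤ ENNReal.ofReal (((1 / 4) ^ (-α) + (16 * √n) ^ (-α))⁻¹ * (2 ^ (-(k : ℤ))) ^ α) *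
          volume R'.toSet := by gcongr
    _ = ∫⁻ _ in R'.toSet,
          ENNReal.ofReal (((1 / 4) ^ (-α) + (16 * √n) ^ (-α))⁻¹ * (2 ^ (-(k : ℤ))) ^ α) := by
        rw [setLIntegral_const]
    _ ≤ ∫⁻ v in R'.toSet, (weight n α v : ℝ≥0∞) :=
        setLIntegral_mono' (measurableSet_toSet _) hwt
    _ = fiberMeasure n α R'.toSet := by rw [fiberMeasure, withDensity_apply _ (measurableSet_toSet _)]
    _ ≤ _ := measure_mono hsub

/-! ### Positivity and finiteness of the weighted measure -/

theorem weight_ne_zero {α : ℝ} {v : E (Fin n)} (hv : v ≠ 0) : weight n α v ≠ 0 := by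
  have : 0 < min 1 ‖v‖ := lt_min one_pos (norm_pos_iff.2 hv)
  simpa [weight] using Real.rpow_pos_of_pos this α

theorem fiberMeasure_ne_top (hn : 1 ≤ n) {α : ℝ} (hα : -(n : ℝ) < α) {S : Set (E (Fin n))}
    (hS : Bornology.IsBounded S) : fiberMeasure n α S ≠ ∞ := by
  obtain ⟨C, hC⟩ := exists_fiberMeasure_slab_le hn hα
  have h1 : fiberMeasure n α (slab n (0 : ℕ)) ≠ ∞ :=
    ne_top_of_le_ne_top (ENNReal.mul_ne_top ENNReal.coe_ne_top (two_rpow_ne_top _)) (hC 0)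
  have h2 : fiberMeasure n α ((closure S) \ slab n (0 : ℕ)) ≠ ∞ := by
    have hm : MeasurableSet ((closure S) \ slab n (0 : ℕ)) :=
      isClosed_closure.measurableSet.diff (measurableSet_slab _)
    rw [fiberMeasure, withDensity_apply _ hm]
    have : ∫⁻ v in (closure S) \ slab n (0 : ℕ), (weight n α v : ℝ≥0∞) ≤
        ∫⁻ _ in (closure S) \ slab n (0 : ℕ), 1 := by
      refine setLIntegral_mono' hm fun v hv => ?_
      have h3 : 16 < supNorm v := by simpa [slab] using hv.2
      have h4 := supNorm_le_norm v
      rw [weight, min_eq_left (by linarith)]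
      simp
    refine ne_top_of_le_ne_top ?_ this
    rw [setLIntegral_const, one_mul]
    exact ne_top_of_le_ne_top (hS.isCompact_closure.measure_lt_top.ne) (measure_mono Set.sdiff_subset)
  refine ne_top_of_le_ne_top (ENNReal.add_ne_top.2 ⟨h1, h2⟩)
    ((measure_mono fun v hv => ?_).trans (measure_union_le _ _))
  by_cases h : v ∈ slab n (0 : ℕ)
  · exact Or.inl h
  · exact Or.inr ⟨subset_closure hv, h⟩

theorem fiberMeasure_cube_ne_zero (hn : 1 ≤ n) (α : ℝ) (R : DyadicCube (Fin n)) :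
    fiberMeasure n α R.toSet ≠ 0 := by
  have : Nonempty (Fin n) := ⟨⟨0, hn⟩⟩
  intro h
  have hac : (volume : Measure (E (Fin n))) ≪ fiberMeasure n α := by
    refine withDensity_absolutelyContinuous' (by fun_prop) ?_
    filter_upwards [Measure.ae_ne volume (0 : E (Fin n))] with v hv
    exact_mod_cast weight_ne_zero hv
  exact R.volume_toSet_ne_zero (hac h)

variable {d : ℕ}

theorem weightMeasure_toSet_ne_zero (hn : 1 ≤ n) (α : ℝ) (P : DyadicCube (Fin d ⊕ Fin n)) :
    weightMeasure d n α P.toSet ≠ 0 := by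
  rw [weightMeasure_toSet]
  exact mul_ne_zero (volume_toSet_ne_zero _) (fiberMeasure_cube_ne_zero hn α _)

theorem weightMeasure_ne_top (hn : 1 ≤ n) {α : ℝ} (hα : -(n : ℝ) < α)
    {S : Set (E (Fin d ⊕ Fin n))} (hS : Bornology.IsBounded S) : weightMeasure d n α S ≠ ∞ := by
  have h1 := (hS.isCompact_closure.image continuous_proj)
  have h2 := (hS.isCompact_closure.image continuous_vert)
  have h3 : S ⊆ proj ⁻¹' (proj '' closure S) ∩ vert ⁻¹' (vert '' closure S) := fun y hy =>
    ⟨⟨y, subset_closure hy, rfl⟩, ⟨y, subset_closure hy, rfl⟩⟩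
  refine ne_top_of_le_ne_top ?_ (measure_mono h3)
  rw [weightMeasure_inter α h1.measurableSet h2.measurableSet]
  exact ENNReal.mul_ne_top h1.measure_lt_top.ne (fiberMeasure_ne_top hn hα h2.isBounded)

theorem weightMeasure_toSet_ne_top (hn : 1 ≤ n) {α : ℝ} (hα : -(n : ℝ) < α)
    (P : DyadicCube (Fin d ⊕ Fin n)) : weightMeasure d n α P.toSet ≠ ∞ :=
  weightMeasure_ne_top hn hα P.isBounded_toSet

theorem isLocallyFiniteMeasure_weightMeasure (hn : 1 ≤ n) {α : ℝ} (hα : -(n : ℝ) < α) :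
    IsLocallyFiniteMeasure (weightMeasure d n α) :=
  ⟨fun x => ⟨Metric.ball x 1, Metric.ball_mem_nhds x one_pos,
    (weightMeasure_ne_top hn hα Metric.isBounded_ball).lt_top⟩⟩

theorem ae_vert_ne_zero (hn : 1 ≤ n) : ∀ᵐ y : E (Fin d ⊕ Fin n), vert y ≠ 0 := by
  have : Nonempty (Fin n) := ⟨⟨0, hn⟩⟩
  have h := weightMeasure_inter (d := d) (n := n) 0 MeasurableSet.univ
    (measurableSet_singleton (0 : E (Fin n)))
  have h0 : fiberMeasure n 0 {0} = 0 := withDensity_absolutelyContinuous _ _ (by simp)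
  rw [weightMeasure_zero, h0, mul_zero] at h
  rw [ae_iff]
  convert h using 2
  ext y; simp

/-- Lebesgue's differentiation theorem along dyadic cubes for the weighted measure. -/
theorem ae_tendsto_cubeAvg_weightMeasure (hn : 1 ≤ n) {α : ℝ} (hα : -(n : ℝ) < α)
    {f : E (Fin d ⊕ Fin n) → ℂ} (hf : LocallyIntegrable f (weightMeasure d n α)) :
    ∀ᵐ y ∂(weightMeasure d n α), Tendsto
      (fun k : ℕ => cubeAvg (weightMeasure d n α) f (cubeAt k y)) atTop (𝓝 (f y)) := by
  have hw : Measurable fun y : E (Fin d ⊕ Fin n) => weight n α (vert y) := by fun_prop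
  have hwm := weightMeasure_eq d n α
  have h1 : LocallyIntegrable (fun y : E (Fin d ⊕ Fin n) => (weight n α (vert y) : ℝ)) volume := by
    refine locallyIntegrable_iff.2 fun S hS =>
      ⟨hw.coe_nnreal_real.aestronglyMeasurable, ?_⟩
    have := weightMeasure_ne_top (d := d) hn hα hS.isBounded
    rw [hwm, withDensity_apply _ hS.measurableSet] at this
    rw [hasFiniteIntegral_iff_enorm]
    simpa using this.lt_top
  have h2 : LocallyIntegrable (fun y => weight n α (vert y) • f y) volume := by
    refine locallyIntegrable_iff.2 fun S hS => ?_
    have := hf.integrableOn_isCompact hS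
    rw [IntegrableOn, hwm, restrict_withDensity hS.measurableSet,
      integrable_withDensity_iff_integrable_smul hw] at this
    exact this
  have h3 : ∀ᵐ y : E (Fin d ⊕ Fin n), weight n α (vert y) ≠ 0 := by
    filter_upwards [ae_vert_ne_zero hn] with y hy using weight_ne_zero hy
  have := ae_tendsto_cubeAvg_withDensity hw h3 h1 h2
  rw [← hwm] at this
  refine (?_ : weightMeasure d n α ≪ volume).ae_le this
  rw [hwm]
  exact withDensity_absolutelyContinuous _ _

end WhitneyTrace

namespace WhitneyTrace
open DyadicCube

/-! ### Sequence spaces -/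

/-- The `ℓ^q` quasinorm of a nonnegative sequence, `0 < q ≤ ∞`. -/
noncomputable def lq (q : ℝ≥0∞) (a : ℕ → ℝ≥0∞) : ℝ≥0∞ :=
  if q = ∞ then ⨆ k, a k else (∑' k, a k ^ q.toReal) ^ (1 / q.toReal)

section lq

variable {q : ℝ≥0∞}

theorem lq_mono {a b : ℕ → ℝ≥0∞} (h : ∀ k, a k ≤ b k) : lq q a ≤ lq q b := by
  unfold lq
  split_ifs
  · exact iSup_mono h
  · gcongr with k; exact h k

theorem le_lq (hq : 0 < q) (a : ℕ → ℝ≥0∞) (k : ℕ) : a k ≤ lq q a := by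
  unfold lq
  split_ifs with hqt
  · exact le_iSup a k
  · have hq' : 0 < q.toReal := ENNReal.toReal_pos hq.ne' hqt
    rw [one_div, ENNReal.le_rpow_inv_iff hq']
    exact ENNReal.le_tsum (f := fun k => a k ^ q.toReal) k

theorem lq_const_mul_le (hq : 0 < q) (c : ℝ≥0∞) (a : ℕ → ℝ≥0∞) :
    lq q (fun k => c * a k) ≤ c * lq q a := by
  unfold lq
  split_ifs with hqt
  · rw [ENNReal.mul_iSup]
  · have hq' : 0 < q.toReal := ENNReal.toReal_pos hq.ne' hqt
    simp only [ENNReal.mul_rpow_of_nonneg _ _ hq'.le, ENNReal.tsum_mul_left]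
    rw [ENNReal.mul_rpow_of_nonneg _ _ (by positivity), ← ENNReal.rpow_mul,
      mul_one_div_cancel hq'.ne', ENNReal.rpow_one]

theorem add_rpow_le_two_rpow_mul (a b : ℝ≥0∞) {r : ℝ} (hr : 0 ≤ r) :
    (a + b) ^ r ≤ 2 ^ r * (a ^ r + b ^ r) := by
  have h1 : a + b ≤ 2 * max a b := by
    rw [two_mul]; exact add_le_add (le_max_left _ _) (le_max_right _ _)
  calc (a + b) ^ r ≤ (2 * max a b) ^ r := by gcongr
    _ = 2 ^ r * max a b ^ r := ENNReal.mul_rpow_of_nonneg _ _ hr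
    _ ≤ _ := by
      gcongr
      rcases le_total a b with h | h
      · rw [max_eq_right h]; exact le_add_self
      · rw [max_eq_left h]; exact le_self_add

theorem exists_lq_add_le (hq : 0 < q) : ∃ C : ℝ≥0, ∀ a b : ℕ → ℝ≥0∞,
    lq q (fun k => a k + b k) ≤ C * (lq q a + lq q b) := by
  by_cases hqt : q = ∞
  · refine ⟨1, fun a b => ?_⟩
    simp only [lq, hqt, if_true, ENNReal.coe_one, one_mul]
    exact iSup_le fun k => add_le_add (le_iSup a k) (le_iSup b k)
  · have hq' : 0 < q.toReal := ENNReal.toReal_pos hq.ne' hqt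
    refine ⟨((2 : ℝ≥0∞) * 2 ^ (1 / q.toReal)).toNNReal, fun a b => ?_⟩
    rw [ENNReal.coe_toNNReal (ENNReal.mul_ne_top (by simp) (two_rpow_ne_top _))]
    simp only [lq, hqt, if_false]
    calc (∑' k, (a k + b k) ^ q.toReal) ^ (1 / q.toReal)
        ≤ (2 ^ q.toReal * (∑' k, a k ^ q.toReal + ∑' k, b k ^ q.toReal)) ^ (1 / q.toReal) := by
          rw [← ENNReal.tsum_add, ← ENNReal.tsum_mul_left]
          gcongr
          exact add_rpow_le_two_rpow_mul _ _ hq'.le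
      _ = 2 * (∑' k, a k ^ q.toReal + ∑' k, b k ^ q.toReal) ^ (1 / q.toReal) := by
          rw [ENNReal.mul_rpow_of_nonneg _ _ (by positivity), ← ENNReal.rpow_mul,
            mul_one_div_cancel hq'.ne', ENNReal.rpow_one]
      _ ≤ 2 * (2 ^ (1 / q.toReal) * ((∑' k, a k ^ q.toReal) ^ (1 / q.toReal) +
            (∑' k, b k ^ q.toReal) ^ (1 / q.toReal))) := by
          gcongr
          exact add_rpow_le_two_rpow_mul _ _ (by positivity)
      _ = _ := by ring

theorem lq_single_le (hq : 0 < q) (c : ℝ≥0∞) : lq q (fun k => if k = 0 then c else 0) ≤ c := by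
  unfold lq
  split_ifs with hqt
  · refine iSup_le fun k => ?_
    dsimp only
    split_ifs <;> simp
  · have hq' : 0 < q.toReal := ENNReal.toReal_pos hq.ne' hqt
    rw [tsum_eq_single 0 (fun k hk => by simp [hk, hq']), one_div,
      ENNReal.rpow_inv_le_iff hq']
    simp

theorem tsum_int_eq (G : ℤ → ℝ≥0∞) :
    ∑' m, G m = ∑' i : ℕ, G i + ∑' i : ℕ, G (-(i + 1)) :=
  (HasSum.of_nat_of_neg_add_one (f := G) ENNReal.summable.hasSum
    ENNReal.summable.hasSum).tsum_eq

theorem tsum_int_ne_top {δ : ℝ} (hδ : 0 < δ) :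
    ∑' m : ℤ, (2 : ℝ≥0∞) ^ (-|(m : ℝ)| * δ) ≠ ∞ := by
  rw [tsum_int_eq]
  have h : ∀ i : ℕ, (2 : ℝ≥0∞) ^ (-|((i : ℤ) : ℝ)| * δ) ≤ 2 ^ (-(i : ℝ) * δ) := by
    intro i; simp
  have h' : ∀ i : ℕ, (2 : ℝ≥0∞) ^ (-|((-((i : ℤ) + 1) : ℤ) : ℝ)| * δ) ≤ 2 ^ (-(i : ℝ) * δ) := by
    intro i
    refine ENNReal.rpow_le_rpow_of_exponent_le one_le_two ?_
    push_cast
    rw [abs_neg, abs_of_nonneg (by positivity)]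
    nlinarith
  exact ENNReal.add_ne_top.2
    ⟨ne_top_of_le_ne_top (tsum_two_rpow_ne_top hδ) (ENNReal.tsum_le_tsum h),
      ne_top_of_le_ne_top (tsum_two_rpow_ne_top hδ) (ENNReal.tsum_le_tsum h')⟩

theorem tsum_nat_sub_le {δ : ℝ} (k : ℕ) : ∑' l : ℕ, (2 : ℝ≥0∞) ^ (-|(k : ℝ) - l| * δ) ≤
    ∑' m : ℤ, (2 : ℝ≥0∞) ^ (-|(m : ℝ)| * δ) := by
  have hinj : Function.Injective fun l : ℕ => (k : ℤ) - l := fun a b h => by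
    simp only at h; omega
  have := ENNReal.tsum_comp_le_tsum_of_injective hinj
    (fun m : ℤ => (2 : ℝ≥0∞) ^ (-|(m : ℝ)| * δ))
  simpa using this

/-- A discrete Hardy inequality: convolution with a geometric sequence is bounded on `ℓ^q`, also
for `q < 1`. Half of the decay is spent on replacing the sum by a supremum, whose `q`-th power is
bounded by the sum of the `q`-th powers. -/
theorem exists_lq_le_of_le_tsum (hq : 0 < q) {δ : ℝ} (hδ : 0 < δ) : ∃ C : ℝ≥0,
    ∀ a b : ℕ → ℝ≥0∞, (∀ k, a k ≤ ∑' l : ℕ, (2 : ℝ≥0∞) ^ (-|(k : ℝ) - l| * δ) * b l) →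
      lq q a ≤ C * lq q b := by
  by_cases hqt : q = ∞
  · refine ⟨(∑' m : ℤ, (2 : ℝ≥0∞) ^ (-|(m : ℝ)| * δ)).toNNReal, fun a b hab => ?_⟩
    rw [ENNReal.coe_toNNReal (tsum_int_ne_top hδ)]
    simp only [lq, hqt, if_true]
    refine iSup_le fun k => (hab k).trans ?_
    calc ∑' l : ℕ, (2 : ℝ≥0∞) ^ (-|(k : ℝ) - l| * δ) * b l
        ≤ ∑' l : ℕ, (2 : ℝ≥0∞) ^ (-|(k : ℝ) - l| * δ) * ⨆ j, b j := by
          gcongr with l; exact le_iSup b l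
      _ ≤ _ := by rw [ENNReal.tsum_mul_right]; gcongr; exact tsum_nat_sub_le k
  · have hq' : 0 < q.toReal := ENNReal.toReal_pos hq.ne' hqt
    set r := q.toReal with hr
    set W : ℝ≥0∞ := ∑' m : ℤ, (2 : ℝ≥0∞) ^ (-|(m : ℝ)| * (δ / 2)) with hW
    set V : ℝ≥0∞ := ∑' m : ℤ, (2 : ℝ≥0∞) ^ (-|(m : ℝ)| * (δ / 2 * r)) with hV
    have hWt : W ≠ ∞ := tsum_int_ne_top (by positivity)
    have hVt : V ≠ ∞ := tsum_int_ne_top (by positivity)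
    refine ⟨(W * V ^ (1 / r)).toNNReal, fun a b hab => ?_⟩
    rw [ENNReal.coe_toNNReal (ENNReal.mul_ne_top hWt
      (ENNReal.rpow_ne_top_of_nonneg (by positivity) hVt))]
    simp only [lq, hqt, if_false, ← hr]
    have key : ∀ k, a k ^ r ≤
        W ^ r * ∑' l : ℕ, (2 : ℝ≥0∞) ^ (-|(k : ℝ) - l| * (δ / 2 * r)) * b l ^ r := by
      intro k
      set D := ∑' l : ℕ, (2 : ℝ≥0∞) ^ (-|(k : ℝ) - l| * (δ / 2 * r)) * b l ^ r with hD
      have h1 : ∀ l : ℕ, (2 : ℝ≥0∞) ^ (-|(k : ℝ) - l| * (δ / 2)) * b l ≤ D ^ (1 / r) := by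
        intro l
        rw [one_div, ENNReal.le_rpow_inv_iff hq', ENNReal.mul_rpow_of_nonneg _ _ hq'.le,
          ← ENNReal.rpow_mul, mul_assoc]
        exact ENNReal.le_tsum
          (f := fun l : ℕ => (2 : ℝ≥0∞) ^ (-|(k : ℝ) - l| * (δ / 2 * r)) * b l ^ r) l
      have h2 : a k ≤ W * D ^ (1 / r) := by
        calc a k ≤ ∑' l : ℕ, (2 : ℝ≥0∞) ^ (-|(k : ℝ) - l| * δ) * b l := hab k
          _ ≤ ∑' l : ℕ, (2 : ℝ≥0∞) ^ (-|(k : ℝ) - l| * (δ / 2)) * D ^ (1 / r) := by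
              refine ENNReal.tsum_le_tsum fun l => ?_
              rw [show -|(k : ℝ) - l| * δ = -|(k : ℝ) - l| * (δ / 2) + -|(k : ℝ) - l| * (δ / 2) by
                ring, two_rpow_add, mul_assoc]
              gcongr
              exact h1 l
          _ ≤ _ := by rw [ENNReal.tsum_mul_right]; gcongr; exact tsum_nat_sub_le k
      calc a k ^ r ≤ (W * D ^ (1 / r)) ^ r := by gcongr
        _ = W ^ r * D := by
            rw [ENNReal.mul_rpow_of_nonneg _ _ hq'.le, ← ENNReal.rpow_mul,
              one_div_mul_cancel hq'.ne', ENNReal.rpow_one]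
    calc (∑' k, a k ^ r) ^ (1 / r)
        ≤ (W ^ r * (V * ∑' l, b l ^ r)) ^ (1 / r) := by
          gcongr
          calc ∑' k, a k ^ r ≤ ∑' k : ℕ, W ^ r * ∑' l : ℕ,
                (2 : ℝ≥0∞) ^ (-|(k : ℝ) - l| * (δ / 2 * r)) * b l ^ r := ENNReal.tsum_le_tsum key
            _ = W ^ r * ∑' l : ℕ, (∑' k : ℕ, (2 : ℝ≥0∞) ^ (-|(l : ℝ) - k| * (δ / 2 * r))) *
                b l ^ r := by
              rw [ENNReal.tsum_mul_left, ENNReal.tsum_comm]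
              congr 1
              refine tsum_congr fun l => ?_
              rw [ENNReal.tsum_mul_right]
              congr 1
              exact tsum_congr fun k => by rw [abs_sub_comm]
            _ ≤ W ^ r * ∑' l : ℕ, V * b l ^ r := by
              gcongr with l
              exact tsum_nat_sub_le l
            _ = _ := by rw [ENNReal.tsum_mul_left]
      _ = W * V ^ (1 / r) * (∑' l, b l ^ r) ^ (1 / r) := by
          rw [ENNReal.mul_rpow_of_nonneg _ _ (by positivity), ← ENNReal.rpow_mul,
            mul_one_div_cancel hq'.ne', ENNReal.rpow_one,
            ENNReal.mul_rpow_of_nonneg _ _ (by positivity), mul_assoc]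

end lq

variable {ι : Type} [Fintype ι]

theorem besovEnergy_eq_lq (s : ℝ) (p q : ℝ≥0∞) (μ : Measure (E ι)) (f : E ι → ℂ) :
    besovEnergy s p q μ f = lq q fun k : ℕ => (2 : ℝ≥0∞) ^ ((k : ℝ) * s) * besovLevel p μ f k := rfl

theorem lq_osc_le_besovEnergy (s : ℝ) {p : ℝ≥0∞} (hp : 1 ≤ p) (q : ℝ≥0∞) (μ : Measure (E ι))
    (f : E ι → ℂ) : lq q (fun k : ℕ => (2 : ℝ≥0∞) ^ ((k : ℝ) * s) * eLpNorm (osc μ f k) p μ) ≤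
      besovEnergy s p q μ f := by
  rw [besovEnergy_eq_lq]
  refine lq_mono fun k => ?_
  gcongr
  exact eLpNorm_osc_le_besovLevel p hp μ f k

theorem besovEnergy_le_lq_osc (s : ℝ) {p : ℝ≥0∞} (hp : 1 ≤ p) {q : ℝ≥0∞} (hq : 0 < q)
    {μ : Measure (E ι)} (hμ : ∀ Q : DyadicCube ι, μ Q.toSet ≠ 0) (f : E ι → ℂ) :
    besovEnergy s p q μ f ≤ ((3 * 5 ^ Fintype.card ι : ℕ) : ℝ≥0∞) *
      lq q (fun k : ℕ => (2 : ℝ≥0∞) ^ ((k : ℝ) * s) * eLpNorm (osc μ f k) p μ) := by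
  rw [besovEnergy_eq_lq]
  refine (lq_mono fun k => ?_).trans (lq_const_mul_le hq _ _)
  rw [mul_left_comm]
  gcongr
  exact besovLevel_le_eLpNorm_osc p hp μ hμ f k

theorem eLpNorm_osc_le_besovNorm {s : ℝ} {p : ℝ≥0∞} (hp : 1 ≤ p) {q : ℝ≥0∞} (hq : 0 < q)
    (μ : Measure (E ι)) (f : E ι → ℂ) (k : ℕ) :
    eLpNorm (osc μ f k) p μ ≤ (2 : ℝ≥0∞) ^ (-(k : ℝ) * s) * besovNorm s p q μ f := by
  have h1 := (le_lq hq (fun k : ℕ => (2 : ℝ≥0∞) ^ ((k : ℝ) * s) * eLpNorm (osc μ f k) p μ) k).trans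
    (lq_osc_le_besovEnergy s hp q μ f)
  have h2 : eLpNorm (osc μ f k) p μ = (2 : ℝ≥0∞) ^ (-(k : ℝ) * s) *
      ((2 : ℝ≥0∞) ^ ((k : ℝ) * s) * eLpNorm (osc μ f k) p μ) := by
    rw [← mul_assoc, ← two_rpow_add]; simp
  rw [h2]
  gcongr
  exact h1.trans le_add_self

end WhitneyTrace

namespace WhitneyTrace
open DyadicCube

/-! ### The cubes above a cube of `ℝ^d` -/

variable {d n : ℕ}

/-- For `Q ⊆ ℝ^d` of edge length `ℓ`, the cube `Q × (0, ℓ]^n`. -/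
def cubeUp (n : ℕ) (Q : DyadicCube (Fin d)) : DyadicCube (Fin d ⊕ Fin n) :=
  ⟨Q.scale, Sum.elim Q.pos fun _ => 0⟩

/-- The cube `(0, 2^{-k}]^n`. -/
def unitFiber (n : ℕ) (k : ℤ) : DyadicCube (Fin n) := ⟨k, fun _ => 0⟩

theorem cubeUp_neighbor {Q Q' : DyadicCube (Fin d)} (h : Q.Neighbor Q') :
    (cubeUp n Q).Neighbor (cubeUp n Q') := by
  obtain ⟨h1, h2, z, hz, hz'⟩ := neighbor_iff.1 h
  refine neighbor_iff.2 ⟨h1, h2, embed n z, ?_, ?_⟩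
  · rw [mem_closedBox] at hz ⊢
    rintro (i | j)
    · exact hz i
    · simp [embed, cubeUp]
  · rw [mem_closedBox] at hz' ⊢
    rintro (i | j)
    · exact hz' i
    · simp [embed, cubeUp]

theorem cubeUp_cubeAt_proj {k : ℤ} {y : E (Fin d ⊕ Fin n)} (hy : vert y ∈ (unitFiber n k).toSet) :
    cubeUp n (cubeAt k (proj y)) = cubeAt k y := by
  have h := eq_cubeAt hy
  refine DyadicCube.ext' rfl ?_
  funext i
  rcases i with i | j
  · rfl
  · exact congrFun (congrArg DyadicCube.pos h) j

/-- The cube above `x` is a neighbour of the cubes of the same size around `(x, 0)`. -/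
theorem cubeUp_neighbor_cubeAt {k : ℤ} {x : E (Fin d)} {y : E (Fin d ⊕ Fin n)}
    (h : dist y (embed n x) ≤ 2 ^ (-k) / 2) :
    (cubeUp n (cubeAt k x)).Neighbor (cubeAt k y) := by
  have hk : (0 : ℝ) < 2 ^ k := by positivity
  have hk' : (0 : ℝ) < 2 ^ (-k) := by positivity
  -- the midpoint of the fibre of the upper cube over `x`
  let u : E (Fin d ⊕ Fin n) := WithLp.toLp 2 (Sum.elim (fun i => x i) fun _ => 2 ^ (-k) / 2)
  have hu : cubeUp n (cubeAt k x) = cubeAt k u := by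
    refine (cubeUp_cubeAt_proj (k := k) (y := u) ?_)
    intro j
    simp only [unitFiber, DyadicCube.side, vert_apply, u, Sum.elim_inr]
    constructor <;> push_cast <;> linarith
  have hc : ∀ i, |y i - embed n x i| ≤ 2 ^ (-k) / 2 := fun i => by
    have := PiLp.norm_apply_le (y - embed n x) i
    rw [← dist_eq_norm] at this
    exact this.trans h
  rw [hu]
  refine neighbor_cubeAt fun i => ?_
  rcases i with i | j
  · have := hc (Sum.inl i)
    rw [abs_sub_comm]
    simp only [embed, Sum.elim_inl] at this
    simp only [u, Sum.elim_inl]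
    linarith
  · have := hc (Sum.inr j)
    simp only [embed, Sum.elim_inr, sub_zero, abs_le] at this
    simp only [u, Sum.elim_inr, abs_le]
    constructor <;> linarith

theorem unitFiber_subset_slab (k : ℤ) : (unitFiber n k).toSet ⊆ slab n k := by
  intro v hv
  have hk' : (0 : ℝ) < 2 ^ (-k) := by positivity
  refine (supNorm_le_iff (by positivity)).2 fun j => ?_
  have := hv j
  simp only [unitFiber, DyadicCube.side] at this
  push_cast at this
  rw [abs_le]; constructor <;> linarith

/-- A step function on the cubes above `ℝ^d` has `L^p(ℝ^d)` norm at most `C 2^{k(α+n)/p}` times its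
norm in the weighted space. -/
theorem exists_eLpNorm_comp_cubeUp_le (hn : 1 ≤ n) (α : ℝ) (p : ℝ≥0∞) :
    ∃ C : ℝ≥0, ∀ (u : DyadicCube (Fin d ⊕ Fin n) → ℝ≥0∞) (k : ℕ),
      eLpNorm (fun x => u (cubeUp n (cubeAt k x))) p volume ≤
        C * (2 : ℝ≥0∞) ^ ((k : ℝ) * ((α + n) * (p⁻¹).toReal)) *
          eLpNorm (fun y => u (cubeAt k y)) p (weightMeasure d n α) := by
  obtain ⟨c, hc0, hc⟩ := exists_le_fiberMeasure_cube hn α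
  set r := (p⁻¹).toReal with hr
  have hr0 : 0 ≤ r := ENNReal.toReal_nonneg
  have hc0' : (c : ℝ≥0∞) ≠ 0 := by exact_mod_cast hc0
  refine ⟨(((c : ℝ≥0∞)⁻¹) ^ r).toNNReal, fun u k => ?_⟩
  rw [ENNReal.coe_toNNReal (ENNReal.rpow_ne_top_of_nonneg hr0 (ENNReal.inv_ne_top.2 hc0'))]
  set R := unitFiber n k
  have hRm := R.measurableSet_toSet
  have h1 : fiberMeasure n α R.toSet ^ r * eLpNorm (fun x => u (cubeUp n (cubeAt k x))) p volume ≤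
      eLpNorm (fun y => u (cubeAt k y)) p (weightMeasure d n α) := by
    rw [← eLpNorm_comp_proj_restrict α hRm (fiberMeasure_cube_ne_zero hn α R) p
      (measurable_comp_cubeAt (fun Q => u (cubeUp n Q)) k)]
    refine le_trans (le_of_eq ?_) (eLpNorm_mono_measure _
      (Measure.restrict_le_self (s := vert ⁻¹' R.toSet)))
    refine eLpNorm_congr_ae ?_
    filter_upwards [ae_restrict_mem (measurable_vert hRm)] with y hy
    rw [cubeUp_cubeAt_proj hy]
  have h2 := hc k R (by simp only [R, unitFiber]; omega) (unitFiber_subset_slab _)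
  have h3 : ((c : ℝ≥0∞) * 2 ^ (-(k : ℝ) * (n + α))) ^ r *
      eLpNorm (fun x => u (cubeUp n (cubeAt k x))) p volume ≤
      eLpNorm (fun y => u (cubeAt k y)) p (weightMeasure d n α) := by
    refine le_trans ?_ h1; gcongr
  rw [ENNReal.mul_rpow_of_nonneg _ _ hr0, ← ENNReal.rpow_mul] at h3
  have e1 : ((c : ℝ≥0∞)⁻¹) ^ r * (c : ℝ≥0∞) ^ r = 1 := by
    rw [← ENNReal.mul_rpow_of_nonneg _ _ hr0, ENNReal.inv_mul_cancel hc0' ENNReal.coe_ne_top,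
      ENNReal.one_rpow]
  have e2 : (2 : ℝ≥0∞) ^ ((k : ℝ) * ((α + n) * r)) * 2 ^ (-(k : ℝ) * (n + α) * r) = 1 := by
    rw [← two_rpow_add, show (k : ℝ) * ((α + n) * r) + -(k : ℝ) * (n + α) * r = 0 by ring,
      ENNReal.rpow_zero]
  calc eLpNorm (fun x => u (cubeUp n (cubeAt k x))) p volume
      = (((c : ℝ≥0∞)⁻¹) ^ r * (c : ℝ≥0∞) ^ r) *
        ((2 : ℝ≥0∞) ^ ((k : ℝ) * ((α + n) * r)) * 2 ^ (-(k : ℝ) * (n + α) * r)) *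
          eLpNorm (fun x => u (cubeUp n (cubeAt k x))) p volume := by rw [e1, e2]; simp
    _ = ((c : ℝ≥0∞)⁻¹) ^ r * 2 ^ ((k : ℝ) * ((α + n) * r)) *
        ((c : ℝ≥0∞) ^ r * 2 ^ (-(k : ℝ) * (n + α) * r) *
          eLpNorm (fun x => u (cubeUp n (cubeAt k x))) p volume) := by ring
    _ ≤ _ := by gcongr

/-- The oscillation of `f` on the cubes above `ℝ^d`. -/
noncomputable def upOsc (μ : Measure (E (Fin d ⊕ Fin n))) (f : E (Fin d ⊕ Fin n) → ℂ) (k : ℤ)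
    (x : E (Fin d)) : ℝ≥0∞ := cubeOsc μ f (cubeUp n (cubeAt k x))

/-- The average of `f` over the cube of edge length `2^{-k}` above `x`. -/
noncomputable def upAvg (μ : Measure (E (Fin d ⊕ Fin n))) (f : E (Fin d ⊕ Fin n) → ℂ) (k : ℤ)
    (x : E (Fin d)) : ℂ := cubeAvg μ f (cubeUp n (cubeAt k x))

variable {μ : Measure (E (Fin d ⊕ Fin n))} {f : E (Fin d ⊕ Fin n) → ℂ}

theorem measurable_upOsc (k : ℤ) : Measurable (upOsc μ f k) :=
  measurable_comp_cubeAt (fun Q => cubeOsc μ f (cubeUp n Q)) k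

theorem measurable_upAvg (k : ℤ) : Measurable (upAvg μ f k) :=
  measurable_comp_cubeAt (fun Q => cubeAvg μ f (cubeUp n Q)) k

theorem enorm_upAvg_sub_le {k l : ℤ} (x : E (Fin d)) (h : l ≤ k + 1) (h' : k ≤ l + 1) :
    ‖upAvg μ f k x - upAvg μ f l x‖ₑ ≤ upOsc μ f k x :=
  enorm_sub_le_cubeOsc _ _ (cubeUp_neighbor (neighbor_cubeAt_of_scale x h h'))

/-! ### Convergence of the averages over balls -/

/-- The sum of the oscillations at all scales from `k` on. -/
noncomputable def tailOsc (μ : Measure (E (Fin d ⊕ Fin n))) (f : E (Fin d ⊕ Fin n) → ℂ) (k : ℕ)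
    (y : E (Fin d ⊕ Fin n)) : ℝ≥0∞ := ∑' i : ℕ, osc μ f ((k + i : ℕ) : ℤ) y

theorem measurable_tailOsc (k : ℕ) : Measurable (tailOsc μ f k) :=
  Measurable.tsum fun _ => measurable_osc _ _ _

/-- The distance between the average over a ball centred at `(x, 0)` and the average over the cube
of comparable size above `x`. -/
theorem enorm_ballAverage_sub_upAvg_le {f : E (Fin d ⊕ Fin n) → ℂ} (hf : LocallyIntegrable f μ)
    (hlim : ∀ᵐ y ∂μ, Tendsto (fun k : ℕ => cubeAvg μ f (cubeAt k y)) atTop (𝓝 (f y)))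
    {k : ℕ} {x : E (Fin d)} {r : ℝ} (hr : r ≤ 2 ^ (-(k : ℤ)) / 2)
    (h0 : μ (Metric.ball (embed n x) r) ≠ 0) (ht : μ (Metric.ball (embed n x) r) ≠ ∞) :
    ‖ballAverage μ f x r - upAvg μ f k x‖ₑ ≤ upOsc μ f k x +
      (μ (Metric.ball (embed n x) r))⁻¹ *
        ∫⁻ y in Metric.ball (embed n x) (2 ^ (-(k : ℤ)) / 2), tailOsc μ f k y ∂μ := by
  set B := Metric.ball (embed n x) r with hB
  have : IsFiniteMeasure (μ.restrict B) := ⟨by simpa using ht.lt_top⟩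
  have : NeZero (μ.restrict B) := ⟨by simpa using h0⟩
  have hint : IntegrableOn f B μ :=
    (hf.integrableOn_isCompact (isCompact_closedBall (embed n x) r)).mono_set
      Metric.ball_subset_closedBall
  have hpt : ∀ᵐ y ∂μ.restrict B, ‖f y - upAvg μ f k x‖ₑ ≤ tailOsc μ f k y + upOsc μ f k x := by
    filter_upwards [ae_restrict_of_ae hlim, ae_restrict_mem Metric.isOpen_ball.measurableSet]
      with y hy hyB
    rw [← sub_add_sub_cancel _ (cubeAvg μ f (cubeAt k y)) _]
    refine (enorm_add_le _ _).trans (add_le_add (enorm_sub_cubeAvg_le_tsum_osc hy k) ?_)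
    rw [← enorm_neg, neg_sub]
    refine enorm_sub_le_cubeOsc _ _ (cubeUp_neighbor_cubeAt ?_)
    exact (Metric.mem_ball.1 hyB).le.trans hr
  calc ‖ballAverage μ f x r - upAvg μ f k x‖ₑ
      ≤ ⨍⁻ y in B, ‖f y - upAvg μ f k x‖ₑ ∂μ := enorm_average_sub_le hint _
    _ ≤ ⨍⁻ y in B, (tailOsc μ f k y + upOsc μ f k x) ∂μ := laverage_mono_ae hpt
    _ = upOsc μ f k x + (μ B)⁻¹ * ∫⁻ y in B, tailOsc μ f k y ∂μ := by
        rw [setLAverage_eq, lintegral_add_right _ measurable_const, setLIntegral_const,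
          ENNReal.add_div, ENNReal.mul_div_cancel_right h0 ht, add_comm, ENNReal.div_eq_inv_mul]
    _ ≤ _ := by
        gcongr
        exact Metric.ball_subset_ball hr

/-- The weighted measure of the ball of radius `r` centred at `(x, 0)` is at least
`c r^{d+n+α}`. -/
theorem exists_le_weightMeasure_ball (hn : 1 ≤ n) (α : ℝ) :
    ∃ c : ℝ≥0, c ≠ 0 ∧ ∀ (k : ℕ) (x : E (Fin d)) (r : ℝ), 2 ^ (-(k : ℤ)) / 4 < r →
      c * (2 : ℝ≥0∞) ^ (-(k : ℝ) * (d + (n + α))) ≤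
        weightMeasure d n α (Metric.ball (embed n x) r) := by
  obtain ⟨c, hc0, hc⟩ := exists_le_fiberMeasure_cube hn α
  obtain ⟨m, hm⟩ := pow_unbounded_of_one_lt (4 * √(d + n : ℕ)) (one_lt_two (α := ℝ))
  have hc0' : (c : ℝ≥0∞) ≠ 0 := by exact_mod_cast hc0
  refine ⟨(c * (2 : ℝ≥0∞) ^ (-(m : ℝ) * (d + (n + α)))).toNNReal, ?_, fun k x r hr => ?_⟩
  · rw [Ne, ENNReal.toNNReal_eq_zero_iff, not_or]
    exact ⟨mul_ne_zero hc0' (two_rpow_ne_zero _),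
      ENNReal.mul_ne_top ENNReal.coe_ne_top (two_rpow_ne_top _)⟩
  rw [ENNReal.coe_toNNReal (ENNReal.mul_ne_top ENNReal.coe_ne_top (two_rpow_ne_top _))]
  set P := cubeUp n (cubeAt ((k + m : ℕ) : ℤ) x) with hP
  have hsub : P.toSet ⊆ Metric.ball (embed n x) r := by
    intro y hy
    have hx : embed n x ∈ P.closedBox := by
      rw [mem_closedBox]
      have := mem_toSet.1 (mem_cubeAt ((k + m : ℕ) : ℤ) x)
      rintro (i | j)
      · exact ⟨(this i).1.le, (this i).2⟩
      · simp [embed, hP, cubeUp]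
    have h1 := dist_le_of_mem (P.toSet_subset_closedBox hy) hx
    rw [Metric.mem_ball]
    refine h1.trans_lt (lt_of_le_of_lt ?_ hr)
    simp only [Fintype.card_sum, Fintype.card_fin]
    rw [show P.scale = (k : ℤ) + m from by simp [hP, cubeUp], neg_add, zpow_add₀ two_ne_zero,
      zpow_neg _ (m : ℤ), zpow_natCast]
    have hk : (0 : ℝ) < 2 ^ (-(k : ℤ)) := by positivity
    have hmp : (0 : ℝ) < 2 ^ m := by positivity
    rw [le_div_iff₀ (by norm_num)]
    calc √(d + n : ℕ) * (2 ^ (-(k : ℤ)) * (2 ^ m)⁻¹) * 4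
        = (4 * √(d + n : ℕ)) * (2 ^ m)⁻¹ * 2 ^ (-(k : ℤ)) := by ring
      _ ≤ 2 ^ m * (2 ^ m)⁻¹ * 2 ^ (-(k : ℤ)) := by gcongr
      _ = 2 ^ (-(k : ℤ)) := by rw [mul_inv_cancel₀ hmp.ne', one_mul]
  refine le_trans ?_ (measure_mono hsub)
  rw [weightMeasure_toSet]
  have h2 := hc (k + m) (unitFiber n ((k + m : ℕ) : ℤ)) (by simp only [unitFiber]; omega)
    (unitFiber_subset_slab _)
  have h3 : volume (projCube P).toSet = (2 : ℝ≥0∞) ^ (-((k + m : ℕ) : ℝ) * d) := by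
    rw [volume_toSet, Fintype.card_fin, ← ofReal_two_rpow, ← ENNReal.ofReal_pow (by positivity)]
    congr 1
    rw [show (projCube P).scale = ((k + m : ℕ) : ℤ) from rfl, ← Real.rpow_natCast, two_zpow_rpow]
  have h4 : vertCube P = unitFiber n ((k + m : ℕ) : ℤ) := rfl
  rw [h3, h4]
  calc (c : ℝ≥0∞) * 2 ^ (-(m : ℝ) * (d + (n + α))) * 2 ^ (-(k : ℝ) * (d + (n + α)))
      = 2 ^ (-((k + m : ℕ) : ℝ) * d) * (c * 2 ^ (-((k + m : ℕ) : ℝ) * (n + α))) := by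
        rw [mul_assoc, ← two_rpow_add, mul_left_comm, ← two_rpow_add]
        congr 2; push_cast; ring
    _ ≤ _ := by gcongr

end WhitneyTrace

namespace WhitneyTrace
open DyadicCube

variable {d n : ℕ}

theorem norm_proj_le (y : E (Fin d ⊕ Fin n)) : ‖proj y‖ ≤ ‖y‖ := by
  rw [EuclideanSpace.norm_eq, EuclideanSpace.norm_eq]
  apply Real.sqrt_le_sqrt
  rw [Fintype.sum_sum_type]
  have : 0 ≤ ∑ j : Fin n, ‖y (Sum.inr j)‖ ^ 2 := by positivity
  simpa using this

theorem dist_proj_le (y : E (Fin d ⊕ Fin n)) (x : E (Fin d)) :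
    dist (proj y) x ≤ dist y (embed n x) := by
  rw [dist_eq_norm, dist_eq_norm]
  exact norm_proj_le (y - embed n x)

theorem continuous_embed : Continuous (embed n : E (Fin d) → E (Fin d ⊕ Fin n)) := by
  unfold embed
  refine (PiLp.continuous_toLp 2 _).comp (continuous_pi fun i => ?_)
  rcases i with i | j
  · simp only [Sum.elim_inl]; fun_prop
  · simp only [Sum.elim_inr]; fun_prop

/-- Tonelli's theorem for the integrals over small balls centred at `ℝ^d`. -/
theorem lintegral_lintegral_ball_le {μ : Measure (E (Fin d ⊕ Fin n))} [SFinite μ]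
    {H : E (Fin d ⊕ Fin n) → ℝ≥0∞} (hH : Measurable H) (N : ℝ) (k : ℕ) :
    ∫⁻ x in Metric.ball (0 : E (Fin d)) N,
        ∫⁻ y in Metric.ball (embed n x) (2 ^ (-(k : ℤ)) / 2), H y ∂μ ≤
      volume (Metric.ball (0 : E (Fin d)) (2 ^ (-(k : ℤ)) / 2)) *
        ∫⁻ y in proj ⁻¹' Metric.ball 0 (N + 1) ∩ vert ⁻¹' slab n k, H y ∂μ := by
  set ρ : ℝ := 2 ^ (-(k : ℤ)) / 2 with hρ
  have hρ0 : 0 < ρ := by positivity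
  have hρ1 : ρ ≤ 1 := by
    have : (2 : ℝ) ^ (-(k : ℤ)) ≤ 1 := zpow_le_one_of_nonpos₀ one_le_two (by omega)
    rw [hρ]; linarith
  set S : Set (E (Fin d) × E (Fin d ⊕ Fin n)) := {z | dist z.2 (embed n z.1) < ρ} with hS
  have hSm : MeasurableSet S :=
    measurableSet_lt ((continuous_snd.dist (continuous_embed.comp continuous_fst)).measurable)
      measurable_const
  set T : Set (E (Fin d ⊕ Fin n)) := proj ⁻¹' Metric.ball 0 (N + 1) ∩ vert ⁻¹' slab n k with hT
  have hTm : MeasurableSet T :=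
    (measurable_proj Metric.isOpen_ball.measurableSet).inter (measurable_vert (measurableSet_slab _))
  have e1 : ∀ x : E (Fin d), ∫⁻ y in Metric.ball (embed n x) ρ, H y ∂μ =
      ∫⁻ y, S.indicator (fun z => H z.2) (x, y) ∂μ := by
    intro x
    rw [← lintegral_indicator Metric.isOpen_ball.measurableSet]
    rfl
  simp only [e1]
  rw [lintegral_lintegral_swap]
  swap
  · exact ((hH.comp measurable_snd).indicator hSm).aemeasurable
  calc ∫⁻ y, (∫⁻ x in Metric.ball (0 : E (Fin d)) N, S.indicator (fun z => H z.2) (x, y)) ∂μ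
      ≤ ∫⁻ y, volume (Metric.ball (0 : E (Fin d)) ρ) * T.indicator H y ∂μ := by
        refine lintegral_mono fun y => ?_
        calc ∫⁻ x in Metric.ball (0 : E (Fin d)) N, S.indicator (fun z => H z.2) (x, y)
            ≤ ∫⁻ x in Metric.ball (0 : E (Fin d)) N,
                (Metric.ball (proj y) ρ).indicator (fun _ => T.indicator H y) x := by
              refine setLIntegral_mono' Metric.isOpen_ball.measurableSet fun x hx => ?_
              by_cases hxy : (x, y) ∈ S
              · have h1 : dist y (embed n x) < ρ := hxy
                have h2 := dist_proj_le y x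
                have h3 : y ∈ T := by
                  constructor
                  · rw [Set.mem_preimage, Metric.mem_ball] at *
                    have := dist_triangle (proj y) x 0
                    linarith
                  · have h4 := norm_vert_le_dist (x := y) (embed_mem_base (n := n) x)
                    have h5 := supNorm_le_norm (vert y)
                    show supNorm (vert y) ≤ 16 * 2 ^ (-(k : ℤ))
                    have : (0 : ℝ) < 2 ^ (-(k : ℤ)) := by positivity
                    linarith
                have h6 : x ∈ Metric.ball (proj y) ρ := by
                  rw [Metric.mem_ball, dist_comm]; linarith
                rw [Set.indicator_of_mem hxy, Set.indicator_of_mem h6, Set.indicator_of_mem h3]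
              · rw [Set.indicator_of_notMem hxy]; exact zero_le
          _ ≤ ∫⁻ x, (Metric.ball (proj y) ρ).indicator (fun _ => T.indicator H y) x :=
              lintegral_mono' Measure.restrict_le_self le_rfl
          _ = volume (Metric.ball (0 : E (Fin d)) ρ) * T.indicator H y := by
              rw [lintegral_indicator Metric.isOpen_ball.measurableSet, setLIntegral_const,
                Measure.addHaar_ball_center, mul_comm]
    _ = _ := by
        rw [lintegral_const_mul _ (hH.indicator hTm), lintegral_indicator hTm]

/-- Hölder's inequality on a set of finite measure. -/
theorem setLIntegral_le_eLpNorm_mul {X : Type*} [MeasurableSpace X] {μ : Measure X} {p : ℝ≥0∞}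
    (hp : 1 ≤ p) {H : X → ℝ≥0∞} (hH : Measurable H) (T : Set X) :
    ∫⁻ y in T, H y ∂μ ≤ eLpNorm H p μ * μ T ^ (1 - (p⁻¹).toReal) := by
  have := eLpNorm_le_eLpNorm_mul_rpow_measure_univ (μ := μ.restrict T) hp
    hH.aestronglyMeasurable
  rw [eLpNorm_one_eq_lintegral_enorm] at this
  simp only [enorm_eq_self, ENNReal.toReal_one, Measure.restrict_apply_univ, one_div, inv_one] at this
  rw [ENNReal.toReal_inv]
  refine this.trans ?_
  gcongr
  exact Measure.restrict_le_self

theorem volume_ball_le (k : ℕ) : volume (Metric.ball (0 : E (Fin d)) (2 ^ (-(k : ℤ)) / 2)) ≤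
    2 ^ (-(k : ℝ) * d) * volume (Metric.ball (0 : E (Fin d)) 1) := by
  rw [Measure.addHaar_ball_of_pos _ _ (by positivity), finrank_euclideanSpace, Fintype.card_fin]
  gcongr
  rw [← ofReal_two_rpow]
  apply ENNReal.ofReal_le_ofReal
  rw [← two_zpow_rpow, Real.rpow_natCast]
  gcongr
  have : (0 : ℝ) < 2 ^ (-(k : ℤ)) := by positivity
  linarith

theorem toReal_inv_le_one {p : ℝ≥0∞} (hp : 1 ≤ p) : (p⁻¹).toReal ≤ 1 := by
  rw [← ENNReal.toReal_one]
  exact ENNReal.toReal_mono ENNReal.one_ne_top (ENNReal.inv_le_one.2 hp)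

section Trace

variable {s : ℝ} {p q : ℝ≥0∞} {α : ℝ} {f : E (Fin d ⊕ Fin n) → ℂ}

theorem eLpNorm_tailOsc_le (hp : 1 ≤ p) (hq : 0 < q) (μ : Measure (E (Fin d ⊕ Fin n))) (k : ℕ) :
    eLpNorm (tailOsc μ f k) p μ ≤ (2 : ℝ≥0∞) ^ (-(k : ℝ) * s) *
      ((∑' i : ℕ, (2 : ℝ≥0∞) ^ (-(i : ℝ) * s)) * besovNorm s p q μ f) := by
  refine (eLpNorm_tsum_ennreal_le hp fun i => measurable_osc μ f _).trans ?_
  rw [← ENNReal.tsum_mul_right, ← ENNReal.tsum_mul_left]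
  refine ENNReal.tsum_le_tsum fun i => ?_
  refine (eLpNorm_osc_le_besovNorm (s := s) hp hq μ f (k + i)).trans_eq ?_
  rw [← mul_assoc, ← two_rpow_add]
  congr 2; push_cast; ring

/-- The averages of the tail of the oscillations over balls centred at `ℝ^d` tend to zero, since
their `L^1` norms on bounded sets decay geometrically. -/
theorem ae_tendsto_ball_tailOsc (hn : 1 ≤ n) (hs0 : 0 < s) (hp : 1 ≤ p) (hq : 0 < q)
    (hα : -(n : ℝ) < α) (hσ : 0 < s - (α + n) * (p⁻¹).toReal)
    (hf : besovNorm s p q (weightMeasure d n α) f ≠ ∞) :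
    ∀ᵐ x : E (Fin d), Tendsto (fun k : ℕ => (2 : ℝ≥0∞) ^ ((k : ℝ) * (d + (n + α))) *
      ∫⁻ y in Metric.ball (embed n x) (2 ^ (-(k : ℤ)) / 2),
        tailOsc (weightMeasure d n α) f k y ∂(weightMeasure d n α)) atTop (𝓝 0) := by
  set μ := weightMeasure d n α with hμ
  set r := (p⁻¹).toReal with hr
  have hr1 : 0 ≤ 1 - r := by have := toReal_inv_le_one hp; linarith
  have : SFinite μ := by rw [hμ, weightMeasure_eq]; infer_instance
  obtain ⟨C, hC⟩ := exists_fiberMeasure_slab_le hn hα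
  set S : ℝ≥0∞ := ∑' i : ℕ, (2 : ℝ≥0∞) ^ (-(i : ℝ) * s) with hS
  have hSt : S ≠ ∞ := tsum_two_rpow_ne_top hs0
  suffices H : ∀ N : ℕ, ∀ᵐ x ∂(volume.restrict (Metric.ball (0 : E (Fin d)) N)),
      Tendsto (fun k : ℕ => (2 : ℝ≥0∞) ^ ((k : ℝ) * (d + (n + α))) *
      ∫⁻ y in Metric.ball (embed n x) (2 ^ (-(k : ℤ)) / 2), tailOsc μ f k y ∂μ) atTop (𝓝 0) by
    have h := (ae_restrict_iUnion_iff (fun N : ℕ => Metric.ball (0 : E (Fin d)) N) _).2 H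
    rwa [Metric.iUnion_ball_nat, Measure.restrict_univ] at h
  intro N
  set V : ℝ≥0∞ := volume (Metric.ball (0 : E (Fin d)) (N + 1)) with hV
  set V1 : ℝ≥0∞ := volume (Metric.ball (0 : E (Fin d)) 1) with hV1
  set M := besovNorm s p q μ f with hM
  have hmeas : ∀ k : ℕ, Measurable fun x : E (Fin d) => (2 : ℝ≥0∞) ^ ((k : ℝ) * (d + (n + α))) *
      ∫⁻ y in Metric.ball (embed n x) (2 ^ (-(k : ℤ)) / 2), tailOsc μ f k y ∂μ := by
    intro k
    refine Measurable.const_mul ?_ _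
    have hSm : MeasurableSet {z : E (Fin d) × E (Fin d ⊕ Fin n) |
        dist z.2 (embed n z.1) < 2 ^ (-(k : ℤ)) / 2} :=
      measurableSet_lt ((continuous_snd.dist (continuous_embed.comp continuous_fst)).measurable)
        measurable_const
    have := Measurable.lintegral_prod_right' (ν := μ)
      (((measurable_tailOsc (μ := μ) (f := f) k).comp measurable_snd).indicator hSm)
    convert this using 2 with x
    rw [← lintegral_indicator Metric.isOpen_ball.measurableSet]
    rfl
  refine ae_tendsto_zero_of_tsum_eLpNorm_ne_top le_rfl hmeas ?_
  have key : ∀ k : ℕ, eLpNorm (fun x : E (Fin d) => (2 : ℝ≥0∞) ^ ((k : ℝ) * (d + (n + α))) *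
      ∫⁻ y in Metric.ball (embed n x) (2 ^ (-(k : ℤ)) / 2), tailOsc μ f k y ∂μ) 1
      (volume.restrict (Metric.ball (0 : E (Fin d)) N)) ≤
      V1 * (S * M) * (V * C) ^ (1 - r) * (2 : ℝ≥0∞) ^ (-(k : ℝ) * (s - (α + n) * r)) := by
    intro k
    rw [eLpNorm_one_eq_lintegral_enorm]
    simp only [enorm_eq_self]
    rw [lintegral_const_mul' _ _ (two_rpow_ne_top _)]
    calc (2 : ℝ≥0∞) ^ ((k : ℝ) * (d + (n + α))) * ∫⁻ x in Metric.ball (0 : E (Fin d)) N,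
          ∫⁻ y in Metric.ball (embed n x) (2 ^ (-(k : ℤ)) / 2), tailOsc μ f k y ∂μ
        ≤ (2 : ℝ≥0∞) ^ ((k : ℝ) * (d + (n + α))) * ((2 ^ (-(k : ℝ) * d) * V1) *
          ((2 ^ (-(k : ℝ) * s) * (S * M)) *
            (V * (C * 2 ^ (-(k : ℝ) * (n + α)))) ^ (1 - r))) := by
          gcongr
          refine (lintegral_lintegral_ball_le (measurable_tailOsc k) _ k).trans ?_
          gcongr
          · exact volume_ball_le k
          · refine (setLIntegral_le_eLpNorm_mul hp (measurable_tailOsc k) _).trans ?_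
            gcongr
            · exact eLpNorm_tailOsc_le hp hq μ k
            · rw [hμ, weightMeasure_inter α Metric.isOpen_ball.measurableSet (measurableSet_slab _)]
              gcongr
              exact hC k
      _ = V1 * (S * M) * (V * C) ^ (1 - r) * ((2 : ℝ≥0∞) ^ ((k : ℝ) * (d + (n + α))) *
            2 ^ (-(k : ℝ) * d) * 2 ^ (-(k : ℝ) * s) * 2 ^ (-(k : ℝ) * (n + α) * (1 - r))) := by
          rw [← mul_assoc V, ENNReal.mul_rpow_of_nonneg _ _ hr1, ← ENNReal.rpow_mul]
          ring
      _ = _ := by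
          rw [← two_rpow_add, ← two_rpow_add, ← two_rpow_add]
          congr 2; ring
  refine ne_top_of_le_ne_top ?_ (ENNReal.tsum_le_tsum key)
  rw [ENNReal.tsum_mul_left]
  refine ENNReal.mul_ne_top (ENNReal.mul_ne_top (ENNReal.mul_ne_top measure_ball_lt_top.ne
    (ENNReal.mul_ne_top hSt hf)) (ENNReal.rpow_ne_top_of_nonneg hr1
      (ENNReal.mul_ne_top measure_ball_lt_top.ne ENNReal.coe_ne_top))) (tsum_two_rpow_ne_top hσ)

theorem tsum_eLpNorm_upOsc_ne_top (hn : 1 ≤ n) (hp : 1 ≤ p) (hq : 0 < q)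
    (hσ : 0 < s - (α + n) * (p⁻¹).toReal)
    (hf : besovNorm s p q (weightMeasure d n α) f ≠ ∞) :
    ∑' k : ℕ, eLpNorm (upOsc (weightMeasure d n α) f k) p volume ≠ ∞ := by
  obtain ⟨C, hC⟩ := exists_eLpNorm_comp_cubeUp_le (d := d) hn α p
  have key : ∀ k : ℕ, eLpNorm (upOsc (weightMeasure d n α) f k) p volume ≤
      C * besovNorm s p q (weightMeasure d n α) f *
        (2 : ℝ≥0∞) ^ (-(k : ℝ) * (s - (α + n) * (p⁻¹).toReal)) := by
    intro k
    refine (hC (cubeOsc (weightMeasure d n α) f) k).trans ?_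
    have h := eLpNorm_osc_le_besovNorm (s := s) hp hq (weightMeasure d n α) f k
    calc C * (2 : ℝ≥0∞) ^ ((k : ℝ) * ((α + n) * (p⁻¹).toReal)) *
          eLpNorm (osc (weightMeasure d n α) f k) p (weightMeasure d n α)
        ≤ C * (2 : ℝ≥0∞) ^ ((k : ℝ) * ((α + n) * (p⁻¹).toReal)) * ((2 : ℝ≥0∞) ^ (-(k : ℝ) * s) *
          besovNorm s p q (weightMeasure d n α) f) := by gcongr
      _ = C * besovNorm s p q (weightMeasure d n α) f *
          ((2 : ℝ≥0∞) ^ ((k : ℝ) * ((α + n) * (p⁻¹).toReal)) * (2 : ℝ≥0∞) ^ (-(k : ℝ) * s)) := by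
          ring
      _ = _ := by rw [← two_rpow_add]; congr 2; ring
  refine ne_top_of_le_ne_top ?_ (ENNReal.tsum_le_tsum key)
  rw [ENNReal.tsum_mul_left]
  exact ENNReal.mul_ne_top (ENNReal.mul_ne_top ENNReal.coe_ne_top hf) (tsum_two_rpow_ne_top hσ)

/-- Convergence of the averages over balls at a point, from the convergence of the averages over
cubes and the decay of the oscillations at that point. -/
theorem tendsto_ballAverage_of_upAvg (hn : 1 ≤ n) (hα : -(n : ℝ) < α)
    (hloc : LocallyIntegrable f (weightMeasure d n α)) {x : E (Fin d)} {l : ℂ}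
    (hl : Tendsto (fun k : ℕ => upAvg (weightMeasure d n α) f k x) atTop (𝓝 l))
    (hx1 : Tendsto (fun k : ℕ => upOsc (weightMeasure d n α) f k x) atTop (𝓝 0))
    (hx2 : Tendsto (fun k : ℕ => (2 : ℝ≥0∞) ^ ((k : ℝ) * (d + (n + α))) *
      ∫⁻ y in Metric.ball (embed n x) (2 ^ (-(k : ℤ)) / 2),
        tailOsc (weightMeasure d n α) f k y ∂(weightMeasure d n α)) atTop (𝓝 0)) :
    Tendsto (ballAverage (weightMeasure d n α) f x) (𝓝[>] 0) (𝓝 l) := by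
  have hlim := ae_tendsto_cubeAvg_weightMeasure hn hα hloc
  obtain ⟨c, hc0, hc⟩ := exists_le_weightMeasure_ball (d := d) hn α
  have hfin : ∀ r, weightMeasure d n α (Metric.ball (embed n x) r) ≠ ∞ := fun r =>
    weightMeasure_ne_top hn hα Metric.isBounded_ball
  generalize weightMeasure d n α = μ at *
  have hc0' : (c : ℝ≥0∞) ≠ 0 := by exact_mod_cast hc0
  -- the error at scale `k` tends to zero
  have herr : Tendsto (fun k : ℕ => (upOsc μ f k x + (c : ℝ≥0∞)⁻¹ *
      ((2 : ℝ≥0∞) ^ ((k : ℝ) * (d + (n + α))) *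
        ∫⁻ y in Metric.ball (embed n x) (2 ^ (-(k : ℤ)) / 2), tailOsc μ f k y ∂μ)) +
      ‖upAvg μ f k x - l‖ₑ) atTop (𝓝 0) := by
    have a2 := ENNReal.Tendsto.const_mul (a := (c : ℝ≥0∞)⁻¹) hx2
      (Or.inr (ENNReal.inv_ne_top.2 hc0'))
    have a3 : Tendsto (fun k : ℕ => ‖upAvg μ f k x - l‖ₑ) atTop (𝓝 0) := by
      have := tendsto_iff_edist_tendsto_0.1 hl
      simpa only [edist_eq_enorm_sub] using this
    simpa using (hx1.add a2).add a3
  rw [EMetric.tendsto_nhds]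
  intro ε hε
  obtain ⟨K, hK⟩ := eventually_atTop.1 (herr.eventually (gt_mem_nhds hε))
  have hKpos : (0 : ℝ) < 2 ^ (-(K : ℤ)) / 2 := by positivity
  filter_upwards [Ioo_mem_nhdsGT hKpos] with r hr
  -- the scale comparable to the radius
  obtain ⟨m, hm1, hm2⟩ := exists_mem_Ioc_zpow (x := 2 * r) (by linarith [hr.1])
    (one_lt_two (α := ℝ))
  have hmK : m < -(K : ℤ) :=
    (zpow_lt_zpow_iff_right₀ (one_lt_two (α := ℝ))).1 (by linarith [hr.2])
  obtain ⟨k, hk⟩ : ∃ k : ℕ, -(k : ℤ) = m + 1 := ⟨(-m - 1).toNat, by omega⟩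
  have hk1 : (2 : ℝ) ^ (-(k : ℤ)) / 4 < r := by
    rw [hk, zpow_add_one₀ two_ne_zero]; linarith
  have hk2 : r ≤ (2 : ℝ) ^ (-(k : ℤ)) / 2 := by rw [hk]; linarith
  have hball := hc k x r hk1
  have hpos : (c : ℝ≥0∞) * 2 ^ (-(k : ℝ) * (d + (n + α))) ≠ 0 :=
    mul_ne_zero hc0' (two_rpow_ne_zero _)
  have hb0 : μ (Metric.ball (embed n x) r) ≠ 0 :=
    (lt_of_lt_of_le (pos_iff_ne_zero.2 hpos) hball).ne'
  have hinv : (μ (Metric.ball (embed n x) r))⁻¹ ≤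
      (c : ℝ≥0∞)⁻¹ * 2 ^ ((k : ℝ) * (d + (n + α))) := by
    refine (ENNReal.inv_le_inv.2 hball).trans_eq ?_
    rw [ENNReal.mul_inv (Or.inl hc0') (Or.inl ENNReal.coe_ne_top), ← ENNReal.rpow_neg]
    congr 2; ring
  rw [edist_eq_enorm_sub, ← sub_add_sub_cancel _ (upAvg μ f k x) _]
  refine lt_of_le_of_lt ((enorm_add_le _ _).trans (add_le_add ?_ le_rfl)) (hK k (by omega))
  refine (enorm_ballAverage_sub_upAvg_le hloc hlim hk2 hb0 (hfin r)).trans ?_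
  rw [← mul_assoc]
  gcongr

/-- At almost every point of `ℝ^d` the averages over the cubes above the point converge, and the
averages over balls have the same limit. -/
theorem ae_tendsto_ballAverage (hn : 1 ≤ n) (hs0 : 0 < s) (hp : 1 ≤ p) (hq : 0 < q)
    (hα : -(n : ℝ) < α) (hσ : 0 < s - (α + n) * (p⁻¹).toReal)
    (hfp : MemLp f p (weightMeasure d n α))
    (hf : besovNorm s p q (weightMeasure d n α) f ≠ ∞) :
    ∀ᵐ x : E (Fin d),
      Tendsto (fun k : ℕ => upAvg (weightMeasure d n α) f k x) atTop
        (𝓝 (trace (weightMeasure d n α) f x)) ∧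
      Tendsto (ballAverage (weightMeasure d n α) f x) (𝓝[>] 0)
        (𝓝 (trace (weightMeasure d n α) f x)) := by
  have : IsLocallyFiniteMeasure (weightMeasure d n α) := isLocallyFiniteMeasure_weightMeasure hn hα
  have hloc : LocallyIntegrable f (weightMeasure d n α) := hfp.locallyIntegrable hp
  have hsum := tsum_eLpNorm_upOsc_ne_top hn hp hq hσ hf
  have h1 := ae_lt_top_of_eLpNorm_ne_top hp
    (Measurable.tsum fun k : ℕ => measurable_upOsc (μ := weightMeasure d n α) (f := f) k)
    (ne_top_of_le_ne_top hsum (eLpNorm_tsum_ennreal_le hp fun k : ℕ => measurable_upOsc k))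
  filter_upwards [h1, ae_tendsto_ball_tailOsc hn hs0 hp hq hα hσ hf] with x hx1 hx2
  -- the averages over cubes form a Cauchy sequence
  obtain ⟨l, hl⟩ : ∃ l, Tendsto (fun k : ℕ => upAvg (weightMeasure d n α) f k x) atTop (𝓝 l) := by
    refine cauchySeq_tendsto_of_complete (cauchySeq_of_edist_le_of_tsum_ne_top
      (fun k : ℕ => upOsc (weightMeasure d n α) f k x) (fun k => ?_) hx1.ne)
    rw [edist_eq_enorm_sub]
    exact enorm_upAvg_sub_le x (by push_cast; omega) (by push_cast; omega)
  have hb := tendsto_ballAverage_of_upAvg hn hα hloc hl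
    (ENNReal.tendsto_atTop_zero_of_tsum_ne_top hx1.ne) hx2
  have htr : trace (weightMeasure d n α) f x = l := hb.limUnder_eq
  rw [htr]
  exact ⟨hl, hb⟩

end Trace

end WhitneyTrace

namespace WhitneyTrace
open DyadicCube

/-! ### Boundedness of the trace -/

section TraceBound

variable {d n : ℕ} {s : ℝ} {p q : ℝ≥0∞} {α : ℝ} {f : E (Fin d ⊕ Fin n) → ℂ}

/-- The sum of the oscillations above `x` at all scales from `k` on. -/
noncomputable def tailUpOsc (μ : Measure (E (Fin d ⊕ Fin n))) (f : E (Fin d ⊕ Fin n) → ℂ) (k : ℕ)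
    (x : E (Fin d)) : ℝ≥0∞ := ∑' i : ℕ, upOsc μ f ((k + i : ℕ) : ℤ) x

variable {μ : Measure (E (Fin d ⊕ Fin n))}

theorem measurable_tailUpOsc (k : ℕ) : Measurable (tailUpOsc μ f k) :=
  Measurable.tsum fun i : ℕ => measurable_upOsc ((k + i : ℕ) : ℤ)

theorem eLpNorm_tailUpOsc_le (hp : 1 ≤ p) (k : ℕ) : eLpNorm (tailUpOsc μ f k) p volume ≤
    ∑' i : ℕ, eLpNorm (upOsc μ f ((k + i : ℕ) : ℤ)) p volume :=
  eLpNorm_tsum_ennreal_le hp fun i : ℕ => measurable_upOsc ((k + i : ℕ) : ℤ)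

theorem enorm_trace_sub_upAvg_le {x : E (Fin d)}
    (hx : Tendsto (fun k : ℕ => upAvg μ f k x) atTop (𝓝 (trace μ f x))) (k : ℕ) :
    ‖trace μ f x - upAvg μ f k x‖ₑ ≤ tailUpOsc μ f k x := by
  have := edist_le_tsum_of_edist_le_of_tendsto (f := fun k : ℕ => upAvg μ f k x)
    (fun k : ℕ => upOsc μ f (k : ℤ) x) (fun n => ?_) hx k
  · rwa [edist_comm, edist_eq_enorm_sub] at this
  · rw [edist_eq_enorm_sub]
    exact enorm_upAvg_sub_le x (by push_cast; omega) (by push_cast; omega)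

theorem exists_eLpNorm_upAvg_zero_le (hn : 1 ≤ n) (hα : -(n : ℝ) < α) (hp : 1 ≤ p) :
    ∃ C : ℝ≥0, ∀ f : E (Fin d ⊕ Fin n) → ℂ, MemLp f p (weightMeasure d n α) →
      eLpNorm (fun x => ‖upAvg (weightMeasure d n α) f (0 : ℕ) x‖ₑ) p volume ≤
        C * eLpNorm f p (weightMeasure d n α) := by
  obtain ⟨C, hC⟩ := exists_eLpNorm_comp_cubeUp_le (d := d) hn α p
  refine ⟨C, fun f hf => ?_⟩
  have h1 := hC (fun P => ‖cubeAvg (weightMeasure d n α) f P‖ₑ) 0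
  rw [show (((0 : ℕ) : ℝ) * ((α + n) * (p⁻¹).toReal)) = 0 by simp, ENNReal.rpow_zero,
    mul_one] at h1
  refine h1.trans ?_
  gcongr
  refine (eLpNorm_mono_ennreal fun y => enorm_cubeAvg_le (weightMeasure d n α) f _).trans ?_
  refine (eLpNorm_cubeLavg_le (weightMeasure_toSet_ne_zero hn α)
    (weightMeasure_toSet_ne_top hn hα) hp hf.1.enorm (0 : ℕ) (τ := id) Function.injective_id
      (fun _ => rfl) (fun _ => rfl)).trans ?_
  exact eLpNorm_mono_enorm fun y => by simp

/-- The oscillation of the trace is controlled by the oscillations of `f` above the point. -/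
theorem osc_trace_le {k : ℕ}
    (hint : LocallyIntegrable (trace μ f) volume)
    (hx : ∀ᵐ x : E (Fin d), Tendsto (fun k : ℕ => upAvg μ f k x) atTop (𝓝 (trace μ f x)))
    (x : E (Fin d)) : osc volume (trace μ f) k x ≤
      2 * 2 ^ d * nbrAvg (fun z => upOsc μ f k z + tailUpOsc μ f k z) (cubeAt k x) +
        upOsc μ f k x := by
  set g := trace μ f
  set h : E (Fin d) → ℝ≥0∞ := fun z => upOsc μ f k z + tailUpOsc μ f k z with hh
  set Q := cubeAt (k : ℤ) x with hQ
  -- the comparison of the averages of the trace and of `f`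
  have key : ∀ Q' : DyadicCube (Fin d), Q.Neighbor Q' →
      ‖cubeAvg volume g Q' - cubeAvg μ f (cubeUp n Q')‖ₑ ≤ 2 ^ d * nbrAvg h Q := by
    intro Q' hQ'
    have hscale := neighbor_iff.1 hQ'
    have h1 : IntegrableOn g Q'.toSet volume :=
      (hint.integrableOn_isCompact Q'.isBounded_toSet.isCompact_closure).mono_set subset_closure
    refine (enorm_cubeAvg_sub_le h1 Q'.volume_toSet_ne_zero Q'.volume_toSet_ne_top _).trans ?_
    refine le_trans ?_ ((cubeLavg_le_nbrAvg h hQ').trans_eq (by rw [Fintype.card_fin]))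
    refine cubeLavg_mono_ae ?_
    filter_upwards [hx] with z hz hzQ
    have e : cubeAvg μ f (cubeUp n Q') = upAvg μ f Q'.scale z := by
      rw [upAvg, ← eq_cubeAt hzQ]
    rw [e, ← sub_add_sub_cancel _ (upAvg μ f k z) _, add_comm (_ - _)]
    refine (enorm_add_le _ _).trans (add_le_add ?_ (enorm_trace_sub_upAvg_le hz k))
    exact enorm_upAvg_sub_le z hscale.1 hscale.2.1
  refine iSup_le fun Q' => ?_
  have hself : Q.Neighbor Q := neighbor_cubeAt_of_scale x (by omega) (by omega)
  have e : cubeAvg volume g Q - cubeAvg volume g Q'.1 =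
      (cubeAvg volume g Q - cubeAvg μ f (cubeUp n Q)) +
      (cubeAvg μ f (cubeUp n Q'.1) - cubeAvg volume g Q'.1) +
      (cubeAvg μ f (cubeUp n Q) - cubeAvg μ f (cubeUp n Q'.1)) := by ring
  rw [e]
  refine (enorm_add_le _ _).trans (add_le_add ((enorm_add_le _ _).trans ?_) ?_)
  · rw [mul_assoc, two_mul]
    refine add_le_add (key Q hself) ?_
    rw [← enorm_neg, neg_sub]
    exact key Q'.1 Q'.2
  · exact enorm_sub_le_cubeOsc _ _ (cubeUp_neighbor Q'.2)

theorem eLpNorm_osc_trace_le (hp : 1 ≤ p) (k : ℕ)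
    (hint : LocallyIntegrable (trace μ f) volume)
    (hx : ∀ᵐ x : E (Fin d), Tendsto (fun k : ℕ => upAvg μ f k x) atTop (𝓝 (trace μ f x))) :
    eLpNorm (osc volume (trace μ f) k) p volume ≤ (2 * 2 ^ d * 7 ^ d * 2 + 1) *
      ∑' i : ℕ, eLpNorm (upOsc μ f ((k + i : ℕ) : ℤ)) p volume := by
  set S := ∑' i : ℕ, eLpNorm (upOsc μ f ((k + i : ℕ) : ℤ)) p volume with hS
  have h0 : eLpNorm (upOsc μ f k) p volume ≤ S := by
    have := ENNReal.le_tsum (f := fun i : ℕ => eLpNorm (upOsc μ f ((k + i : ℕ) : ℤ)) p volume) 0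
    rwa [add_zero] at this
  have hm : Measurable fun z => upOsc μ f k z + tailUpOsc μ f k z :=
    (measurable_upOsc _).add (measurable_tailUpOsc k)
  have h1 : eLpNorm (fun z => upOsc μ f k z + tailUpOsc μ f k z) p volume ≤ 2 * S := by
    refine (eLpNorm_add_ennreal_le hp (measurable_upOsc _) (measurable_tailUpOsc k)).trans ?_
    rw [two_mul]
    exact add_le_add h0 (eLpNorm_tailUpOsc_le hp k)
  have hn := eLpNorm_nbrAvg_le hp hm.aemeasurable k
  calc eLpNorm (osc volume (trace μ f) k) p volume
      ≤ eLpNorm (fun x => 2 * 2 ^ d * nbrAvg (fun z => upOsc μ f k z + tailUpOsc μ f k z)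
          (cubeAt k x) + upOsc μ f k x) p volume := eLpNorm_mono_ennreal (osc_trace_le hint hx)
    _ ≤ 2 * 2 ^ d * (((7 ^ Fintype.card (Fin d) : ℕ) : ℝ≥0∞) * (2 * S)) + S := by
        refine (eLpNorm_add_ennreal_le hp ((measurable_nbrAvg _ k).const_mul _)
          (measurable_upOsc _)).trans (add_le_add ?_ h0)
        refine (eLpNorm_const_mul_ennreal_le (measurable_nbrAvg _ k) _).trans ?_
        gcongr
        exact hn.trans (by gcongr)
    _ = _ := by
        rw [Fintype.card_fin]; push_cast; ring

theorem aestronglyMeasurable_trace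
    (hx : ∀ᵐ x : E (Fin d), Tendsto (fun k : ℕ => upAvg μ f k x) atTop (𝓝 (trace μ f x))) :
    AEStronglyMeasurable (trace μ f) volume :=
  aestronglyMeasurable_of_tendsto_ae atTop
    (fun k : ℕ => (measurable_upAvg (μ := μ) (f := f) k).aestronglyMeasurable) hx

theorem exists_eLpNorm_trace_le (hn : 1 ≤ n) (hs0 : 0 < s) (hp : 1 ≤ p) (hq : 0 < q)
    (hα : -(n : ℝ) < α) (hσ : 0 < s - (α + n) * (p⁻¹).toReal) :
    ∃ C : ℝ≥0, ∀ f : E (Fin d ⊕ Fin n) → ℂ, MemLp f p (weightMeasure d n α) →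
      besovNorm s p q (weightMeasure d n α) f ≠ ∞ →
      eLpNorm (trace (weightMeasure d n α) f) p volume ≤
        C * besovNorm s p q (weightMeasure d n α) f := by
  obtain ⟨C₁, hC₁⟩ := exists_eLpNorm_upAvg_zero_le (d := d) hn hα hp
  obtain ⟨C₂, hC₂⟩ := exists_eLpNorm_comp_cubeUp_le (d := d) hn α p
  set σ := s - (α + n) * (p⁻¹).toReal with hσd
  set S : ℝ≥0∞ := ∑' k : ℕ, (2 : ℝ≥0∞) ^ (-(k : ℝ) * σ) with hS
  have hSt : S ≠ ∞ := tsum_two_rpow_ne_top hσ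
  refine ⟨(C₁ + C₂ * S).toNNReal, fun f hfp hf => ?_⟩
  rw [ENNReal.coe_toNNReal (by finiteness)]
  have hx := ae_tendsto_ballAverage hn hs0 hp hq hα hσ hfp hf
  set μ := weightMeasure d n α
  set M := besovNorm s p q μ f with hM
  have h1 : eLpNorm (trace μ f) p volume ≤
      eLpNorm (fun x => ‖upAvg μ f (0 : ℕ) x‖ₑ + tailUpOsc μ f 0 x) p volume := by
    refine eLpNorm_mono_enorm_ae ?_
    filter_upwards [hx] with x hx
    rw [enorm_eq_self, ← sub_add_cancel (trace μ f x) (upAvg μ f (0 : ℕ) x), add_comm]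
    refine (enorm_add_le _ _).trans (add_le_add le_rfl ?_)
    simpa using enorm_trace_sub_upAvg_le hx.1 0
  have h2 : ∀ i : ℕ, eLpNorm (upOsc μ f ((0 + i : ℕ) : ℤ)) p volume ≤
      C₂ * M * (2 : ℝ≥0∞) ^ (-(i : ℝ) * σ) := by
    intro i
    rw [zero_add]
    refine (hC₂ (cubeOsc μ f) i).trans ?_
    have h := eLpNorm_osc_le_besovNorm (s := s) hp hq μ f i
    calc C₂ * (2 : ℝ≥0∞) ^ ((i : ℝ) * ((α + n) * (p⁻¹).toReal)) * eLpNorm (osc μ f i) p μ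
        ≤ C₂ * (2 : ℝ≥0∞) ^ ((i : ℝ) * ((α + n) * (p⁻¹).toReal)) *
          ((2 : ℝ≥0∞) ^ (-(i : ℝ) * s) * M) := by gcongr
      _ = C₂ * M * ((2 : ℝ≥0∞) ^ ((i : ℝ) * ((α + n) * (p⁻¹).toReal)) *
          (2 : ℝ≥0∞) ^ (-(i : ℝ) * s)) := by ring
      _ = _ := by rw [← two_rpow_add, hσd]; congr 2; ring
  calc eLpNorm (trace μ f) p volume
      ≤ C₁ * eLpNorm f p μ + ∑' i : ℕ, C₂ * M * (2 : ℝ≥0∞) ^ (-(i : ℝ) * σ) := by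
        refine h1.trans ((eLpNorm_add_ennreal_le hp (measurable_upAvg _).enorm
          (measurable_tailUpOsc 0)).trans (add_le_add (hC₁ f hfp) ?_))
        exact (eLpNorm_tailUpOsc_le hp 0).trans (ENNReal.tsum_le_tsum h2)
    _ ≤ C₁ * M + C₂ * M * S := by
        rw [ENNReal.tsum_mul_left]
        gcongr
        exact le_self_add
    _ = _ := by ring

theorem tsum_add_le_tsum (F : ℕ → ℝ≥0∞) (k : ℕ) : ∑' i, F (k + i) ≤ ∑' l, F l :=
  ENNReal.tsum_comp_le_tsum_of_injective (add_right_injective k) F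

/-- The trace operator is bounded from the weighted Besov space to the Besov space on `ℝ^d`. -/
theorem exists_besovNorm_trace_le (hn : 1 ≤ n) (hs0 : 0 < s) (hp : 1 ≤ p) (hq : 0 < q)
    (hα : -(n : ℝ) < α) (hσ : 0 < s - (α + n) * (p⁻¹).toReal) :
    ∃ C : ℝ≥0, ∀ f : E (Fin d ⊕ Fin n) → ℂ, MemLp f p (weightMeasure d n α) →
      besovNorm s p q (weightMeasure d n α) f ≠ ∞ →
      besovNorm (s - (α + n) * (p⁻¹).toReal) p q volume (trace (weightMeasure d n α) f) ≤
        C * besovNorm s p q (weightMeasure d n α) f := by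
  obtain ⟨C₁, hC₁⟩ := exists_eLpNorm_trace_le (d := d) hn hs0 hp hq hα hσ
  obtain ⟨C₂, hC₂⟩ := exists_eLpNorm_comp_cubeUp_le (d := d) hn α p
  set σ := s - (α + n) * (p⁻¹).toReal with hσd
  obtain ⟨C₃, hC₃⟩ := exists_lq_le_of_le_tsum hq hσ
  set A : ℝ≥0∞ := 2 * 2 ^ d * 7 ^ d * 2 + 1 with hA
  set B : ℝ≥0∞ := ((3 * 5 ^ Fintype.card (Fin d) : ℕ) : ℝ≥0∞) with hB
  have hAt : A ≠ ∞ := by rw [hA]; finiteness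
  have hBt : B ≠ ∞ := ENNReal.natCast_ne_top _
  refine ⟨(C₁ + B * (C₃ * (A * C₂))).toNNReal, fun f hfp hf => ?_⟩
  rw [ENNReal.coe_toNNReal (by finiteness), add_mul, besovNorm]
  refine add_le_add (hC₁ f hfp hf) ?_
  have hx := (ae_tendsto_ballAverage hn hs0 hp hq hα hσ hfp hf).mono fun x hx => hx.1
  have hmem : MemLp (trace (weightMeasure d n α) f) p volume :=
    ⟨aestronglyMeasurable_trace hx,
      (hC₁ f hfp hf).trans_lt (ENNReal.mul_lt_top ENNReal.coe_lt_top hf.lt_top)⟩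
  have hint := hmem.locallyIntegrable hp
  set μ := weightMeasure d n α
  refine (besovEnergy_le_lq_osc σ hp hq (fun Q => Q.volume_toSet_ne_zero) _).trans ?_
  rw [← hB, mul_assoc]
  gcongr
  rw [mul_assoc]
  have hl := (lq_const_mul_le hq (A * C₂) fun k : ℕ => (2 : ℝ≥0∞) ^ ((k : ℝ) * s) *
    eLpNorm (osc μ f k) p μ).trans (mul_le_mul_right
      ((lq_osc_le_besovEnergy s hp q μ f).trans (le_add_self (b := eLpNorm f p μ))) _)
  refine (hC₃ _ (fun l : ℕ => A * C₂ * ((2 : ℝ≥0∞) ^ ((l : ℝ) * s) * eLpNorm (osc μ f l) p μ))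
    fun k => ?_).trans (mul_le_mul_right hl _)
  set F : ℕ → ℝ≥0∞ := fun l => (2 : ℝ≥0∞) ^ (-|(k : ℝ) - l| * σ) *
    (A * C₂ * ((2 : ℝ≥0∞) ^ ((l : ℝ) * s) * eLpNorm (osc μ f l) p μ)) with hF
  refine le_trans ?_ (tsum_add_le_tsum F k)
  calc (2 : ℝ≥0∞) ^ ((k : ℝ) * σ) * eLpNorm (osc volume (trace μ f) k) p volume
      ≤ (2 : ℝ≥0∞) ^ ((k : ℝ) * σ) * (A * ∑' i : ℕ, eLpNorm (upOsc μ f ((k + i : ℕ) : ℤ)) p volume) := by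
        gcongr; exact eLpNorm_osc_trace_le hp k hint hx
    _ = ∑' i : ℕ, (2 : ℝ≥0∞) ^ ((k : ℝ) * σ) *
          (A * eLpNorm (upOsc μ f ((k + i : ℕ) : ℤ)) p volume) := by
        rw [ENNReal.tsum_mul_left, ENNReal.tsum_mul_left]
    _ ≤ ∑' i, F (k + i) := by
        refine ENNReal.tsum_le_tsum fun i => ?_
        calc (2 : ℝ≥0∞) ^ ((k : ℝ) * σ) * (A * eLpNorm (upOsc μ f ((k + i : ℕ) : ℤ)) p volume)
            ≤ (2 : ℝ≥0∞) ^ ((k : ℝ) * σ) * (A * (C₂ * (2 : ℝ≥0∞) ^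
                (((k + i : ℕ) : ℝ) * ((α + n) * (p⁻¹).toReal)) * eLpNorm (osc μ f (k + i : ℕ)) p μ)) := by
              gcongr
              exact hC₂ (cubeOsc μ f) (k + i)
          _ = A * C₂ * ((2 : ℝ≥0∞) ^ ((k : ℝ) * σ) * (2 : ℝ≥0∞) ^
                (((k + i : ℕ) : ℝ) * ((α + n) * (p⁻¹).toReal))) * eLpNorm (osc μ f (k + i : ℕ)) p μ := by
              ring
          _ = A * C₂ * ((2 : ℝ≥0∞) ^ (-|(k : ℝ) - (k + i : ℕ)| * σ) *
                (2 : ℝ≥0∞) ^ (((k + i : ℕ) : ℝ) * s)) * eLpNorm (osc μ f (k + i : ℕ)) p μ := by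
              rw [← two_rpow_add, ← two_rpow_add, hσd]
              congr 3
              push_cast
              rw [show (k : ℝ) - (k + i) = -i by ring, abs_neg, abs_of_nonneg (by positivity)]
              ring
          _ = F (k + i) := by simp only [hF]; ring

end TraceBound

end WhitneyTrace

namespace WhitneyTrace
open DyadicCube

/-! ### Whitney cubes -/

section WhitneyCubes

variable {d n : ℕ}

theorem scale_and_projCube_of_mem_whitneyCubes {Q : DyadicCube (Fin d)}
    {P : DyadicCube (Fin d ⊕ Fin n)} (hP : P ∈ whitneyCubes n Q) :
    P.scale = Q.scale ∧ projCube P = Q := by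
  refine ⟨hP.1, ?_⟩
  obtain ⟨y, hy⟩ := P.toSet_nonempty
  have h1 : proj y ∈ Q.toSet := (hP.2 hy).1.1
  have h2 : proj y ∈ (projCube P).toSet := by
    rw [toSet_eq_inter] at hy; exact hy.1
  rw [eq_cubeAt h1, eq_cubeAt h2]
  exact congrArg (fun k => cubeAt k (proj y)) hP.1

theorem mem_allWhitneyCubes_iff {P : DyadicCube (Fin d ⊕ Fin n)} :
    P ∈ allWhitneyCubes d n ↔ 0 ≤ P.scale ∧ P ∈ whitneyCubes n (projCube P) := by
  simp only [allWhitneyCubes, Set.mem_iUnion]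
  constructor
  · rintro ⟨Q, hQ⟩
    obtain ⟨h1, h2⟩ := scale_and_projCube_of_mem_whitneyCubes hQ
    exact ⟨h1 ▸ Q.2, h2 ▸ hQ⟩
  · rintro ⟨h1, h2⟩
    exact ⟨⟨projCube P, h1⟩, h2⟩

theorem height_mem_of_mem_whitney {P : DyadicCube (Fin d ⊕ Fin n)} (hP : P ∈ allWhitneyCubes d n)
    {y : E (Fin d ⊕ Fin n)} (hy : y ∈ P.toSet) :
    P.side ≤ height y ∧ height y ≤ 2 * P.side := by
  obtain ⟨-, hP⟩ := mem_allWhitneyCubes_iff.1 hP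
  have hs : (projCube P).side = P.side := rfl
  have hpos : 0 < P.side := P.side_pos
  obtain ⟨⟨h1, h2⟩, h3⟩ := hP.2 hy
  rw [hs] at h2
  refine ⟨?_, (height_le_iff (by positivity)).2 fun j => abs_le.2 (h2 j)⟩
  by_contra! hlt
  refine h3 ⟨h1, fun j => ?_⟩
  rw [hs]
  exact abs_lt.1 ((abs_le_height y j).trans_lt hlt)

/-- The Whitney cubes cover the layer `0 < height < 2`. -/
theorem exists_mem_whitney {y : E (Fin d ⊕ Fin n)} (h0 : 0 < height y) (h2 : height y < 2) :
    ∃ P ∈ allWhitneyCubes d n, y ∈ P.toSet := by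
  have hex : ∃ k : ℕ, ∃ j : Fin n, ¬ (-1 < (2 : ℝ) ^ k * vert y j ∧ (2 : ℝ) ^ k * vert y j ≤ 1) := by
    obtain ⟨k, hk⟩ := pow_unbounded_of_one_lt (height y)⁻¹ (one_lt_two (α := ℝ))
    refine ⟨k, ?_⟩
    by_contra! hall
    have hk0 : (0 : ℝ) < 2 ^ k := by positivity
    have : height y ≤ (2 ^ k)⁻¹ := (height_le_iff (by positivity)).2 fun j => by
      have := hall j
      rw [← one_div, le_div_iff₀ hk0]
      change |vert y j| * _ ≤ 1
      rw [← abs_of_pos hk0, ← abs_mul, mul_comm, abs_le]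
      exact ⟨this.1.le, this.2⟩
    have h3 : 2 ^ k ≤ (height y)⁻¹ := by
      rw [← inv_inv ((2 : ℝ) ^ k)]; exact inv_anti₀ h0 this
    linarith
  classical
  set k := Nat.find hex with hk
  -- at the first scale at which `y` leaves `(-1, 1]^n`, it is still in `(-2, 2]^n`
  have hbd : ∀ j : Fin n, -2 < (2 : ℝ) ^ k * vert y j ∧ (2 : ℝ) ^ k * vert y j ≤ 2 := by
    intro j
    rcases Nat.eq_zero_or_pos k with hk0 | hk0
    · have := (abs_le_height y j).trans_lt h2
      rw [hk0, pow_zero, one_mul]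
      exact ⟨(abs_lt.1 this).1, (abs_lt.1 this).2.le⟩
    · have := Nat.find_min hex (m := k - 1) (by omega)
      push Not at this
      obtain ⟨h1, h2⟩ := this j
      have e : (2 : ℝ) ^ k = 2 * 2 ^ (k - 1) := by
        rw [← pow_succ']; congr 1; omega
      rw [e]
      constructor <;> linarith
  obtain ⟨j₀, hj₀⟩ := Nat.find_spec hex
  rw [← hk] at hj₀
  refine ⟨cubeAt k y, mem_allWhitneyCubes_iff.2 ⟨by simp, rfl, fun z hz => ?_⟩, mem_cubeAt _ _⟩
  have hy := mem_toSet.1 (mem_cubeAt (k : ℤ) y)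
  have hz' := mem_toSet.1 hz
  simp only [cubeAt_scale, zpow_natCast] at hy hz'
  have hkp : (0 : ℝ) < 2 ^ k := by positivity
  have hside : (projCube (cubeAt (k : ℤ) y)).side = (2 ^ k)⁻¹ := by
    simp [DyadicCube.side, projCube]
  have hp : proj z ∈ (projCube (cubeAt (k : ℤ) y)).toSet := by
    rw [toSet_eq_inter] at hz; exact hz.1
  have hcast : ∀ {a b : ℤ}, (a : ℝ) < b → (a : ℝ) + 1 ≤ b := fun h => by
    exact_mod_cast Int.add_one_le_iff.2 (by exact_mod_cast h)
  refine ⟨⟨hp, fun j => ?_⟩, fun hcon => hj₀ ?_⟩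
  · have h1 := hy (Sum.inr j)
    have h2 := hz' (Sum.inr j)
    have h3 := hbd j
    simp only [vert_apply] at h3
    have h4 : ((cubeAt (k : ℤ) y).pos (Sum.inr j) : ℝ) + 1 ≤ (2 : ℤ) :=
      hcast (by push_cast; linarith)
    have h5 : ((-3 : ℤ) : ℝ) + 1 ≤ (cubeAt (k : ℤ) y).pos (Sum.inr j) :=
      hcast (by push_cast; linarith)
    push_cast at h4 h5
    rw [hside, Set.mem_Icc, ← mul_le_mul_iff_right₀ hkp, ← mul_le_mul_iff_right₀ (c := 2 * _) hkp]
    rw [mul_neg, mul_left_comm, mul_inv_cancel₀ hkp.ne']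
    constructor <;> linarith
  · have h1 := hy (Sum.inr j₀)
    have h2 := hz' (Sum.inr j₀)
    have h3 := hcon.2 j₀
    rw [hside, Set.mem_Ioo, ← mul_lt_mul_iff_right₀ hkp,
      ← mul_lt_mul_iff_right₀ (c := (2 ^ k : ℝ)⁻¹) hkp, mul_neg, mul_inv_cancel₀ hkp.ne'] at h3
    have h4 : ((cubeAt (k : ℤ) y).pos (Sum.inr j₀) : ℝ) + 1 ≤ (1 : ℤ) :=
      hcast (by push_cast; linarith)
    have h5 : ((-2 : ℤ) : ℝ) + 1 ≤ (cubeAt (k : ℤ) y).pos (Sum.inr j₀) :=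
      hcast (by push_cast; linarith)
    push_cast at h4 h5
    simp only [vert_apply]
    constructor <;> linarith

/-- A finitely supported sum over the Whitney cubes, arranged by the cubes of `ℝ^d`. -/
theorem tsum_whitneyCubes_eq_sum {M : Type*} [NormedAddCommGroup M]
    {g : DyadicCube (Fin d ⊕ Fin n) → M} {T : Finset (DyadicCube (Fin d ⊕ Fin n))}
    (hT : (T : Set _) ⊆ allWhitneyCubes d n) (hg : ∀ P ∈ allWhitneyCubes d n, P ∉ T → g P = 0) :
    ∑' Q : SmallCube d, ∑' P : whitneyCubes n Q.1, g P.1 = ∑ P ∈ T, g P := by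
  classical
  let φ : (Σ Q : SmallCube d, whitneyCubes n Q.1) → DyadicCube (Fin d ⊕ Fin n) := fun a => a.2.1
  have hφ : Function.Injective φ := by
    rintro ⟨⟨Q, hQ⟩, ⟨P, hP⟩⟩ ⟨⟨Q', hQ'⟩, ⟨P', hP'⟩⟩ h
    have hPP : P = P' := h
    subst hPP
    have : Q = Q' := (scale_and_projCube_of_mem_whitneyCubes hP).2.symm.trans
      (scale_and_projCube_of_mem_whitneyCubes hP').2
    subst this
    rfl
  have hmem : ∀ a, φ a ∈ allWhitneyCubes d n := fun a => Set.mem_iUnion.2 ⟨a.1, a.2.2⟩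
  have hrange : allWhitneyCubes d n ⊆ Set.range φ := by
    intro P hP
    obtain ⟨Q, hQ⟩ := Set.mem_iUnion.1 hP
    exact ⟨⟨Q, P, hQ⟩, rfl⟩
  have hfin : (Function.support fun a => g (φ a)).Finite := by
    refine Set.Finite.subset (T.finite_toSet.preimage hφ.injOn) fun a ha => ?_
    by_contra hcon
    exact ha (hg _ (hmem a) hcon)
  have hinner : ∀ Q : SmallCube d, Summable fun P : whitneyCubes n Q.1 => g P.1 := fun Q => by
    refine summable_of_hasFiniteSupport ?_
    refine Set.Finite.subset (T.finite_toSet.preimage Subtype.val_injective.injOn) fun P hP => ?_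
    by_contra hcon
    exact hP (hg _ (hmem ⟨Q, P⟩) hcon)
  have h1 := Summable.tsum_sigma' (f := fun a => g (φ a)) hinner (summable_of_hasFiniteSupport hfin)
  refine Eq.trans h1.symm ?_
  have h2 : (fun a => g (φ a)) = fun a => (allWhitneyCubes d n).indicator g (φ a) := by
    funext a; rw [Set.indicator_of_mem (hmem a)]
  rw [h2, hφ.tsum_eq (Set.support_indicator_subset.trans hrange), tsum_eq_sum (s := T)]
  · exact Finset.sum_congr rfl fun P hP => Set.indicator_of_mem (hT hP) _
  · intro P hP
    by_cases hW : P ∈ allWhitneyCubes d n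
    · rw [Set.indicator_of_mem hW, hg P hW hP]
    · exact Set.indicator_of_notMem hW _

variable {ψ : DyadicCube (Fin d ⊕ Fin n) → E (Fin d ⊕ Fin n) → ℝ}

theorem IsWhitneyBumps.exists_of_ne_zero (hψ : IsWhitneyBumps ψ) {P : DyadicCube (Fin d ⊕ Fin n)}
    (hP : P ∈ allWhitneyCubes d n) {w : E (Fin d ⊕ Fin n)} (hw : ψ P w ≠ 0) :
    ∃ z ∈ P.toSet, ∀ i, |w i - z i| ≤ P.side / 4 := by
  obtain ⟨z, hz, hd⟩ := Metric.mem_thickening_iff.1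
    (hψ.support P hP (subset_tsupport _ (Function.mem_support.2 hw)))
  refine ⟨z, hz, fun i => ?_⟩
  have := PiLp.norm_apply_le (w - z) i
  rw [← dist_eq_norm] at this
  exact this.trans hd.le

theorem IsWhitneyBumps.height_mem (hψ : IsWhitneyBumps ψ) {P : DyadicCube (Fin d ⊕ Fin n)}
    (hP : P ∈ allWhitneyCubes d n) {w : E (Fin d ⊕ Fin n)} (hw : ψ P w ≠ 0) :
    3 / 4 * P.side ≤ height w ∧ height w ≤ 9 / 4 * P.side := by
  obtain ⟨z, hz, hd⟩ := hψ.exists_of_ne_zero hP hw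
  obtain ⟨h1, h2⟩ := height_mem_of_mem_whitney hP hz
  have hs := P.side_pos
  have h3 := height_le_add hd (by positivity)
  have h4 := height_le_add (y := z) (z := w) (r := P.side / 4)
    (fun i => by rw [abs_sub_comm]; exact hd i) (by positivity)
  constructor <;> linarith

/-- Near a point of height comparable to `2^m` the Whitney extension is a finite sum, over
boundedly many Whitney cubes close to the point. -/
theorem IsWhitneyBumps.exists_finset (hψ : IsWhitneyBumps ψ) {y : E (Fin d ⊕ Fin n)} {m : ℤ}
    (h1 : (2 : ℝ) ^ m < height y) (h2 : height y ≤ 2 ^ (m + 1)) :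
    ∃ T : Finset (DyadicCube (Fin d ⊕ Fin n)), (T : Set _) ⊆ allWhitneyCubes d n ∧
      T.card ≤ 3 * (3 * 5 ^ (d + n)) ∧
      (∀ P ∈ T, -m - 1 ≤ P.scale ∧ P.scale ≤ -m + 1 ∧ (cubeAt P.scale y).Neighbor P) ∧
      ∀ w : E (Fin d ⊕ Fin n), (∀ i, |w i - y i| ≤ 3 / 8 * 2 ^ m) →
        (∀ f, whitneyExt ψ f w = ∑ P ∈ T, cubeAvg volume f (projCube P) * (ψ P w : ℂ)) ∧
        (0 < height w → height w < 2 → ∑ P ∈ T, ψ P w = 1) := by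
  classical
  have hm : (0 : ℝ) < 2 ^ m := by positivity
  rw [zpow_add_one₀ two_ne_zero] at h2
  let N : ℤ → Set (DyadicCube (Fin d ⊕ Fin n)) := fun i => {P | (cubeAt i y).Neighbor P}
  have hN : ∀ i, (N i).encard ≤ ((3 * 5 ^ (d + n) : ℕ) : ℕ∞) := fun i => by
    have := card_neighbor_le (cubeAt i y)
    simp only [Fintype.card_sum, Fintype.card_fin] at this
    exact this
  set S : Set (DyadicCube (Fin d ⊕ Fin n)) :=
    {P | P ∈ allWhitneyCubes d n ∧ -m - 1 ≤ P.scale ∧ P.scale ≤ -m + 1 ∧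
      (cubeAt P.scale y).Neighbor P} with hS
  have hsub : S ⊆ N (-m - 1) ∪ N (-m) ∪ N (-m + 1) := by
    rintro P ⟨-, ha, hb, hc⟩
    have : P.scale = -m - 1 ∨ P.scale = -m ∨ P.scale = -m + 1 := by omega
    rcases this with h | h | h <;> rw [h] at hc
    · exact Or.inl (Or.inl hc)
    · exact Or.inl (Or.inr hc)
    · exact Or.inr hc
  have hcard : S.encard ≤ ((3 * (3 * 5 ^ (d + n)) : ℕ) : ℕ∞) := by
    refine (Set.encard_le_encard hsub).trans ((Set.encard_union_le _ _).trans
      ((add_le_add ((Set.encard_union_le _ _).trans (add_le_add (hN _) (hN _))) (hN _)).trans ?_))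
    rw [← Nat.cast_add, ← Nat.cast_add, Nat.cast_le]
    omega
  have hfin : S.Finite := Set.finite_of_encard_le_coe hcard
  have hTS : ∀ P, P ∈ hfin.toFinset ↔ P ∈ S := fun P => hfin.mem_toFinset
  refine ⟨hfin.toFinset, fun P hP => ((hTS P).1 hP).1, ?_, fun P hP => ((hTS P).1 hP).2, ?_⟩
  · rw [hfin.encard_eq_coe_toFinset_card] at hcard
    exact_mod_cast hcard
  intro w hw
  have hz : ∀ P ∈ allWhitneyCubes d n, P ∉ hfin.toFinset → ψ P w = 0 := by
    intro P hP hPT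
    by_contra hne
    refine hPT ((hTS P).2 ⟨hP, ?_⟩)
    obtain ⟨ha, hb⟩ := hψ.height_mem hP hne
    obtain ⟨z, hz, hd⟩ := hψ.exists_of_ne_zero hP hne
    have h3 := height_le_add hw (by positivity)
    have h4 := height_le_add (y := y) (z := w) (r := 3 / 8 * 2 ^ m)
      (fun i => by rw [abs_sub_comm]; exact hw i) (by positivity)
    have hside : P.side = 2 ^ (-P.scale) := rfl
    -- the height of `w` lies between `5/8 · 2^m` and `19/8 · 2^m`, which pins down the scale of `P`
    have h5 : -P.scale < m + 2 := by
      rw [← zpow_lt_zpow_iff_right₀ (one_lt_two (α := ℝ)), ← hside, zpow_add₀ two_ne_zero]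
      norm_num
      linarith
    have h6 : m - 2 < -P.scale := by
      rw [← zpow_lt_zpow_iff_right₀ (one_lt_two (α := ℝ)), ← hside, zpow_sub₀ two_ne_zero]
      norm_num
      linarith
    have h7 : (2 : ℝ) ^ m ≤ 2 * P.side := by
      have : m ≤ -P.scale + 1 := by omega
      have := zpow_le_zpow_right₀ (one_le_two (α := ℝ)) this
      rw [zpow_add_one₀ two_ne_zero, ← hside] at this
      linarith
    refine ⟨by omega, by omega, ?_⟩
    have hPz := eq_cubeAt hz
    rw [show (cubeAt P.scale y).Neighbor P ↔ (cubeAt P.scale y).Neighbor (cubeAt P.scale z) by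
      rw [← hPz]]
    refine neighbor_cubeAt fun i => ?_
    rw [← hside]
    have := abs_sub_le (y i) (w i) (z i)
    have h8 := hw i
    rw [abs_sub_comm] at h8
    have := hd i
    linarith
  refine ⟨fun f => ?_, fun hw0 hw2 => ?_⟩
  · rw [← tsum_whitneyCubes_eq_sum (g := fun P => cubeAvg volume f (projCube P) * (ψ P w : ℂ))
      (fun P hP => ((hTS P).1 hP).1) fun P hP hPT => by rw [hz P hP hPT]; simp]
    refine tsum_congr fun Q => tsum_congr fun P => ?_
    rw [(scale_and_projCube_of_mem_whitneyCubes P.2).2]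
    rfl
  · obtain ⟨P₀, hP₀, hwP⟩ := exists_mem_whitney hw0 hw2
    rw [← hψ.partition P₀ hP₀ w hwP]
    exact (tsum_whitneyCubes_eq_sum (g := fun P => ψ P w)
      (fun P hP => ((hTS P).1 hP).1) hz).symm

end WhitneyCubes

end WhitneyTrace

namespace WhitneyTrace
open DyadicCube

/-! ### Pointwise estimates for the Whitney extension -/

section Pointwise

variable {d n : ℕ}

/-- The oscillation of `f` at scale `l`, to which local averages of `|f|` are added at scale `0`, so
that the sum over all scales controls `f` and not only its differences. -/
noncomputable def extOsc (f : E (Fin d) → ℂ) (l : ℕ) (x : E (Fin d)) : ℝ≥0∞ :=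
  osc volume f l x + if l = 0 then 2 ^ d * nbrAvg (fun z => ‖f z‖ₑ) (cubeAt 0 x) else 0

theorem measurable_extOsc (f : E (Fin d) → ℂ) (l : ℕ) : Measurable (extOsc f l) := by
  unfold extOsc
  split_ifs
  · exact (measurable_osc _ _ _).add ((measurable_nbrAvg _ 0).const_mul _)
  · exact (measurable_osc _ _ _).add measurable_const

theorem osc_le_extOsc (f : E (Fin d) → ℂ) (l : ℕ) (x : E (Fin d)) :
    osc volume f l x ≤ extOsc f l x := le_self_add

theorem enorm_cubeAvg_le_extOsc (f : E (Fin d) → ℂ) (x : E (Fin d)) :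
    ‖cubeAvg volume f (cubeAt 0 x)‖ₑ ≤ extOsc f 0 x := by
  refine le_trans ?_ (le_add_left le_rfl)
  rw [if_pos rfl]
  refine (enorm_cubeAvg_le _ _ _).trans ?_
  have := cubeLavg_le_nbrAvg (fun z => ‖f z‖ₑ)
    (neighbor_cubeAt_of_scale (k := 0) (l := 0) x (by norm_num) (by norm_num))
  rwa [Fintype.card_fin] at this

/-- The oscillation of `f` at scale `l`, spread over the slab of height `≈ 2^{-l}`. -/
noncomputable def slabOsc (f : E (Fin d) → ℂ) (l : ℕ) : E (Fin d ⊕ Fin n) → ℝ≥0∞ :=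
  (vert ⁻¹' slab n l).indicator fun y => extOsc f l (proj y)

theorem measurable_slabOsc (f : E (Fin d) → ℂ) (l : ℕ) :
    Measurable (slabOsc f l : E (Fin d ⊕ Fin n) → ℝ≥0∞) :=
  ((measurable_extOsc f l).comp measurable_proj).indicator
    (measurable_vert (measurableSet_slab _))

theorem slabOsc_eq (f : E (Fin d) → ℂ) {l : ℕ} {y : E (Fin d ⊕ Fin n)}
    (h : height y ≤ 16 * 2 ^ (-(l : ℤ))) : slabOsc f l y = extOsc f l (proj y) :=
  Set.indicator_of_mem (s := vert ⁻¹' slab n l) h _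

theorem sixteen_mul_zpow_le {l i : ℕ} (h : l ≤ i) :
    (16 : ℝ) * 2 ^ (-(i : ℤ)) ≤ 16 * 2 ^ (-(l : ℤ)) := by
  have : (2 : ℝ) ^ (-(i : ℤ)) ≤ 2 ^ (-(l : ℤ)) :=
    zpow_le_zpow_right₀ one_le_two (by omega)
  linarith

/-- The oscillations of `f` at all scales `≥ a` that are visible at the height of `y`. -/
noncomputable def fineOsc (f : E (Fin d) → ℂ) (a : ℕ) (y : E (Fin d ⊕ Fin n)) : ℝ≥0∞ :=
  ∑' l : ℕ, slabOsc f (a + l) y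

/-- The oscillations of `f` at the scales `l ≤ k` that are visible at the height of `y`, damped by
the factor `2^{l-k}` which a smooth function at scale `l` gains over a distance `2^{-k}`. -/
noncomputable def coarseOsc (f : E (Fin d) → ℂ) (k : ℕ) (y : E (Fin d ⊕ Fin n)) : ℝ≥0∞ :=
  ∑ l ∈ Finset.range (k + 1), (2 : ℝ≥0∞) ^ ((l : ℝ) - k) * slabOsc f l y

theorem measurable_fineOsc (f : E (Fin d) → ℂ) (a : ℕ) :
    Measurable (fineOsc f a : E (Fin d ⊕ Fin n) → ℝ≥0∞) :=
  Measurable.tsum fun _ => measurable_slabOsc _ _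

theorem slabOsc_le_fineOsc (f : E (Fin d) → ℂ) (a l : ℕ) (y : E (Fin d ⊕ Fin n)) :
    slabOsc f (a + l) y ≤ fineOsc f a y := ENNReal.le_tsum (f := fun l => slabOsc f (a + l) y) l

theorem sum_osc_le_sum_slabOsc (f : E (Fin d) → ℂ) {a j : ℕ} {y : E (Fin d ⊕ Fin n)}
    (h : height y ≤ 16 * 2 ^ (-((a + j : ℕ) : ℤ))) :
    ∑ i ∈ Finset.range (j + 1), osc volume f ((a + i : ℕ) : ℤ) (proj y) ≤
      ∑ i ∈ Finset.range (j + 1), slabOsc f (a + i) y := by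
  refine Finset.sum_le_sum fun i hi => ?_
  have := Finset.mem_range.1 hi
  rw [slabOsc_eq f (h.trans (sixteen_mul_zpow_le (by omega)))]
  exact osc_le_extOsc _ _ _

/-- The averages of `f` over the projection of a cube near `y` and over a larger cube around the
projection of `y` differ by at most the oscillations at the scales between. -/
theorem enorm_cubeAvg_projCube_sub_le (f : E (Fin d) → ℂ) {a j : ℕ} {y : E (Fin d ⊕ Fin n)}
    {P : DyadicCube (Fin d ⊕ Fin n)} (hs : P.scale = ((a + j : ℕ) : ℤ))
    (hP : (cubeAt P.scale y).Neighbor P) (h : height y ≤ 16 * 2 ^ (-((a + j : ℕ) : ℤ))) :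
    ‖cubeAvg volume f (projCube P) - cubeAvg volume f (cubeAt a (proj y))‖ₑ ≤
      ∑ i ∈ Finset.range (j + 1), slabOsc f (a + i) y := by
  refine le_trans ?_ (sum_osc_le_sum_slabOsc f h)
  rw [← sub_add_sub_cancel _ (cubeAvg volume f (cubeAt ((a + j : ℕ) : ℤ) (proj y))),
    Finset.sum_range_succ, add_comm (Finset.sum _ _)]
  refine (enorm_add_le _ _).trans (add_le_add ?_ (enorm_cubeAvg_sub_cubeAvg_le _ _ _ _ _))
  rw [← enorm_neg, neg_sub]
  have := WhitneyTrace.Neighbor.projCube hP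
  rw [projCube_cubeAt, hs] at this
  exact enorm_sub_le_cubeOsc _ _ this

variable {ψ : DyadicCube (Fin d ⊕ Fin n) → E (Fin d ⊕ Fin n) → ℝ}

theorem height_le_of_scale_le {y : E (Fin d ⊕ Fin n)} {m : ℤ} {i : ℕ}
    (h2 : height y ≤ 2 ^ (m + 1)) (hi : (i : ℤ) ≤ -m + 1) : height y ≤ 16 * 2 ^ (-(i : ℤ)) := by
  have : (2 : ℝ) ^ (m + 1) ≤ 2 ^ (-(i : ℤ) + 2) := zpow_le_zpow_right₀ one_le_two (by omega)
  rw [zpow_add₀ two_ne_zero (-(i : ℤ)) 2, show (2 : ℝ) ^ (2 : ℤ) = 4 by norm_num] at this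
  have h0 : (0 : ℝ) < 2 ^ (-(i : ℤ)) := by positivity
  linarith

theorem IsWhitneyBumps.enorm_le_one (hψ : IsWhitneyBumps ψ) {P : DyadicCube (Fin d ⊕ Fin n)}
    (hP : P ∈ allWhitneyCubes d n) (y : E (Fin d ⊕ Fin n)) : ‖(ψ P y : ℂ)‖ₑ ≤ 1 := by
  obtain ⟨h0, h1⟩ := hψ.mem_Icc P hP y
  rw [← ofReal_norm, Complex.norm_real, Real.norm_of_nonneg h0]
  exact ENNReal.ofReal_le_one.2 h1

/-- A bound for the number of Whitney cubes near a point. -/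
def numWhitney (d n : ℕ) : ℕ := 3 * (3 * 5 ^ (d + n))

theorem whitneyExt_eq_zero (hψ : IsWhitneyBumps ψ) (f : E (Fin d) → ℂ) {y : E (Fin d ⊕ Fin n)}
    (h : 4 < height y) : whitneyExt ψ f y = 0 := by
  obtain ⟨m, h1, h2⟩ := exists_mem_Ioc_zpow (y := (2 : ℝ)) (lt_trans (by norm_num) h) one_lt_two
  obtain ⟨T, hT, -, hTs, hw⟩ := hψ.exists_finset h1 h2
  rw [(hw y fun i => by simp; positivity).1]
  refine Finset.sum_eq_zero fun P hP => ?_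
  exfalso
  have h3 := (mem_allWhitneyCubes_iff.1 (hT hP)).1
  have h4 := (hTs P hP).2.1
  have : (2 : ℝ) ^ (m + 1) ≤ 2 ^ (2 : ℤ) := zpow_le_zpow_right₀ one_le_two (by omega)
  norm_num at this
  linarith

/-- At a point at height at most `2^{-a}`, the Whitney extension differs from the average of `f`
over the cube of edge length `2^{-a}` below by at most the oscillations at finer scales. -/
theorem enorm_whitneyExt_sub_cubeAvg_le (hψ : IsWhitneyBumps ψ) (f : E (Fin d) → ℂ) {a : ℕ}
    {y : E (Fin d ⊕ Fin n)} (h0 : 0 < height y) (ha : a = 0 ∨ height y ≤ 2 ^ (-(a : ℤ)))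
    (h16 : height y ≤ 16 * 2 ^ (-(a : ℤ))) :
    ‖whitneyExt ψ f y - cubeAvg volume f (cubeAt a (proj y))‖ₑ ≤
      ((2 * numWhitney d n + 1 : ℕ) : ℝ≥0∞) * fineOsc f a y := by
  obtain ⟨m, h1, h2⟩ := exists_mem_Ioc_zpow (y := (2 : ℝ)) h0 one_lt_two
  obtain ⟨T, hT, hcard, hTs, hw⟩ := hψ.exists_finset h1 h2
  obtain ⟨hF, hS⟩ := hw y fun i => by simp; positivity
  set c := cubeAvg volume f (cubeAt a (proj y)) with hc
  set S : ℂ := ∑ P ∈ T, (ψ P y : ℂ) with hSdef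
  have hcard' : (T.card : ℝ≥0∞) ≤ (numWhitney d n : ℝ≥0∞) := by exact_mod_cast hcard
  have hsplit : whitneyExt ψ f y - c =
      ∑ P ∈ T, (cubeAvg volume f (projCube P) - c) * (ψ P y : ℂ) + (S - 1) * c := by
    rw [hF f, hSdef]
    simp only [sub_mul, Finset.sum_sub_distrib, Finset.sum_mul, one_mul, mul_comm c]
    ring
  have hmain : ‖∑ P ∈ T, (cubeAvg volume f (projCube P) - c) * (ψ P y : ℂ)‖ₑ ≤
      numWhitney d n * fineOsc f a y := by
    refine (enorm_sum_le _ _).trans (le_trans (Finset.sum_le_card_nsmul T _ (fineOsc f a y) ?_) ?_)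
    · intro P hP
      rw [enorm_mul]
      refine (mul_le_mul' le_rfl (hψ.enorm_le_one (hT hP) y)).trans ?_
      rw [mul_one]
      have hs0 := (mem_allWhitneyCubes_iff.1 (hT hP)).1
      obtain ⟨hs1, hs2, hs3⟩ := hTs P hP
      have hale : (a : ℤ) ≤ P.scale := by
        rcases ha with rfl | ha
        · exact_mod_cast hs0
        · have : (2 : ℝ) ^ m < 2 ^ (-(a : ℤ)) := h1.trans_le ha
          rw [zpow_lt_zpow_iff_right₀ one_lt_two] at this
          omega
      obtain ⟨j, hj⟩ := Int.le.dest hale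
      have hj' : P.scale = ((a + j : ℕ) : ℤ) := by rw [← hj]; push_cast; ring
      refine (enorm_cubeAvg_projCube_sub_le f hj' hs3
        (height_le_of_scale_le h2 (by omega))).trans ?_
      exact ENNReal.sum_le_tsum (f := fun l => slabOsc f (a + l) y) _
    · rw [nsmul_eq_mul]
      gcongr
  have hrest : ‖(S - 1) * c‖ₑ ≤ (numWhitney d n + 1) * fineOsc f a y := by
    rcases lt_or_ge (height y) 2 with hy2 | hy2
    · have : S = 1 := by
        rw [hSdef, ← Complex.ofReal_sum, hS h0 hy2, Complex.ofReal_one]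
      rw [this]; simp
    -- above height `2` the bumps do not sum up to `1`, but there `a = 0`
    · have ha0 : a = 0 := by
        rcases ha with ha | ha
        · exact ha
        · exfalso
          have : (2 : ℝ) ^ (-(a : ℤ)) ≤ 1 := zpow_le_one_of_nonpos₀ one_le_two (by omega)
          linarith
      rw [enorm_mul]
      gcongr
      · refine (enorm_sub_le).trans (add_le_add ?_ (by simp))
        refine (enorm_sum_le _ _).trans ((Finset.sum_le_card_nsmul T _ 1
          fun P hP => hψ.enorm_le_one (hT hP) y).trans ?_)
        rwa [nsmul_eq_mul, mul_one]
      · subst ha0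
        refine (enorm_cubeAvg_le_extOsc f (proj y)).trans ?_
        rw [← slabOsc_eq f h16]
        exact slabOsc_le_fineOsc f 0 0 y
  rw [hsplit]
  refine (enorm_add_le _ _).trans ((add_le_add hmain hrest).trans (le_of_eq ?_))
  push_cast; ring

theorem enorm_whitneyExt_le (hψ : IsWhitneyBumps ψ) (f : E (Fin d) → ℂ)
    {y : E (Fin d ⊕ Fin n)} (h0 : 0 < height y) :
    ‖whitneyExt ψ f y‖ₑ ≤ ((2 * numWhitney d n + 2 : ℕ) : ℝ≥0∞) * fineOsc f 0 y := by
  rcases lt_or_ge 4 (height y) with h | h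
  · rw [whitneyExt_eq_zero hψ f h]; simp
  have h16 : height y ≤ 16 * 2 ^ (-((0 : ℕ) : ℤ)) := by norm_num; linarith
  have h1 := enorm_whitneyExt_sub_cubeAvg_le hψ f h0 (Or.inl rfl) h16
  have h2 : ‖cubeAvg volume f (cubeAt ((0 : ℕ) : ℤ) (proj y))‖ₑ ≤ fineOsc f 0 y := by
    refine (enorm_cubeAvg_le_extOsc f (proj y)).trans ?_
    rw [← slabOsc_eq f h16]
    exact slabOsc_le_fineOsc f 0 0 y
  rw [← sub_add_cancel (whitneyExt ψ f y) (cubeAvg volume f (cubeAt ((0 : ℕ) : ℤ) (proj y)))]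
  refine (enorm_add_le _ _).trans ((add_le_add h1 h2).trans (le_of_eq ?_))
  push_cast; ring

/-- On a cube of edge length about `2^{-k}` at height at most about `2^{-k}`, the Whitney extension
differs from the average of `f` over the projection of the cube by at most the oscillations at
scales `≥ k - 4`; the `4` comes from `11 · 2^{-k} ≤ 2^{-(k-4)}`. -/
theorem enorm_whitneyExt_sub_cubeAvg_projCube_le (hψ : IsWhitneyBumps ψ) (f : E (Fin d) → ℂ) {k : ℕ}
    {P : DyadicCube (Fin d ⊕ Fin n)} (hk1 : (k : ℤ) ≤ P.scale + 1) (hk2 : P.scale ≤ k + 1)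
    {z : E (Fin d ⊕ Fin n)} (hz : z ∈ P.toSet) (h0 : 0 < height z)
    (h : height z ≤ 11 * 2 ^ (-(k : ℤ))) :
    ‖whitneyExt ψ f z - cubeAvg volume f (projCube P)‖ₑ ≤
      ((2 * numWhitney d n + 2 : ℕ) : ℝ≥0∞) * fineOsc f (k - 4) z := by
  set a := k - 4 with ha
  have hkp : (0 : ℝ) < 2 ^ (-(k : ℤ)) := by positivity
  have h16k : height z ≤ 16 * 2 ^ (-(k : ℤ)) := by linarith
  have h16 : height z ≤ 16 * 2 ^ (-(a : ℤ)) := h16k.trans (sixteen_mul_zpow_le (by omega))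
  have ha' : a = 0 ∨ height z ≤ 2 ^ (-(a : ℤ)) := by
    rcases Nat.eq_zero_or_pos a with h | h
    · exact Or.inl h
    · refine Or.inr (h16k.trans (le_of_eq ?_))
      rw [show -(a : ℤ) = 4 + -(k : ℤ) by omega, zpow_add₀ two_ne_zero]
      norm_num
  have h1 := enorm_whitneyExt_sub_cubeAvg_le hψ f h0 ha' h16
  have hproj : projCube P = cubeAt P.scale (proj z) := by
    rw [toSet_eq_inter] at hz; exact eq_cubeAt hz.1
  have h2 : ‖cubeAvg volume f (cubeAt a (proj z)) - cubeAvg volume f (projCube P)‖ₑ ≤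
      fineOsc f a z := by
    rw [hproj]
    rcases le_or_gt (a : ℤ) P.scale with hle | hlt
    · obtain ⟨j, hj⟩ := Int.le.dest hle
      have hj' : P.scale = ((a + j : ℕ) : ℤ) := by rw [← hj]; push_cast; ring
      rw [hj', ← enorm_neg, neg_sub]
      refine (enorm_cubeAvg_sub_cubeAvg_le _ _ _ _ _).trans (le_trans ?_
        (ENNReal.sum_le_tsum (f := fun l => slabOsc f (a + l) z) (Finset.range j)))
      refine Finset.sum_le_sum fun i hi => ?_
      have := Finset.mem_range.1 hi
      rw [slabOsc_eq f (h16k.trans (sixteen_mul_zpow_le (by omega)))]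
      exact osc_le_extOsc _ _ _
    · refine le_trans (enorm_sub_le_cubeOsc _ _
        (neighbor_cubeAt_of_scale (proj z) (by omega) (by omega))) ?_
      change osc volume f a (proj z) ≤ _
      refine (osc_le_extOsc _ _ _).trans ?_
      rw [← slabOsc_eq f h16]
      exact slabOsc_le_fineOsc f a 0 z
  rw [← sub_add_sub_cancel _ (cubeAvg volume f (cubeAt a (proj z)))]
  refine (enorm_add_le _ _).trans ((add_le_add h1 h2).trans (le_of_eq ?_))
  push_cast; ring

end Pointwise

end WhitneyTrace

namespace WhitneyTrace
open DyadicCube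

/-! ### Smoothness of the Whitney extension away from `ℝ^d` -/

section Smooth

variable {d n : ℕ} {ψ : DyadicCube (Fin d ⊕ Fin n) → E (Fin d ⊕ Fin n) → ℝ}

theorem IsWhitneyBumps.exists_enorm_sub_le (hψ : IsWhitneyBumps ψ) :
    ∃ D : ℝ≥0, ∀ P ∈ allWhitneyCubes d n, ∀ (k : ℕ) (y z : E (Fin d ⊕ Fin n)),
      (∀ i, |z i - y i| ≤ 3 * 2 ^ (-(k : ℤ))) →
        ‖(ψ P z : ℂ) - ψ P y‖ₑ ≤ D * (2 : ℝ≥0∞) ^ ((P.scale : ℝ) - k) := by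
  obtain ⟨C, hC⟩ := hψ.lipschitz
  refine ⟨Real.toNNReal (|C| * (√(d + n : ℕ) * 3)), fun P hP k y z h => ?_⟩
  have hk : (0 : ℝ) < 2 ^ (-(k : ℤ)) := by positivity
  have hdist : dist z y ≤ √(d + n : ℕ) * (3 * 2 ^ (-(k : ℤ))) := by
    rw [EuclideanSpace.dist_eq]
    have hpos : (0 : ℝ) ≤ 3 * 2 ^ (-(k : ℤ)) := by positivity
    rw [← Real.sqrt_sq hpos, ← Real.sqrt_mul (by positivity)]
    apply Real.sqrt_le_sqrt
    refine (Finset.sum_le_card_nsmul _ _ ((3 * 2 ^ (-(k : ℤ))) ^ 2) fun i _ => ?_).trans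
      (le_of_eq (by simp [nsmul_eq_mul]))
    rw [Real.dist_eq]
    exact pow_le_pow_left₀ (abs_nonneg _) (h i) 2
  have hside := P.side_pos
  have h1 : |ψ P z - ψ P y| ≤ |C| * (√(d + n : ℕ) * 3) * 2 ^ ((P.scale : ℝ) - k) := by
    calc |ψ P z - ψ P y| ≤ C / P.side * dist z y := hC P hP z y
      _ ≤ |C| / P.side * (√(d + n : ℕ) * (3 * 2 ^ (-(k : ℤ)))) := by
          gcongr
          exact le_abs_self C
      _ = |C| * (√(d + n : ℕ) * 3) * 2 ^ ((P.scale : ℝ) - k) := by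
          have e1 : P.side = (2 : ℝ) ^ (-(P.scale : ℝ)) := by
            rw [DyadicCube.side, ← Real.rpow_intCast]; push_cast; rfl
          have e2 : (2 : ℝ) ^ (-(k : ℤ)) = 2 ^ (-(k : ℝ)) := by
            rw [← Real.rpow_intCast]; push_cast; rfl
          rw [e1, e2, sub_eq_add_neg, Real.rpow_add two_pos, Real.rpow_neg two_pos.le (P.scale : ℝ),
            div_inv_eq_mul]
          ring
  rw [← Complex.ofReal_sub, ← ofReal_norm, Complex.norm_real, Real.norm_eq_abs]
  refine (ENNReal.ofReal_le_ofReal h1).trans (le_of_eq ?_)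
  rw [ENNReal.ofReal_mul (by positivity), ofReal_two_rpow]
  rfl

/-- The Lipschitz estimate for the Whitney extension: moving a distance `2^{-k}`, at a height larger
than `2^{-k}`, changes it by at most the damped oscillations at the coarser scales. -/
theorem exists_enorm_whitneyExt_sub_le (hψ : IsWhitneyBumps ψ) :
    ∃ C : ℝ≥0, ∀ (f : E (Fin d) → ℂ) (k : ℕ) (y z : E (Fin d ⊕ Fin n)),
      8 * 2 ^ (-(k : ℤ)) < height y → (∀ i, |z i - y i| ≤ 3 * 2 ^ (-(k : ℤ))) →
        ‖whitneyExt ψ f z - whitneyExt ψ f y‖ₑ ≤ C * coarseOsc f k y := by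
  obtain ⟨D, hD⟩ := hψ.exists_enorm_sub_le
  set N := numWhitney d n with hN
  refine ⟨N * (4 * D) + N * (2 * D), fun f k y z hy hz => ?_⟩
  have hk : (0 : ℝ) < 2 ^ (-(k : ℤ)) := by positivity
  have hy0 : 0 < height y := lt_trans (by positivity) hy
  obtain ⟨m, h1, h2⟩ := exists_mem_Ioc_zpow (y := (2 : ℝ)) hy0 one_lt_two
  have hm : (0 : ℝ) < 2 ^ m := by positivity
  obtain ⟨T, hT, hcard, hTs, hw⟩ := hψ.exists_finset h1 h2
  have hcard' : (T.card : ℝ≥0∞) ≤ (N : ℝ≥0∞) := by exact_mod_cast hcard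
  have hkm : 3 - (k : ℤ) ≤ m := by
    have h3 : (2 : ℝ) ^ (3 - (k : ℤ)) < 2 ^ (m + 1) := by
      refine lt_of_lt_of_le ?_ (h2)
      rw [sub_eq_add_neg, zpow_add₀ two_ne_zero]
      norm_num at hy ⊢
      exact hy
    rw [zpow_lt_zpow_iff_right₀ one_lt_two] at h3
    omega
  have hkm' : 8 * (2 : ℝ) ^ (-(k : ℤ)) ≤ 2 ^ m := by
    have := zpow_le_zpow_right₀ (one_le_two (α := ℝ)) hkm
    rw [sub_eq_add_neg, zpow_add₀ two_ne_zero, show (2 : ℝ) ^ (3 : ℤ) = 8 by norm_num] at this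
    exact this
  obtain ⟨hFy, hSy⟩ := hw y fun i => by simp; positivity
  obtain ⟨hFz, hSz⟩ := hw z fun i => (hz i).trans (by linarith)
  have hyz := height_le_add (y := y) (z := z) (fun i => by rw [abs_sub_comm]; exact hz i)
    (by positivity)
  have hzy := height_le_add hz (by positivity)
  set a := (-m - 1).toNat with ha
  set c := cubeAvg volume f (cubeAt a (proj y)) with hc
  set Δ : DyadicCube (Fin d ⊕ Fin n) → ℂ := fun P => (ψ P z : ℂ) - ψ P y with hΔ
  have hsplit : whitneyExt ψ f z - whitneyExt ψ f y =
      ∑ P ∈ T, (cubeAvg volume f (projCube P) - c) * Δ P + (∑ P ∈ T, Δ P) * c := by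
    rw [hFy f, hFz f]
    simp only [hΔ, sub_mul, mul_sub, Finset.sum_sub_distrib, Finset.sum_mul, mul_comm c]
    ring
  have hTscale : ∀ P ∈ T, ∃ i : ℕ, P.scale = i ∧ (i : ℤ) ≤ -m + 1 ∧ a ≤ i ∧ i ≤ a + 2 := by
    intro P hP
    have hs0 := (mem_allWhitneyCubes_iff.1 (hT hP)).1
    obtain ⟨hs1, hs2, -⟩ := hTs P hP
    exact ⟨P.scale.toNat, by omega, by omega, by omega, by omega⟩
  have hterm : ∀ l : ℕ, l ≤ k → (2 : ℝ≥0∞) ^ ((l : ℝ) - k) * slabOsc f l y ≤ coarseOsc f k y :=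
    fun l hl => Finset.single_le_sum
      (f := fun l : ℕ => (2 : ℝ≥0∞) ^ ((l : ℝ) - k) * slabOsc f l y) (fun _ _ => zero_le)
      (Finset.mem_range.2 (by omega))
  have hmain : ‖∑ P ∈ T, (cubeAvg volume f (projCube P) - c) * Δ P‖ₑ ≤
      N * (4 * D * coarseOsc f k y) := by
    refine (enorm_sum_le _ _).trans
      (le_trans (Finset.sum_le_card_nsmul T _ (4 * D * coarseOsc f k y) ?_) ?_)
    · intro P hP
      obtain ⟨i, hi1, hi2, hi3, hi4⟩ := hTscale P hP
      obtain ⟨j, rfl⟩ := Nat.exists_eq_add_of_le hi3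
      have e1 := enorm_cubeAvg_projCube_sub_le f hi1 (hTs P hP).2.2
        (height_le_of_scale_le h2 (by omega))
      have e2 := hD P (hT hP) k y z hz
      rw [hi1] at e2
      rw [enorm_mul]
      refine (mul_le_mul' e1 e2).trans ?_
      rw [Finset.sum_mul]
      calc ∑ l ∈ Finset.range (j + 1), slabOsc f (a + l) y *
            (D * (2 : ℝ≥0∞) ^ ((((a + j : ℕ) : ℤ) : ℝ) - k))
          ≤ ∑ l ∈ Finset.range (j + 1),
              4 * D * ((2 : ℝ≥0∞) ^ (((a + l : ℕ) : ℝ) - k) * slabOsc f (a + l) y) := by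
            refine Finset.sum_le_sum fun l hl => ?_
            have e3 : (2 : ℝ≥0∞) ^ ((((a + j : ℕ) : ℤ) : ℝ) - k) ≤
                4 * (2 : ℝ≥0∞) ^ (((a + l : ℕ) : ℝ) - k) := by
              rw [show (4 : ℝ≥0∞) = 2 ^ (2 : ℝ) by norm_num, ← two_rpow_add]
              refine ENNReal.rpow_le_rpow_of_exponent_le one_le_two ?_
              have : (j : ℝ) ≤ 2 := by exact_mod_cast (by omega : j ≤ 2)
              push_cast
              have : (0 : ℝ) ≤ l := by positivity
              linarith
            calc slabOsc f (a + l) y * (D * (2 : ℝ≥0∞) ^ ((((a + j : ℕ) : ℤ) : ℝ) - k))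
                ≤ slabOsc f (a + l) y * (D * (4 * (2 : ℝ≥0∞) ^ (((a + l : ℕ) : ℝ) - k))) := by
                  gcongr
              _ = _ := by ring
        _ = 4 * D * ∑ l ∈ Finset.range (j + 1),
              ((2 : ℝ≥0∞) ^ (((a + l : ℕ) : ℝ) - k) * slabOsc f (a + l) y) := by
            rw [Finset.mul_sum]
        _ ≤ 4 * D * coarseOsc f k y := by
            refine mul_le_mul' le_rfl ?_
            rw [← Finset.sum_image (s := Finset.range (j + 1)) (g := fun l => a + l)
              (f := fun l : ℕ => (2 : ℝ≥0∞) ^ ((l : ℝ) - k) * slabOsc f l y)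
              (fun _ _ _ _ h => Nat.add_left_cancel h)]
            refine Finset.sum_le_sum_of_subset fun l hl => ?_
            obtain ⟨i, hi, rfl⟩ := Finset.mem_image.1 hl
            have := Finset.mem_range.1 hi
            exact Finset.mem_range.2 (by omega)
    · rw [nsmul_eq_mul]
      gcongr
  have hrest : ‖(∑ P ∈ T, Δ P) * c‖ₑ ≤ N * (2 * D * coarseOsc f k y) := by
    by_cases hboth : height y < 2 ∧ height z < 2
    · have : ∑ P ∈ T, Δ P = 0 := by
        rw [hΔ, Finset.sum_sub_distrib, ← Complex.ofReal_sum, ← Complex.ofReal_sum,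
          hSy hy0 hboth.1, hSz (by linarith) hboth.2, sub_self]
      rw [this]; simp
    -- here the bumps need not sum up to a constant, but the scales are bounded
    have hm0 : 0 ≤ m := by
      by_contra! hneg
      have : (2 : ℝ) ^ (m + 1) ≤ 1 := zpow_le_one_of_nonpos₀ one_le_two (by omega)
      have hm2 : (2 : ℝ) ^ (m + 1) = 2 ^ m * 2 := zpow_add_one₀ two_ne_zero m
      refine hboth ⟨by linarith, by linarith⟩
    have ha0 : a = 0 := by omega
    rw [Finset.sum_mul]
    refine (enorm_sum_le _ _).trans
      (le_trans (Finset.sum_le_card_nsmul T _ (2 * D * coarseOsc f k y) ?_) ?_)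
    · intro P hP
      obtain ⟨i, hi1, hi2, hi3, hi4⟩ := hTscale P hP
      have e2 := hD P (hT hP) k y z hz
      have h16 : height y ≤ 16 * 2 ^ (-((0 : ℕ) : ℤ)) :=
        (height_le_of_scale_le h2 hi2).trans (sixteen_mul_zpow_le (by omega))
      have e3 : ‖c‖ₑ ≤ slabOsc f 0 y := by
        rw [hc, ha0, slabOsc_eq f h16]
        exact enorm_cubeAvg_le_extOsc f (proj y)
      have e4 : (2 : ℝ≥0∞) ^ ((P.scale : ℝ) - k) ≤ 2 * 2 ^ (((0 : ℕ) : ℝ) - k) := by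
        have : (2 : ℝ≥0∞) * 2 ^ (((0 : ℕ) : ℝ) - k) = 2 ^ ((1 : ℝ) + (((0 : ℕ) : ℝ) - k)) := by
          rw [two_rpow_add, ENNReal.rpow_one]
        rw [this]
        refine ENNReal.rpow_le_rpow_of_exponent_le one_le_two ?_
        have : (P.scale : ℝ) ≤ 1 := by exact_mod_cast (by omega : P.scale ≤ 1)
        push_cast
        linarith
      rw [enorm_mul]
      calc ‖Δ P‖ₑ * ‖c‖ₑ ≤ D * (2 * 2 ^ (((0 : ℕ) : ℝ) - k)) * slabOsc f 0 y := by
            gcongr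
            exact e2.trans (by gcongr)
        _ = 2 * D * (2 ^ (((0 : ℕ) : ℝ) - k) * slabOsc f 0 y) := by ring
        _ ≤ _ := by
            gcongr
            exact hterm 0 (by omega)
    · rw [nsmul_eq_mul]
      gcongr
  rw [hsplit]
  refine (enorm_add_le _ _).trans ((add_le_add hmain hrest).trans (le_of_eq ?_))
  push_cast; ring

theorem continuousAt_whitneyExt (hψ : IsWhitneyBumps ψ) (f : E (Fin d) → ℂ)
    {y : E (Fin d ⊕ Fin n)} (h0 : 0 < height y) : ContinuousAt (whitneyExt ψ f) y := by
  obtain ⟨m, h1, h2⟩ := exists_mem_Ioc_zpow (y := (2 : ℝ)) h0 one_lt_two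
  obtain ⟨T, hT, -, -, hw⟩ := hψ.exists_finset h1 h2
  have hcont : ContinuousAt
      (fun w => ∑ P ∈ T, cubeAvg volume f (projCube P) * (ψ P w : ℂ)) y := by
    refine Continuous.continuousAt (continuous_finsetSum _ fun P hP => ?_)
    exact continuous_const.mul
      (Complex.continuous_ofReal.comp (hψ.smooth P (hT hP)).continuous)
  refine hcont.congr ?_
  filter_upwards [Metric.ball_mem_nhds y (show (0 : ℝ) < 3 / 8 * 2 ^ m by positivity)] with w hwy
  refine ((hw w fun i => ?_).1 f).symm
  have := PiLp.norm_apply_le (w - y) i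
  rw [← dist_eq_norm] at this
  exact this.trans (Metric.mem_ball.1 hwy).le

theorem ae_height_pos (hn : 1 ≤ n) (α : ℝ) : ∀ᵐ y ∂weightMeasure d n α, 0 < height y := by
  have : weightMeasure d n α ≪ volume := withDensity_absolutelyContinuous _ _
  filter_upwards [this.ae_le (ae_vert_ne_zero hn)] with y hy
  refine lt_of_le_of_ne (height_nonneg y) fun h => hy ?_
  ext j
  have := abs_le_height y j
  rw [← h, abs_nonpos_iff] at this
  exact this

theorem aestronglyMeasurable_whitneyExt (hn : 1 ≤ n) (α : ℝ) (hψ : IsWhitneyBumps ψ)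
    (f : E (Fin d) → ℂ) : AEStronglyMeasurable (whitneyExt ψ f) (weightMeasure d n α) := by
  have hU : MeasurableSet {y : E (Fin d ⊕ Fin n) | 0 < height y} :=
    measurableSet_lt measurable_const measurable_height
  have hc : ContinuousOn (whitneyExt ψ f) {y : E (Fin d ⊕ Fin n) | 0 < height y} :=
    fun y hy => (continuousAt_whitneyExt hψ f hy).continuousWithinAt
  have := hc.aestronglyMeasurable (μ := weightMeasure d n α) hU
  rwa [Measure.restrict_eq_self_of_ae_mem
    (s := {y : E (Fin d ⊕ Fin n) | 0 < height y}) (ae_height_pos hn α)] at this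

end Smooth

end WhitneyTrace

namespace WhitneyTrace
open DyadicCube

/-! ### Integrability of the Whitney extension -/

section ExtIntegrable

variable {d n : ℕ} {σ : ℝ} {p q : ℝ≥0∞} {α : ℝ}

/-- The `L^p` norm of the oscillation at scale `l`, normalized by the `p`-th root of the weighted
measure `2^{-l(n+α)}` of a fibre of the slab of height `2^{-l}`. -/
noncomputable def slabNorm (n : ℕ) (α : ℝ) (p : ℝ≥0∞) (f : E (Fin d) → ℂ) (l : ℕ) : ℝ≥0∞ :=
  (2 : ℝ≥0∞) ^ (-(l : ℝ) * ((n + α) * (p⁻¹).toReal)) * eLpNorm (extOsc f l) p volume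

theorem fiberMeasure_slab_ne_zero (hn : 1 ≤ n) (α : ℝ) (l : ℤ) :
    fiberMeasure n α (slab n l) ≠ 0 := fun h =>
  fiberMeasure_cube_ne_zero hn α (unitFiber n l) (measure_mono_null (unitFiber_subset_slab l) h)

theorem exists_eLpNorm_slab_le (hn : 1 ≤ n) (hα : -(n : ℝ) < α) (p : ℝ≥0∞) :
    ∃ C : ℝ≥0, ∀ (l : ℕ) (g : E (Fin d) → ℝ≥0∞), Measurable g →
      eLpNorm ((vert ⁻¹' slab n l).indicator fun y => g (proj y)) p (weightMeasure d n α) ≤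
        C * ((2 : ℝ≥0∞) ^ (-(l : ℝ) * ((n + α) * (p⁻¹).toReal)) * eLpNorm g p volume) := by
  obtain ⟨C, hC⟩ := exists_fiberMeasure_slab_le hn hα
  have hr0 : 0 ≤ (p⁻¹).toReal := ENNReal.toReal_nonneg
  refine ⟨C ^ (p⁻¹).toReal, fun l g hg => ?_⟩
  rw [eLpNorm_indicator_eq_eLpNorm_restrict (measurable_vert (measurableSet_slab _)),
    eLpNorm_comp_proj_restrict α (measurableSet_slab _) (fiberMeasure_slab_ne_zero hn α l) p hg,
    ENNReal.coe_rpow_of_nonneg _ hr0, ← mul_assoc]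
  gcongr
  refine (ENNReal.rpow_le_rpow (hC l) hr0).trans (le_of_eq ?_)
  rw [ENNReal.mul_rpow_of_nonneg _ _ hr0, ← ENNReal.rpow_mul]
  congr 2; ring

theorem exists_eLpNorm_fineOsc_le (hn : 1 ≤ n) (hα : -(n : ℝ) < α) (hp : 1 ≤ p) :
    ∃ C : ℝ≥0, ∀ (f : E (Fin d) → ℂ) (a : ℕ),
      eLpNorm (fineOsc f a) p (weightMeasure d n α) ≤ C * ∑' l : ℕ, slabNorm n α p f (a + l) := by
  obtain ⟨C, hC⟩ := exists_eLpNorm_slab_le (d := d) hn hα p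
  refine ⟨C, fun f a => ?_⟩
  refine (eLpNorm_tsum_ennreal_le hp fun l : ℕ => measurable_slabOsc f (a + l)).trans ?_
  rw [← ENNReal.tsum_mul_left]
  exact ENNReal.tsum_le_tsum fun l => hC (a + l) _ (measurable_extOsc f _)

theorem exists_eLpNorm_coarseOsc_le (hn : 1 ≤ n) (hα : -(n : ℝ) < α) (hp : 1 ≤ p) :
    ∃ C : ℝ≥0, ∀ (f : E (Fin d) → ℂ) (k : ℕ),
      eLpNorm (coarseOsc f k) p (weightMeasure d n α) ≤
        C * ∑ l ∈ Finset.range (k + 1), (2 : ℝ≥0∞) ^ ((l : ℝ) - k) * slabNorm n α p f l := by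
  obtain ⟨C, hC⟩ := exists_eLpNorm_slab_le (d := d) hn hα p
  refine ⟨C, fun f k => ?_⟩
  refine (eLpNorm_finset_sum_ennreal_le hp _
    fun l : ℕ => (measurable_slabOsc f l).const_mul _).trans ?_
  rw [Finset.mul_sum]
  refine Finset.sum_le_sum fun l _ => ?_
  refine (eLpNorm_const_mul_ennreal_le (measurable_slabOsc f l) _).trans ?_
  rw [mul_left_comm]
  gcongr
  exact hC l _ (measurable_extOsc f l)

theorem measurable_coarseOsc (f : E (Fin d) → ℂ) (k : ℕ) :
    Measurable (coarseOsc f k : E (Fin d ⊕ Fin n) → ℝ≥0∞) :=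
  Finset.measurable_fun_sum _ fun l _ => (measurable_slabOsc f l).const_mul _

theorem eLpNorm_extOsc_le (hp : 1 ≤ p) {f : E (Fin d) → ℂ} (hf : AEStronglyMeasurable f volume)
    (l : ℕ) : eLpNorm (extOsc f l) p volume ≤ eLpNorm (osc volume f l) p volume +
      if l = 0 then ((14 ^ d : ℕ) : ℝ≥0∞) * eLpNorm f p volume else 0 := by
  unfold extOsc
  split_ifs with hl
  · refine (eLpNorm_add_ennreal_le hp (measurable_osc _ _ _)
      ((measurable_nbrAvg _ 0).const_mul _)).trans (add_le_add le_rfl ?_)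
    refine (eLpNorm_const_mul_ennreal_le (measurable_nbrAvg _ 0) _).trans ?_
    refine (mul_le_mul' le_rfl (eLpNorm_nbrAvg_le hp hf.enorm 0)).trans (le_of_eq ?_)
    rw [Fintype.card_fin, ← mul_assoc, eLpNorm_enorm]
    congr 1
    rw [show 14 = 2 * 7 by norm_num, mul_pow]
    push_cast
    rfl
  · simp

theorem eLpNorm_extOsc_le_besovNorm (hp : 1 ≤ p) (hq : 0 < q) {f : E (Fin d) → ℂ}
    (hf : AEStronglyMeasurable f volume) (l : ℕ) :
    eLpNorm (extOsc f l) p volume ≤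
      ((1 + 14 ^ d : ℕ) : ℝ≥0∞) * ((2 : ℝ≥0∞) ^ (-(l : ℝ) * σ) * besovNorm σ p q volume f) := by
  have h1 := eLpNorm_osc_le_besovNorm (s := σ) hp hq volume f l
  refine (eLpNorm_extOsc_le hp hf l).trans ?_
  push_cast
  rw [add_mul, one_mul]
  refine add_le_add h1 ?_
  split_ifs with hl
  · subst hl
    simp only [Nat.cast_zero, neg_zero, zero_mul, ENNReal.rpow_zero, one_mul]
    gcongr
    exact le_self_add
  · exact zero_le

theorem exists_tsum_slabNorm_le (hα : -(n : ℝ) < α) (hp : 1 ≤ p) (hq : 0 < q) (hσ : 0 < σ) :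
    ∃ C : ℝ≥0, ∀ f : E (Fin d) → ℂ, AEStronglyMeasurable f volume →
      ∑' l : ℕ, slabNorm n α p f l ≤ C * besovNorm σ p q volume f := by
  have hfin := tsum_two_rpow_ne_top hσ
  refine ⟨(1 + 14 ^ d : ℕ) * (∑' i : ℕ, (2 : ℝ≥0∞) ^ (-(i : ℝ) * σ)).toNNReal, fun f hf => ?_⟩
  rw [ENNReal.coe_mul, ENNReal.coe_toNNReal hfin, mul_assoc, ← ENNReal.tsum_mul_right,
    ← ENNReal.tsum_mul_left]
  refine ENNReal.tsum_le_tsum fun l => ?_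
  have h1 : (2 : ℝ≥0∞) ^ (-(l : ℝ) * ((n + α) * (p⁻¹).toReal)) ≤ 1 := by
    rw [← ENNReal.rpow_zero (x := 2)]
    refine ENNReal.rpow_le_rpow_of_exponent_le one_le_two ?_
    have : 0 ≤ (l : ℝ) * ((n + α) * (p⁻¹).toReal) :=
      mul_nonneg (by positivity) (mul_nonneg (by linarith) ENNReal.toReal_nonneg)
    linarith
  refine (mul_le_mul' h1 (eLpNorm_extOsc_le_besovNorm (σ := σ) hp hq hf l)).trans (le_of_eq ?_)
  rw [one_mul]
  push_cast
  rfl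

variable {ψ : DyadicCube (Fin d ⊕ Fin n) → E (Fin d ⊕ Fin n) → ℝ}

theorem exists_eLpNorm_whitneyExt_le (hψ : IsWhitneyBumps ψ) (hn : 1 ≤ n) (hα : -(n : ℝ) < α)
    (hp : 1 ≤ p) (hq : 0 < q) (hσ : 0 < σ) :
    ∃ C : ℝ≥0, ∀ f : E (Fin d) → ℂ, AEStronglyMeasurable f volume →
      eLpNorm (whitneyExt ψ f) p (weightMeasure d n α) ≤ C * besovNorm σ p q volume f := by
  obtain ⟨C₁, hC₁⟩ := exists_eLpNorm_fineOsc_le (d := d) hn hα hp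
  obtain ⟨C₂, hC₂⟩ := exists_tsum_slabNorm_le (d := d) hα hp hq hσ
  refine ⟨(2 * numWhitney d n + 2 : ℕ) * (C₁ * C₂), fun f hf => ?_⟩
  have h1 : eLpNorm (whitneyExt ψ f) p (weightMeasure d n α) ≤
      eLpNorm (fun y => ((2 * numWhitney d n + 2 : ℕ) : ℝ≥0∞) * fineOsc f 0 y) p
        (weightMeasure d n α) := by
    refine eLpNorm_mono_enorm_ae ?_
    filter_upwards [ae_height_pos hn α] with y hy
    simpa only [enorm_eq_self] using enorm_whitneyExt_le hψ f hy
  refine h1.trans ((eLpNorm_const_mul_ennreal_le (measurable_fineOsc f 0) _).trans ?_)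
  have h2 := (hC₁ f 0)
  simp only [zero_add] at h2
  have h3 := h2.trans (mul_le_mul' le_rfl (hC₂ f hf))
  refine (mul_le_mul' le_rfl h3).trans (le_of_eq ?_)
  push_cast; ring

theorem memLp_whitneyExt (hψ : IsWhitneyBumps ψ) (hn : 1 ≤ n) (hα : -(n : ℝ) < α)
    (hp : 1 ≤ p) (hq : 0 < q) (hσ : 0 < σ) {f : E (Fin d) → ℂ}
    (hf : AEStronglyMeasurable f volume) (hf' : besovNorm σ p q volume f < ∞) :
    MemLp (whitneyExt ψ f) p (weightMeasure d n α) := by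
  obtain ⟨C, hC⟩ := exists_eLpNorm_whitneyExt_le (d := d) hψ hn hα hp hq hσ
  exact ⟨aestronglyMeasurable_whitneyExt hn α hψ f,
    (hC f hf).trans_lt (ENNReal.mul_lt_top ENNReal.coe_lt_top hf')⟩

theorem locallyIntegrable_whitneyExt (hψ : IsWhitneyBumps ψ) (hn : 1 ≤ n) (hα : -(n : ℝ) < α)
    (hp : 1 ≤ p) (hq : 0 < q) (hσ : 0 < σ) {f : E (Fin d) → ℂ}
    (hf : AEStronglyMeasurable f volume) (hf' : besovNorm σ p q volume f < ∞) :
    LocallyIntegrable (whitneyExt ψ f) (weightMeasure d n α) := by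
  have := isLocallyFiniteMeasure_weightMeasure (d := d) hn hα
  exact (memLp_whitneyExt hψ hn hα hp hq hσ hf hf').locallyIntegrable hp

/-! ### Averages of the Whitney extension near `ℝ^d` -/

/-- The local averages of the oscillations at scales `≥ k - 4`, weighted by the portion of the
measure of a cube at height `2^{-k}` on which these oscillations are visible. -/
noncomputable def nearAvg (n : ℕ) (α : ℝ) (f : E (Fin d) → ℂ) (k : ℕ) (x : E (Fin d)) : ℝ≥0∞ :=
  ∑' l : ℕ, (2 : ℝ≥0∞) ^ (-(l : ℝ) * (n + α)) * nbrAvg (extOsc f (k - 4 + l)) (cubeAt k x)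

theorem measurable_nearAvg (α : ℝ) (f : E (Fin d) → ℂ) (k : ℕ) : Measurable (nearAvg n α f k) :=
  Measurable.tsum fun l : ℕ => (measurable_nbrAvg (extOsc f (k - 4 + l)) k).const_mul _

theorem eLpNorm_nearAvg_le (hp : 1 ≤ p) (α : ℝ) (f : E (Fin d) → ℂ) (k : ℕ) :
    eLpNorm (nearAvg n α f k) p volume ≤ ((7 ^ d : ℕ) : ℝ≥0∞) *
      ∑' l : ℕ, (2 : ℝ≥0∞) ^ (-(l : ℝ) * (n + α)) * eLpNorm (extOsc f (k - 4 + l)) p volume := by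
  refine (eLpNorm_tsum_ennreal_le hp
    fun l : ℕ => (measurable_nbrAvg (extOsc f (k - 4 + l)) k).const_mul _).trans ?_
  rw [← ENNReal.tsum_mul_left]
  refine ENNReal.tsum_le_tsum fun l => ?_
  refine (eLpNorm_const_mul_ennreal_le (measurable_nbrAvg _ k) _).trans ?_
  rw [mul_left_comm]
  gcongr
  have := eLpNorm_nbrAvg_le hp (measurable_extOsc f (k - 4 + l)).aemeasurable k
  rwa [Fintype.card_fin] at this

theorem cubeLavg_slabOsc_le {c C : ℝ≥0∞} (f : E (Fin d) → ℂ) {l : ℕ} {P : DyadicCube (Fin d ⊕ Fin n)}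
    (h1 : c ≤ fiberMeasure n α (vertCube P).toSet) (h2 : fiberMeasure n α (slab n l) ≤ C) :
    cubeLavg (weightMeasure d n α) (slabOsc f l) P ≤
      c⁻¹ * C * cubeLavg volume (extOsc f l) (projCube P) := by
  have hS : MeasurableSet (slab n l) := measurableSet_slab _
  have hR := (vertCube P).measurableSet_toSet
  have hQ := (projCube P).measurableSet_toSet
  have hnum : ∫⁻ y in P.toSet, slabOsc f l y ∂weightMeasure d n α ≤
      C * ∫⁻ x in (projCube P).toSet, extOsc f l x := by
    rw [slabOsc, setLIntegral_indicator (measurable_vert hS)]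
    refine le_trans (lintegral_mono_set (?_ : _ ⊆ proj ⁻¹' (projCube P).toSet ∩
      vert ⁻¹' slab n l)) ?_
    · rw [toSet_eq_inter]
      exact fun y hy => ⟨hy.2.1, hy.1⟩
    · rw [setLIntegral_comp_proj α hQ hS (measurable_extOsc f l)]
      gcongr
  rw [cubeLavg_eq, cubeLavg_eq, weightMeasure_toSet]
  have hv0 := (projCube P).volume_toSet_ne_zero
  have hvt := (projCube P).volume_toSet_ne_top
  rw [div_eq_mul_inv, div_eq_mul_inv, ENNReal.mul_inv (Or.inl hv0) (Or.inl hvt)]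
  calc (∫⁻ y in P.toSet, slabOsc f l y ∂weightMeasure d n α) *
        ((volume (projCube P).toSet)⁻¹ * (fiberMeasure n α (vertCube P).toSet)⁻¹)
      ≤ (C * ∫⁻ x in (projCube P).toSet, extOsc f l x) * ((volume (projCube P).toSet)⁻¹ * c⁻¹) := by
        gcongr
    _ = _ := by ring

/-- Over a cube of edge length about `2^{-k}` and height at most about `2^{-k}`, the average of the
Whitney extension is close to the average of `f` over the projection of the cube. -/
theorem exists_enorm_cubeAvg_whitneyExt_sub_le (hψ : IsWhitneyBumps ψ) (hn : 1 ≤ n)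
    (hα : -(n : ℝ) < α) :
    ∃ C : ℝ≥0, ∀ (f : E (Fin d) → ℂ) (k : ℕ) (x : E (Fin d)) (P : DyadicCube (Fin d ⊕ Fin n)),
      LocallyIntegrable (whitneyExt ψ f) (weightMeasure d n α) →
      (k : ℤ) ≤ P.scale + 1 → P.scale ≤ k + 1 → (∀ z ∈ P.toSet, height z ≤ 11 * 2 ^ (-(k : ℤ))) →
      (cubeAt k x).Neighbor (projCube P) →
      ‖cubeAvg (weightMeasure d n α) (whitneyExt ψ f) P - cubeAvg volume f (projCube P)‖ₑ ≤
        C * nearAvg n α f k x := by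
  obtain ⟨c, hc0, hc⟩ := exists_le_fiberMeasure_cube hn α
  obtain ⟨K, hK⟩ := exists_fiberMeasure_slab_le hn hα
  have hc0' : (c : ℝ≥0∞) ≠ 0 := by exact_mod_cast hc0
  set N : ℕ := 2 * numWhitney d n + 2
  let C : ℝ≥0∞ := N * (2 ^ d * ((c : ℝ≥0∞)⁻¹ * K * 2 ^ (4 * (n + α))))
  have hCt : C ≠ ∞ := by
    have := ENNReal.inv_ne_top.2 hc0'
    have := two_rpow_ne_top (4 * (n + α))
    finiteness
  refine ⟨C.toNNReal, fun f k x P hF hk1 hk2 hz hx => ?_⟩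
  rw [ENNReal.coe_toNNReal hCt]
  have hkp : (0 : ℝ) < 2 ^ (-(k : ℤ)) := by positivity
  have hint : IntegrableOn (whitneyExt ψ f) P.toSet (weightMeasure d n α) :=
    (hF.integrableOn_isCompact P.isBounded_toSet.isCompact_closure).mono_set subset_closure
  have hsub : (vertCube P).toSet ⊆ slab n k := by
    intro v hv
    obtain ⟨x₀, hx₀⟩ := (projCube P).toSet_nonempty
    -- a point of the cube with vertical part `v`
    let y : E (Fin d ⊕ Fin n) := WithLp.toLp 2 (Sum.elim (fun i => x₀ i) fun j => v j)
    have hy : y ∈ P.toSet := by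
      rw [toSet_eq_inter]
      exact ⟨hx₀, hv⟩
    have h3 : supNorm v ≤ 11 * 2 ^ (-(k : ℤ)) := hz y hy
    change supNorm v ≤ 16 * 2 ^ (-(k : ℤ))
    linarith
  refine (enorm_cubeAvg_sub_le hint (weightMeasure_toSet_ne_zero hn α P)
    (weightMeasure_toSet_ne_top hn hα P) _).trans ?_
  have hle : cubeLavg (weightMeasure d n α)
      (fun y => ‖whitneyExt ψ f y - cubeAvg volume f (projCube P)‖ₑ) P ≤
      N * ∑' l : ℕ, cubeLavg (weightMeasure d n α) (slabOsc f (k - 4 + l)) P := by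
    refine (cubeLavg_mono_ae (h := fun y => (N : ℝ≥0∞) * fineOsc f (k - 4) y) ?_).trans ?_
    · filter_upwards [ae_height_pos hn α] with y hy hyP
      exact enorm_whitneyExt_sub_cubeAvg_projCube_le hψ f hk1 hk2 hyP hy (hz y hyP)
    · simp only [cubeLavg_eq]
      rw [lintegral_const_mul _ (measurable_fineOsc f _), mul_div_assoc]
      gcongr
      simp only [fineOsc, div_eq_mul_inv]
      rw [lintegral_tsum fun l => (measurable_slabOsc f _).aemeasurable, ENNReal.tsum_mul_right]
  refine hle.trans ?_
  simp only [C]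
  rw [mul_assoc]
  refine mul_le_mul' le_rfl ?_
  rw [nearAvg, ← ENNReal.tsum_mul_left]
  refine ENNReal.tsum_le_tsum fun l => ?_
  have h1 := hc k (vertCube P) hk2 hsub
  have h2 := hK (k - 4 + l)
  refine (cubeLavg_slabOsc_le f h1 h2).trans ?_
  have h3 := cubeLavg_le_nbrAvg (extOsc f (k - 4 + l)) hx
  rw [Fintype.card_fin] at h3
  have h4 : ((c : ℝ≥0∞) * 2 ^ (-(k : ℝ) * (n + α)))⁻¹ *
      (K * 2 ^ (-((k - 4 + l : ℕ) : ℝ) * (n + α))) ≤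
      (c : ℝ≥0∞)⁻¹ * K * 2 ^ (4 * (n + α)) * 2 ^ (-(l : ℝ) * (n + α)) := by
    rw [ENNReal.mul_inv (Or.inl hc0') (Or.inl ENNReal.coe_ne_top), ← ENNReal.rpow_neg]
    calc (c : ℝ≥0∞)⁻¹ * 2 ^ (-(-(k : ℝ) * (n + α))) *
          (K * 2 ^ (-((k - 4 + l : ℕ) : ℝ) * (n + α)))
        = (c : ℝ≥0∞)⁻¹ * K * (2 ^ (-(-(k : ℝ) * (n + α))) *
            2 ^ (-((k - 4 + l : ℕ) : ℝ) * (n + α))) := by ring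
      _ ≤ (c : ℝ≥0∞)⁻¹ * K * (2 ^ (4 * (n + α)) * 2 ^ (-(l : ℝ) * (n + α))) := by
          rw [← two_rpow_add, ← two_rpow_add]
          refine mul_le_mul' le_rfl (ENNReal.rpow_le_rpow_of_exponent_le one_le_two ?_)
          have h5 : (k : ℝ) ≤ ((k - 4 + l : ℕ) : ℝ) - l + 4 := by
            have : (k : ℝ) + l ≤ ((k - 4 + l : ℕ) : ℝ) + 4 := by
              exact_mod_cast (by omega : k + l ≤ (k - 4 + l) + 4)
            linarith
          nlinarith
      _ = _ := by ring
  calc _ ≤ (c : ℝ≥0∞)⁻¹ * K * 2 ^ (4 * (n + α)) * 2 ^ (-(l : ℝ) * (n + α)) *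
          (2 ^ d * nbrAvg (extOsc f (k - 4 + l)) (cubeAt k x)) := mul_le_mul' h4 h3
    _ = _ := by ring

end ExtIntegrable

end WhitneyTrace

namespace WhitneyTrace
open DyadicCube

/-! ### Boundedness of the extension -/

section ExtBound

variable {d n : ℕ} {s σ : ℝ} {p q : ℝ≥0∞} {α : ℝ}
  {ψ : DyadicCube (Fin d ⊕ Fin n) → E (Fin d ⊕ Fin n) → ℝ}

theorem neighbor_self {ι : Type} (Q : DyadicCube ι) : Q.Neighbor Q := by
  obtain ⟨x, -, hx⟩ := Q.exists_eq_cubeAt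
  rw [hx]
  exact neighbor_cubeAt_of_scale x (by omega) (by omega)

/-- On cubes at height at most about `2^{-k}` the oscillation of the extension is controlled by the
comparison of its averages with those of `f`. -/
theorem exists_osc_whitneyExt_le_near (hψ : IsWhitneyBumps ψ) (hn : 1 ≤ n) (hα : -(n : ℝ) < α) :
    ∃ C : ℝ≥0, ∀ (f : E (Fin d) → ℂ) (k : ℕ) (y : E (Fin d ⊕ Fin n)),
      LocallyIntegrable (whitneyExt ψ f) (weightMeasure d n α) → height y ≤ 8 * 2 ^ (-(k : ℤ)) →
      osc (weightMeasure d n α) (whitneyExt ψ f) k y ≤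
        C * nearAvg n α f k (proj y) + osc volume f k (proj y) := by
  obtain ⟨C, hC⟩ := exists_enorm_cubeAvg_whitneyExt_sub_le (d := d) hψ hn hα
  refine ⟨2 * C, fun f k y hF hy => iSup_le fun P' => ?_⟩
  have hkp : (0 : ℝ) < 2 ^ (-(k : ℤ)) := by positivity
  have key : ∀ P, (cubeAt (k : ℤ) y).Neighbor P →
      ‖cubeAvg (weightMeasure d n α) (whitneyExt ψ f) P - cubeAvg volume f (projCube P)‖ₑ ≤
        C * nearAvg n α f k (proj y) := by
    intro P hP
    obtain ⟨h1, h2, -⟩ := neighbor_iff.1 hP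
    rw [cubeAt_scale] at h1 h2
    refine hC f k (proj y) P hF h2 h1 (fun z hz => ?_) (Neighbor.projCube hP)
    have := height_le_add (y := z) (z := y) (r := 3 * 2 ^ (-(k : ℤ))) (fun i => by
      rw [abs_sub_comm]
      exact abs_sub_le_of_neighbor hP (mem_cubeAt _ _) hz i) (by positivity)
    linarith
  have h1 := key _ (neighbor_self _)
  have h2 := key _ P'.2
  have h3 : ‖cubeAvg volume f (projCube (cubeAt (k : ℤ) y)) - cubeAvg volume f (projCube P'.1)‖ₑ ≤
      osc volume f k (proj y) := enorm_sub_le_cubeOsc _ _ (Neighbor.projCube P'.2)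
  set A := cubeAvg (weightMeasure d n α) (whitneyExt ψ f) (cubeAt (k : ℤ) y)
  set B := cubeAvg (weightMeasure d n α) (whitneyExt ψ f) P'.1
  set a := cubeAvg volume f (projCube (cubeAt (k : ℤ) y))
  set b := cubeAvg volume f (projCube P'.1)
  calc ‖A - B‖ₑ = ‖(A - a) + (a - b) + (b - B)‖ₑ := by congr 1; ring
    _ ≤ ‖A - a‖ₑ + ‖a - b‖ₑ + ‖b - B‖ₑ :=
        (enorm_add_le _ _).trans (add_le_add (enorm_add_le _ _) le_rfl)
    _ ≤ C * nearAvg n α f k (proj y) + osc volume f k (proj y) +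
          C * nearAvg n α f k (proj y) := by
        rw [← enorm_neg (b - B), neg_sub]
        gcongr
    _ = _ := by push_cast; ring

/-- On cubes at height larger than their size the oscillation of the extension is controlled by its
Lipschitz estimate. -/
theorem exists_osc_whitneyExt_le_far (hψ : IsWhitneyBumps ψ) (hn : 1 ≤ n) (hα : -(n : ℝ) < α) :
    ∃ C : ℝ≥0, ∀ (f : E (Fin d) → ℂ) (k : ℕ) (y : E (Fin d ⊕ Fin n)),
      LocallyIntegrable (whitneyExt ψ f) (weightMeasure d n α) → 8 * 2 ^ (-(k : ℤ)) < height y →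
      osc (weightMeasure d n α) (whitneyExt ψ f) k y ≤ C * coarseOsc f k y := by
  obtain ⟨C, hC⟩ := exists_enorm_whitneyExt_sub_le hψ
  refine ⟨2 * C, fun f k y hF hy => iSup_le fun P' => ?_⟩
  have key : ∀ P, (cubeAt (k : ℤ) y).Neighbor P →
      ‖cubeAvg (weightMeasure d n α) (whitneyExt ψ f) P - whitneyExt ψ f y‖ₑ ≤
        C * coarseOsc f k y := by
    intro P hP
    have hint : IntegrableOn (whitneyExt ψ f) P.toSet (weightMeasure d n α) :=
      (hF.integrableOn_isCompact P.isBounded_toSet.isCompact_closure).mono_set subset_closure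
    have h0 := weightMeasure_toSet_ne_zero hn α P
    have ht := weightMeasure_toSet_ne_top hn hα P
    refine (enorm_cubeAvg_sub_le hint h0 ht _).trans ?_
    rw [← cubeLavg_const h0 ht (C * coarseOsc f k y)]
    refine cubeLavg_mono fun z hz => hC f k y z hy fun i => ?_
    rw [abs_sub_comm]
    exact abs_sub_le_of_neighbor hP (mem_cubeAt _ _) hz i
  have h1 := key _ (neighbor_self _)
  have h2 := key _ P'.2
  rw [← sub_sub_sub_cancel_right _ _ (whitneyExt ψ f y)]
  refine (enorm_sub_le).trans ((add_le_add h1 h2).trans (le_of_eq ?_))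
  push_cast; ring

theorem exists_osc_whitneyExt_le (hψ : IsWhitneyBumps ψ) (hn : 1 ≤ n) (hα : -(n : ℝ) < α) :
    ∃ C : ℝ≥0, ∀ (f : E (Fin d) → ℂ) (k : ℕ) (y : E (Fin d ⊕ Fin n)),
      LocallyIntegrable (whitneyExt ψ f) (weightMeasure d n α) →
      osc (weightMeasure d n α) (whitneyExt ψ f) k y ≤
        C * ((vert ⁻¹' slab n k).indicator (fun y => nearAvg n α f k (proj y)) y +
          coarseOsc f k y) := by
  obtain ⟨C₁, hC₁⟩ := exists_osc_whitneyExt_le_near (d := d) hψ hn hα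
  obtain ⟨C₂, hC₂⟩ := exists_osc_whitneyExt_le_far (d := d) hψ hn hα
  refine ⟨C₁ + 1 + C₂, fun f k y hF => ?_⟩
  have hkp : (0 : ℝ) < 2 ^ (-(k : ℤ)) := by positivity
  push_cast
  rcases le_or_gt (height y) (8 * 2 ^ (-(k : ℤ))) with h | h
  · have h16 : height y ≤ 16 * 2 ^ (-(k : ℤ)) := by linarith
    have hmem : y ∈ vert ⁻¹' slab n k := h16
    have h1 : osc volume f k (proj y) ≤ coarseOsc f k y := by
      refine (osc_le_extOsc _ _ _).trans ?_
      rw [← slabOsc_eq f h16]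
      refine le_trans (le_of_eq ?_) (Finset.single_le_sum
        (f := fun l : ℕ => (2 : ℝ≥0∞) ^ ((l : ℝ) - k) * slabOsc f l y) (fun _ _ => zero_le)
        (Finset.mem_range.2 (Nat.lt_succ_self k)))
      simp
    rw [Set.indicator_of_mem hmem]
    refine (hC₁ f k y hF h).trans ?_
    calc C₁ * nearAvg n α f k (proj y) + osc volume f k (proj y)
        ≤ C₁ * (nearAvg n α f k (proj y) + coarseOsc f k y) +
          1 * (nearAvg n α f k (proj y) + coarseOsc f k y) := by
          rw [one_mul]
          gcongr
          · exact le_self_add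
          · exact h1.trans le_add_self
      _ = (C₁ + 1) * (nearAvg n α f k (proj y) + coarseOsc f k y) := by ring
      _ ≤ _ := mul_le_mul' le_self_add le_rfl
  · refine (hC₂ f k y hF h).trans ?_
    gcongr
    · exact le_add_self
    · exact le_add_self

/-- The scales `l ≥ k - 4` enter through the layer of height about `2^{-k}` next to `ℝ^d`, the scales
`l ≤ k` through the layers of height about `2^{-l}`. -/
theorem exists_eLpNorm_osc_whitneyExt_le (hψ : IsWhitneyBumps ψ) (hn : 1 ≤ n) (hα : -(n : ℝ) < α)
    (hp : 1 ≤ p) :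
    ∃ C : ℝ≥0, ∀ (f : E (Fin d) → ℂ) (k : ℕ),
      LocallyIntegrable (whitneyExt ψ f) (weightMeasure d n α) →
      eLpNorm (osc (weightMeasure d n α) (whitneyExt ψ f) k) p (weightMeasure d n α) ≤
        C * (∑' l : ℕ, slabNorm n α p f (k - 4 + l) +
          ∑ l ∈ Finset.range (k + 1), (2 : ℝ≥0∞) ^ ((l : ℝ) - k) * slabNorm n α p f l) := by
  obtain ⟨C, hC⟩ := exists_osc_whitneyExt_le (d := d) hψ hn hα
  obtain ⟨C₁, hC₁⟩ := exists_eLpNorm_slab_le (d := d) hn hα p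
  obtain ⟨C₂, hC₂⟩ := exists_eLpNorm_coarseOsc_le (d := d) hn hα hp
  set r := (p⁻¹).toReal with hr
  have hr0 : 0 ≤ r := ENNReal.toReal_nonneg
  have hr1 : r ≤ 1 := toReal_inv_le_one hp
  refine ⟨C * (C₁ * (7 ^ d : ℕ) + C₂), fun f k hF => ?_⟩
  have hm1 : Measurable ((vert ⁻¹' slab n k).indicator
      fun y : E (Fin d ⊕ Fin n) => nearAvg n α f k (proj y)) :=
    ((measurable_nearAvg α f k).comp measurable_proj).indicator
      (measurable_vert (measurableSet_slab _))
  have hm2 := measurable_coarseOsc (d := d) (n := n) f k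
  set S₁ := ∑' l : ℕ, slabNorm n α p f (k - 4 + l)
  set S₂ := ∑ l ∈ Finset.range (k + 1), (2 : ℝ≥0∞) ^ ((l : ℝ) - k) * slabNorm n α p f l
  have h1 : eLpNorm ((vert ⁻¹' slab n k).indicator
      fun y : E (Fin d ⊕ Fin n) => nearAvg n α f k (proj y)) p (weightMeasure d n α) ≤
      C₁ * (7 ^ d : ℕ) * S₁ := by
    refine (hC₁ k _ (measurable_nearAvg α f k)).trans ?_
    rw [mul_assoc]
    refine mul_le_mul' le_rfl ?_
    refine (mul_le_mul' le_rfl (eLpNorm_nearAvg_le hp α f k)).trans ?_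
    rw [mul_left_comm, ← ENNReal.tsum_mul_left]
    refine mul_le_mul' le_rfl (ENNReal.tsum_le_tsum fun l => ?_)
    rw [slabNorm, ← mul_assoc, ← two_rpow_add]
    refine mul_le_mul' (ENNReal.rpow_le_rpow_of_exponent_le one_le_two ?_) le_rfl
    have h3 : ((k - 4 + l : ℕ) : ℝ) ≤ k + l := by exact_mod_cast (by omega : k - 4 + l ≤ k + l)
    have h4 : 0 ≤ (n : ℝ) + α := by linarith
    have h5 : (n + α) * r ≤ n + α := mul_le_of_le_one_right h4 hr1
    have h6 : 0 ≤ (n + α) * r := mul_nonneg h4 hr0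
    have h7 : (l : ℝ) * ((n + α) * r) ≤ l * (n + α) := by gcongr
    have h8 := mul_le_mul_of_nonneg_right h3 h6
    linarith
  calc eLpNorm (osc (weightMeasure d n α) (whitneyExt ψ f) k) p (weightMeasure d n α)
      ≤ eLpNorm (fun y => (C : ℝ≥0∞) *
          ((vert ⁻¹' slab n k).indicator (fun y => nearAvg n α f k (proj y)) y +
            coarseOsc f k y)) p (weightMeasure d n α) :=
        eLpNorm_mono_ennreal fun y => hC f k y hF
    _ ≤ C * (C₁ * (7 ^ d : ℕ) * S₁ + C₂ * S₂) := by
        refine (eLpNorm_const_mul_ennreal_le (hm1.add hm2) _).trans ?_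
        gcongr
        exact (eLpNorm_add_ennreal_le hp hm1 hm2).trans (add_le_add h1 (hC₂ f k))
    _ ≤ C * ((C₁ * (7 ^ d : ℕ) + C₂) * S₁ + (C₁ * (7 ^ d : ℕ) + C₂) * S₂) := by
        gcongr
        · exact le_self_add
        · exact le_add_self
    _ = _ := by push_cast; ring

/-- The contributions of the finer scales decay by the smoothness `s > 0`, those of the coarser
scales by `1 - s > 0`. -/
theorem exists_lq_slabNorm_le (hs0 : 0 < s) (hs1 : s < 1) (hq : 0 < q) :
    ∃ C : ℝ≥0, ∀ f : E (Fin d) → ℂ,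
      lq q (fun k : ℕ => (2 : ℝ≥0∞) ^ ((k : ℝ) * s) * (∑' l : ℕ, slabNorm n α p f (k - 4 + l) +
        ∑ l ∈ Finset.range (k + 1), (2 : ℝ≥0∞) ^ ((l : ℝ) - k) * slabNorm n α p f l)) ≤
        C * lq q (fun l : ℕ => (2 : ℝ≥0∞) ^ ((l : ℝ) * (s - (α + n) * (p⁻¹).toReal)) *
          eLpNorm (extOsc f l) p volume) := by
  set r := (p⁻¹).toReal
  set δ := min s (1 - s) with hδ
  have hδ0 : 0 < δ := lt_min hs0 (by linarith)
  have hδs : δ ≤ s := min_le_left _ _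
  have hδs' : δ ≤ 1 - s := min_le_right _ _
  obtain ⟨C, hC⟩ := exists_lq_le_of_le_tsum hq hδ0
  refine ⟨C * (2 ^ 8 + 1), fun f => ?_⟩
  set b : ℕ → ℝ≥0∞ := fun l => (2 : ℝ≥0∞) ^ ((l : ℝ) * (s - (α + n) * r)) *
    eLpNorm (extOsc f l) p volume with hb
  have hslab : ∀ (t : ℝ) (m : ℕ), (2 : ℝ≥0∞) ^ t * slabNorm n α p f m =
      (2 : ℝ≥0∞) ^ (t - m * s) * b m := by
    intro t m
    rw [hb, slabNorm]
    dsimp only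
    rw [← mul_assoc ((2 : ℝ≥0∞) ^ t), ← mul_assoc ((2 : ℝ≥0∞) ^ (t - m * s)), ← two_rpow_add,
      ← two_rpow_add]
    congr 2; ring
  have hcoef : lq q (fun k => (2 ^ 8 + 1 : ℝ≥0∞) * b k) ≤ (2 ^ 8 + 1) * lq q b :=
    lq_const_mul_le hq _ _
  refine le_trans (hC _ (fun k => (2 ^ 8 + 1 : ℝ≥0∞) * b k) fun k => ?_) ?_
  -- for `k - 4 ≤ l < k` the factor `2^{(k-l)s}` exceeds `2^{-|k-l|δ}`, by at most `2^8`
  · have hfine : (2 : ℝ≥0∞) ^ ((k : ℝ) * s) * ∑' l : ℕ, slabNorm n α p f (k - 4 + l) ≤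
        ∑' l : ℕ, (2 : ℝ≥0∞) ^ (-|(k : ℝ) - l| * δ) * (2 ^ 8 * b l) := by
      rw [← ENNReal.tsum_mul_left]
      refine le_trans (ENNReal.tsum_le_tsum fun l => ?_)
        (tsum_add_le_tsum (fun l : ℕ => (2 : ℝ≥0∞) ^ (-|(k : ℝ) - l| * δ) * (2 ^ 8 * b l)) (k - 4))
      rw [hslab, ← mul_assoc ((2 : ℝ≥0∞) ^ _) ((2 : ℝ≥0∞) ^ 8)]
      refine mul_le_mul' ?_ le_rfl
      rw [show (2 : ℝ≥0∞) ^ 8 = 2 ^ (8 : ℝ) by norm_num, ← two_rpow_add]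
      refine ENNReal.rpow_le_rpow_of_exponent_le one_le_two ?_
      have h4 : (k : ℝ) ≤ ((k - 4 + l : ℕ) : ℝ) + 4 := by
        exact_mod_cast (by omega : k ≤ (k - 4 + l) + 4)
      set m : ℝ := ((k - 4 + l : ℕ) : ℝ)
      rcases abs_cases ((k : ℝ) - m) with ⟨h5, h6⟩ | ⟨h5, h6⟩ <;> rw [h5] <;> nlinarith
    have hcoarse : (2 : ℝ≥0∞) ^ ((k : ℝ) * s) *
        ∑ l ∈ Finset.range (k + 1), (2 : ℝ≥0∞) ^ ((l : ℝ) - k) * slabNorm n α p f l ≤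
        ∑' l : ℕ, (2 : ℝ≥0∞) ^ (-|(k : ℝ) - l| * δ) * b l := by
      rw [Finset.mul_sum]
      refine le_trans (Finset.sum_le_sum fun l hl => ?_) (ENNReal.sum_le_tsum (Finset.range (k + 1)))
      rw [← mul_assoc, ← two_rpow_add, hslab]
      refine mul_le_mul' (ENNReal.rpow_le_rpow_of_exponent_le one_le_two ?_) le_rfl
      have h4 : (l : ℝ) ≤ k := by
        exact_mod_cast Nat.lt_succ_iff.1 (Finset.mem_range.1 hl)
      rw [abs_of_nonneg (by linarith)]
      nlinarith
    rw [mul_add]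
    refine (add_le_add hfine hcoarse).trans (le_of_eq ?_)
    rw [← ENNReal.tsum_add]
    exact tsum_congr fun l => by ring
  · calc (C : ℝ≥0∞) * lq q (fun k => (2 ^ 8 + 1 : ℝ≥0∞) * b k)
        ≤ C * ((2 ^ 8 + 1) * lq q b) := by gcongr
      _ = _ := by push_cast; ring

theorem lq_osc_le_besovNorm {ι : Type} [Fintype ι] (s : ℝ) (hp : 1 ≤ p) (q : ℝ≥0∞)
    (μ : Measure (E ι)) (f : E ι → ℂ) :
    lq q (fun k : ℕ => (2 : ℝ≥0∞) ^ ((k : ℝ) * s) * eLpNorm (osc μ f k) p μ) ≤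
      besovNorm s p q μ f := by
  rw [besovNorm]
  exact (lq_osc_le_besovEnergy s hp q μ f).trans le_add_self

theorem eLpNorm_le_besovNorm {ι : Type} [Fintype ι] (s : ℝ) (p q : ℝ≥0∞) (μ : Measure (E ι))
    (f : E ι → ℂ) : eLpNorm f p μ ≤ besovNorm s p q μ f := by
  rw [besovNorm]
  exact le_self_add

theorem lq_extOsc_le (hp : 1 ≤ p) (hq : 0 < q) {C : ℝ≥0}
    (hC : ∀ a b : ℕ → ℝ≥0∞, lq q (fun k => a k + b k) ≤ C * (lq q a + lq q b))
    {f : E (Fin d) → ℂ} (hf : AEStronglyMeasurable f volume) :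
    lq q (fun l : ℕ => (2 : ℝ≥0∞) ^ ((l : ℝ) * σ) * eLpNorm (extOsc f l) p volume) ≤
      C * ((1 + 14 ^ d : ℕ) * besovNorm σ p q volume f) := by
  let a : ℕ → ℝ≥0∞ := fun l =>
    (2 : ℝ≥0∞) ^ ((l : ℝ) * σ) * eLpNorm (osc volume f l) p volume
  let c : ℝ≥0∞ := ((14 ^ d : ℕ) : ℝ≥0∞) * eLpNorm f p volume
  let b : ℕ → ℝ≥0∞ := fun l => if l = 0 then c else 0
  have h1 : ∀ l : ℕ, (2 : ℝ≥0∞) ^ ((l : ℝ) * σ) * eLpNorm (extOsc f l) p volume ≤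
      a l + b l := by
    intro l
    have h := mul_le_mul_right (eLpNorm_extOsc_le hp hf l) ((2 : ℝ≥0∞) ^ ((l : ℝ) * σ))
    refine h.trans (le_of_eq ?_)
    rw [mul_add]
    refine congrArg (a l + ·) ?_
    change _ * (if l = 0 then c else 0) = if l = 0 then c else 0
    split_ifs with hl
    · rw [hl, Nat.cast_zero, zero_mul, ENNReal.rpow_zero, one_mul]
    · rw [mul_zero]
  have h2 := lq_osc_le_besovNorm σ hp q volume f
  have h3 := (lq_single_le hq c).trans
    (mul_le_mul_right (eLpNorm_le_besovNorm σ p q volume f) ((14 ^ d : ℕ) : ℝ≥0∞))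
  refine (lq_mono h1).trans ((hC a b).trans (mul_le_mul_right ?_ _))
  rw [Nat.cast_add, Nat.cast_one, add_mul, one_mul]
  exact add_le_add h2 h3

/-- The Whitney extension is bounded from the Besov space on `ℝ^d` to the weighted Besov space. -/
theorem exists_besovNorm_whitneyExt_le (hψ : IsWhitneyBumps ψ) (hn : 1 ≤ n) (hs0 : 0 < s)
    (hs1 : s < 1) (hp : 1 ≤ p) (hq : 0 < q) (hα : -(n : ℝ) < α)
    (hσ : 0 < s - (α + n) * (p⁻¹).toReal) :
    ∃ C : ℝ≥0, ∀ f : E (Fin d) → ℂ, AEStronglyMeasurable f volume →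
      besovNorm (s - (α + n) * (p⁻¹).toReal) p q volume f < ∞ →
      besovNorm s p q (weightMeasure d n α) (whitneyExt ψ f) ≤
        C * besovNorm (s - (α + n) * (p⁻¹).toReal) p q volume f := by
  obtain ⟨C₀, hC₀⟩ := exists_eLpNorm_whitneyExt_le (d := d) hψ hn hα hp hq hσ
  obtain ⟨C₁, hC₁⟩ := exists_eLpNorm_osc_whitneyExt_le (d := d) hψ hn hα hp
  obtain ⟨C₂, hC₂⟩ := exists_lq_slabNorm_le (d := d) (n := n) (α := α) (p := p) hs0 hs1 hq
  obtain ⟨C₃, hC₃⟩ := exists_lq_add_le hq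
  set σ := s - (α + n) * (p⁻¹).toReal with hσdef
  set N : ℕ := 3 * 5 ^ Fintype.card (Fin d ⊕ Fin n)
  refine ⟨C₀ + N * (C₁ * (C₂ * (C₃ * (1 + 14 ^ d : ℕ)))), fun f hf hfin => ?_⟩
  have hF := locallyIntegrable_whitneyExt hψ hn hα hp hq hσ hf hfin
  set M := besovNorm σ p q volume f with hM
  have hext := lq_extOsc_le (σ := σ) hp hq hC₃ hf
  have henergy : besovEnergy s p q (weightMeasure d n α) (whitneyExt ψ f) ≤
      N * (C₁ * (C₂ * (C₃ * ((1 + 14 ^ d : ℕ) * M)))) := by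
    refine (besovEnergy_le_lq_osc s hp hq (weightMeasure_toSet_ne_zero hn α) _).trans ?_
    refine mul_le_mul_right ?_ _
    refine (lq_mono fun k => ?_).trans ((lq_const_mul_le hq (C₁ : ℝ≥0∞) (fun k : ℕ =>
      (2 : ℝ≥0∞) ^ ((k : ℝ) * s) * (∑' l : ℕ, slabNorm n α p f (k - 4 + l) +
        ∑ l ∈ Finset.range (k + 1), (2 : ℝ≥0∞) ^ ((l : ℝ) - k) * slabNorm n α p f l))).trans ?_)
    · rw [mul_left_comm]
      exact mul_le_mul_right (hC₁ f k hF) _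
    · exact mul_le_mul_right ((hC₂ f).trans (mul_le_mul_right hext _)) _
  rw [besovNorm]
  refine (add_le_add (hC₀ f hf) henergy).trans (le_of_eq ?_)
  push_cast; ring

/-! ### The trace of the extension -/

theorem tsum_eLpNorm_nearAvg_ne_top (hp : 1 ≤ p) (hq : 0 < q) (hα : -(n : ℝ) < α) (hσ : 0 < σ)
    {f : E (Fin d) → ℂ} (hf : AEStronglyMeasurable f volume)
    (hfin : besovNorm σ p q volume f < ∞) :
    ∑' k : ℕ, eLpNorm (nearAvg n α f k) p volume ≠ ∞ := by
  have hM := hfin.ne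
  have hext := fun l => eLpNorm_extOsc_le_besovNorm (σ := σ) hp hq hf l
  generalize besovNorm σ p q volume f = M at hM hext
  set S := ∑' l : ℕ, (2 : ℝ≥0∞) ^ (-(l : ℝ) * (n + α)) with hS
  have hSt : S ≠ ∞ := tsum_two_rpow_ne_top (by linarith)
  have hnorm : ∀ k : ℕ, eLpNorm (nearAvg n α f k) p volume ≤
      ((7 ^ d : ℕ) : ℝ≥0∞) * (S * (((1 + 14 ^ d : ℕ) : ℝ≥0∞) * (2 ^ (4 * σ) * M))) *
        (2 : ℝ≥0∞) ^ (-(k : ℝ) * σ) := by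
    intro k
    refine (eLpNorm_nearAvg_le hp α f k).trans ?_
    have hk : ∀ l : ℕ, eLpNorm (extOsc f (k - 4 + l)) p volume ≤
        ((1 + 14 ^ d : ℕ) : ℝ≥0∞) * (2 ^ (4 * σ) * M) * 2 ^ (-(k : ℝ) * σ) := by
      intro l
      have h1 : (2 : ℝ≥0∞) ^ (-((k - 4 + l : ℕ) : ℝ) * σ) ≤ 2 ^ (4 * σ) * 2 ^ (-(k : ℝ) * σ) := by
        rw [← two_rpow_add]
        refine ENNReal.rpow_le_rpow_of_exponent_le one_le_two ?_
        have h4 : (k : ℝ) ≤ ((k - 4 + l : ℕ) : ℝ) + 4 := by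
          exact_mod_cast (by omega : k ≤ (k - 4 + l) + 4)
        nlinarith
      refine (hext _).trans ((mul_le_mul_right (mul_le_mul_left h1 M) _).trans (le_of_eq ?_))
      ring
    refine (mul_le_mul_right (ENNReal.tsum_le_tsum fun l => mul_le_mul_right (hk l) _) _).trans
      (le_of_eq ?_)
    rw [ENNReal.tsum_mul_right]
    ring
  refine ne_top_of_le_ne_top ?_ (ENNReal.tsum_le_tsum hnorm)
  rw [ENNReal.tsum_mul_left]
  have h1 := tsum_two_rpow_ne_top hσ
  have h2 := two_rpow_ne_top (4 * σ)
  finiteness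

end ExtBound

end WhitneyTrace

namespace WhitneyTrace
open DyadicCube

section TraceExt

variable {d n : ℕ} {s σ : ℝ} {p q : ℝ≥0∞} {α : ℝ}
  {ψ : DyadicCube (Fin d ⊕ Fin n) → E (Fin d ⊕ Fin n) → ℝ}

/-- The averages of the extension above `x` and the averages of `f` around `x` have the same limit,
provided that the oscillations of `f` at the scales `≥ k - 4` tend to zero near `x`. -/
theorem tendsto_upAvg_whitneyExt_sub (hψ : IsWhitneyBumps ψ) (hn : 1 ≤ n) (hα : -(n : ℝ) < α)
    {f : E (Fin d) → ℂ} (hF : LocallyIntegrable (whitneyExt ψ f) (weightMeasure d n α))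
    {x : E (Fin d)} (hx : Tendsto (fun k : ℕ => nearAvg n α f k x) atTop (𝓝 0)) :
    Tendsto (fun k : ℕ => upAvg (weightMeasure d n α) (whitneyExt ψ f) k x -
      cubeAvg volume f (cubeAt (k : ℤ) x)) atTop (𝓝 0) := by
  obtain ⟨C, hC⟩ := exists_enorm_cubeAvg_whitneyExt_sub_le (d := d) hψ hn hα
  have hlim := ENNReal.Tendsto.const_mul (a := (C : ℝ≥0∞)) hx (Or.inr ENNReal.coe_ne_top)
  rw [mul_zero] at hlim
  rw [tendsto_zero_iff_enorm_tendsto_zero]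
  refine tendsto_of_tendsto_of_tendsto_of_le_of_le tendsto_const_nhds hlim (fun _ => zero_le)
    fun k => ?_
  have hkp : (0 : ℝ) < 2 ^ (-(k : ℤ)) := by positivity
  refine hC f k x (cubeUp n (cubeAt k x)) hF (by simp [cubeUp]) (by simp [cubeUp])
    (fun z hz => ?_) (neighbor_self _)
  refine (height_le_iff (by positivity)).2 fun j => ?_
  have := hz (Sum.inr j)
  simp only [cubeUp, DyadicCube.side, cubeAt_scale, Sum.elim_inr, Int.cast_zero, mul_zero,
    zero_add, mul_one] at this
  rw [abs_le]
  constructor <;> linarith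

/-- The trace of the Whitney extension of `f` is `f`. -/
theorem ae_trace_whitneyExt (hψ : IsWhitneyBumps ψ) (hn : 1 ≤ n) (hs0 : 0 < s)
    (hs1 : s < 1) (hp : 1 ≤ p) (hq : 0 < q) (hα : -(n : ℝ) < α)
    (hσ : 0 < s - (α + n) * (p⁻¹).toReal) {f : E (Fin d) → ℂ} (hf : MemLp f p volume)
    (hfin : besovNorm (s - (α + n) * (p⁻¹).toReal) p q volume f < ∞) :
    ∀ᵐ x : E (Fin d), trace (weightMeasure d n α) (whitneyExt ψ f) x = f x := by
  obtain ⟨C₁, hC₁⟩ := exists_besovNorm_whitneyExt_le (d := d) hψ hn hs0 hs1 hp hq hα hσ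
  have hF := locallyIntegrable_whitneyExt hψ hn hα hp hq hσ hf.1 hfin
  have hFmem := memLp_whitneyExt hψ hn hα hp hq hσ hf.1 hfin
  have hFfin := ((hC₁ f hf.1 hfin).trans_lt (ENNReal.mul_lt_top ENNReal.coe_lt_top hfin)).ne
  have hsum := tsum_eLpNorm_nearAvg_ne_top hp hq hα hσ hf.1 hfin
  have hnear := ae_tendsto_zero_of_tsum_eLpNorm_ne_top hp (fun k => measurable_nearAvg α f k) hsum
  have havg := ae_tendsto_average_cube (hf.locallyIntegrable hp)
  have hball := ae_tendsto_ballAverage hn hs0 hp hq hα hσ hFmem hFfin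
  filter_upwards [hnear, havg, hball] with x hx0 hxf hxF
  have hxf' : Tendsto (fun k : ℕ => cubeAvg volume f (cubeAt (k : ℤ) x)) atTop (𝓝 (f x)) := hxf
  have hlim := (tendsto_upAvg_whitneyExt_sub hψ hn hα hF hx0).add hxf'
  simp only [zero_add, sub_add_cancel] at hlim
  exact tendsto_nhds_unique hxF.1 hlim

/-! ### Membership in the Besov spaces -/

theorem smoothness_pos (hs0 : 0 < s) (hp : 1 ≤ p) (hα : p ≠ ∞ → α < s * p.toReal - n) :
    0 < s - (α + n) * (p⁻¹).toReal := by
  by_cases hpt : p = ∞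
  · simpa [hpt] using hs0
  · have hp0 : 0 < p.toReal := ENNReal.toReal_pos (zero_lt_one.trans_le hp).ne' hpt
    have h := hα hpt
    rw [ENNReal.toReal_inv, ← div_eq_mul_inv, sub_pos, div_lt_iff₀ hp0]
    linarith

theorem whitneyExt_mem_besovSpace (hψ : IsWhitneyBumps ψ) (hn : 1 ≤ n) (hs0 : 0 < s)
    (hs1 : s < 1) (hp : 1 ≤ p) (hq : 0 < q) (hα : -(n : ℝ) < α)
    (hσ : 0 < s - (α + n) * (p⁻¹).toReal) {f : E (Fin d) → ℂ}
    (hf : f ∈ besovSpace (s - (α + n) * (p⁻¹).toReal) p q volume) :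
    whitneyExt ψ f ∈ besovSpace s p q (weightMeasure d n α) := by
  obtain ⟨-, hfp, hfin⟩ := hf
  obtain ⟨C, hC⟩ := exists_besovNorm_whitneyExt_le (d := d) hψ hn hs0 hs1 hp hq hα hσ
  -- Lebesgue measure is the weighted measure with exponent `0`
  have hn0 : -(n : ℝ) < 0 := by
    have : (1 : ℝ) ≤ n := by exact_mod_cast hn
    linarith
  have hloc := locallyIntegrable_whitneyExt hψ hn hn0 hp hq hσ hfp.1 hfin
  rw [weightMeasure_zero] at hloc
  exact ⟨hloc, memLp_whitneyExt hψ hn hα hp hq hσ hfp.1 hfin,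
    (hC f hfp.1 hfin).trans_lt (ENNReal.mul_lt_top ENNReal.coe_lt_top hfin)⟩

theorem memLp_trace_and_besovNorm_lt_top (hn : 1 ≤ n) (hs0 : 0 < s) (hp : 1 ≤ p) (hq : 0 < q)
    (hα : -(n : ℝ) < α) (hσ : 0 < s - (α + n) * (p⁻¹).toReal) {f : E (Fin d ⊕ Fin n) → ℂ}
    (hf : f ∈ besovSpace s p q (weightMeasure d n α)) :
    MemLp (trace (weightMeasure d n α) f) p volume ∧
      besovNorm (s - (α + n) * (p⁻¹).toReal) p q volume (trace (weightMeasure d n α) f) < ∞ := by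
  obtain ⟨-, hfp, hfin⟩ := hf
  obtain ⟨C, hC⟩ := exists_besovNorm_trace_le (d := d) hn hs0 hp hq hα hσ
  have hlt := (hC f hfp hfin.ne).trans_lt (ENNReal.mul_lt_top ENNReal.coe_lt_top hfin)
  have hle := eLpNorm_le_besovNorm (s - (α + n) * (p⁻¹).toReal) p q volume
    (trace (weightMeasure d n α) f)
  have hlim := ae_tendsto_ballAverage hn hs0 hp hq hα hσ hfp hfin.ne
  have hmeas := aestronglyMeasurable_trace (hlim.mono fun x hx => hx.1)
  exact ⟨⟨hmeas, hle.trans_lt hlt⟩, hlt⟩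

end TraceExt

end WhitneyTrace

theorem mainTheorem5 (d n : ℕ) (hd : 1 ≤ d) (hn : 1 ≤ n)
    (s : ℝ) (hs0 : 0 < s) (hs1 : s < 1)
    (p : ℝ≥0∞) (hp : 1 ≤ p) (q : ℝ≥0∞) (hq : 0 < q)
    (α : ℝ) (hα : -(n : ℝ) < α) (hα' : p ≠ ∞ → α < s * p.toReal - n)
    (ψ : WhitneyTrace.DyadicCube (Fin d ⊕ Fin n) →
      WhitneyTrace.E (Fin d ⊕ Fin n) → ℝ)
    (hψ : WhitneyTrace.IsWhitneyBumps ψ) :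
    WhitneyTrace.IsWhitneyTraceExtensionPair ψ (WhitneyTrace.weightMeasure d n α)
      (WhitneyTrace.besovSpace (s - (α + n) * (p⁻¹).toReal) p q
        (volume : Measure (WhitneyTrace.E (Fin d))))
      (WhitneyTrace.besovNorm (s - (α + n) * (p⁻¹).toReal) p q
        (volume : Measure (WhitneyTrace.E (Fin d))))
      (WhitneyTrace.besovSpace s p q (WhitneyTrace.weightMeasure d n α))
      (WhitneyTrace.besovNorm s p q (WhitneyTrace.weightMeasure d n α)) := by
  have hσ := WhitneyTrace.smoothness_pos hs0 hp hα'
  obtain ⟨C, hC⟩ := WhitneyTrace.exists_besovNorm_whitneyExt_le (d := d) hψ hn hs0 hs1 hp hq hα hσ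
  obtain ⟨K, hK⟩ := WhitneyTrace.exists_besovNorm_trace_le (d := d) hn hs0 hp hq hα hσ
  have hmem := fun f hf =>
    WhitneyTrace.memLp_trace_and_besovNorm_lt_top (d := d) (f := f) hn hs0 hp hq hα hσ hf
  exact
    { ext_mem := fun f hf => WhitneyTrace.whitneyExt_mem_besovSpace hψ hn hs0 hs1
        hp hq hα hσ hf
      ext_bounded := ⟨C, fun f hf => hC f hf.2.1.1 hf.2.2⟩
      trace_exists := fun f hf => by
        filter_upwards [WhitneyTrace.ae_tendsto_ballAverage hn hs0 hp hq hα hσ hf.2.1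
          hf.2.2.ne] with x hx
        exact ⟨_, hx.2⟩
      trace_locallyIntegrable := fun f hf => (hmem f hf).1.locallyIntegrable hp
      trace_mem := fun f hf => ⟨(hmem f hf).1.locallyIntegrable hp, hmem f hf⟩
      trace_bounded := ⟨K, fun f hf => hK f hf.2.1 hf.2.2.ne⟩
      trace_ext := fun f hf => WhitneyTrace.ae_trace_whitneyExt hψ hn hs0 hs1 hp hq hα hσ
        hf.2.1 hf.2.2 }
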